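/- Let $N\in\mathbb N$, $s\in(0,1)$, $N>2s$, $2^*_s=\frac{2N}{N-2s}$ and $\varepsilon>0$. Let $V,W:\mathbb R^N\to\mathbb R$ be continuous, $V_0=\inf V$, $W_0=\inf W$, $V_\infty=\liminf_{|x|\to\infty}V(x)$, $W_\infty=\liminf_{|x|\to\infty}W(x)$ (values in $(-\infty,\infty]$), and assume $V_0=W_0>0$, $\{x: V(x)=W(x)=V_0\}\neq\emptyset$, and $V_0<\max\{V_\infty,W_\infty\}$. Let $Q\in C^1([0,\infty)^2)\cap C^2((0,\infty)^2)$ be real valued and satisfy, for some $q\in(2,2^*_s)$: $Q(tu,tv)=t^qQ(u,v)$ for all $t>0$, $u,v\ge0$; $|Q_u(u,v)|+|Q_v(u,v)|\le C(u^{q-1}+v^{q-1})$ for all $u,v\ge0$ and some $C>0$; $Q_u(0,1)=Q_v(1,0)=Q_u(1,0)=Q_v(0,1)=0$; $Q_{uv}(u,v)>0$ for all $u,v>0$. Extend $Q$ to $\mathbb R^2$ by $Q(u,v)=0$ if $u\le0$ or $v\le0$. Write $[u]^2=\iint_{\mathbb R^{2N}}\frac{|u(x)-u(y)|^2}{|x-y|^{N+2s}}\,dx\,dy$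 and $H^s(\mathbb R^N)=\{u\in L^2(\mathbb R^N):[u]^2<\infty\}$ (real-valued functions). Let $$\mathbb X_\varepsilon=\Big\{(u,v)\in H^s(\mathbb R^N)^2:\int_{\mathbb R^N}(V(\varepsilon x)u^2+W(\varepsilon x)v^2)\,dx<\infty\Big\},\qquad \|(u,v)\|_\varepsilon^2=[u]^2+[v]^2+\int_{\mathbb R^N}(V(\varepsilon x)u^2+W(\varepsilon x)v^2)\,dx,$$ $$\mathcal J_\varepsilon(u,v)=\tfrac12\|(u,v)\|_\varepsilon^2-\int_{\mathbb R^N}Q(u,v)\,dx,\qquad \mathcal N_\varepsilon=\{w\in\mathbb X_\varepsilon\setminus\{0\}:\langle\mathcal J_\varepsilon'(w),w\rangle=0\}.$$ Let $\mathbb X_0=H^s(\mathbb R^N)^2$ with the norm $\|(u,v)\|_0^2=[u]^2+[v]^2+\int_{\mathbb R^N}(V_0u^2+W_0v^2)\,dx$. If $V_\infty,W_\infty<\infty$, put $\mathcal J_\infty(u,v)=\frac12\big([u]^2+[v]^2+\int_{\mathbb R^N}(V_\infty u^2+W_\infty v^2)\,dx\big)-\int_{\mathbb R^N}Q(u,v)\,dx$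 on $\mathbb X_0$, $\mathcal N_\infty=\{w\in\mathbb X_0\setminus\{0\}:\langle\mathcal J_\infty'(w),w\rangle=0\}$ and $c_\infty=\inf_{\mathcal N_\infty}\mathcal J_\infty$; if $\max\{V_\infty,W_\infty\}=\infty$, put $c_\infty=\infty$. Then $\mathcal J_\varepsilon$ and $\mathcal G_\varepsilon(w)=\langle\mathcal J_\varepsilon'(w),w\rangle$ are of class $C^1$ on $\mathbb X_\varepsilon$; for $w\in\mathcal N_\varepsilon$ let $\mathcal J_\varepsilon'(w)|_{\mathcal N_\varepsilon}$ denote the restriction of $\mathcal J_\varepsilon'(w)$ to the tangent space $\ker\mathcal G_\varepsilon'(w)$, and $\|\cdot\|_*$ the dual norm on that space. Moreover: 1. $\mathcal J_\varepsilon$ constrained to $\mathcal N_\varepsilon$ satisfies the Palais–Smale condition at every level $d\in\mathbb R$ with $d<c_\infty$: every sequence $(w_n)\subset\mathcal N_\varepsilon$ with $\mathcal J_\varepsilon(w_n)\to d$ and $\|\mathcal J_\varepsilon'(w_n)|_{\mathcal N_\varepsilon}\|_*\to0$ has a subsequence converging in $\mathbb X_\varepsilon$ to a point of $\mathcal N_\varepsilon$.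 2. Every critical point of $\mathcal J_\varepsilon$ constrained to $\mathcal N_\varepsilon$ (that is, $w\in\mathcal N_\varepsilon$ with $\mathcal J_\varepsilon'(w)|_{\mathcal N_\varepsilon}=0$) is a critical point of $\mathcal J_\varepsilon$ in $\mathbb X_\varepsilon$: $\mathcal J_\varepsilon'(w)=0$. -/

import Mathlib

open MeasureTheory Filter Topology

noncomputable section

namespace FracSystem

/-- The Euclidean space `ℝ^N`. -/
abbrev Rn (N : ℕ) : Type := EuclideanSpace ℝ (Fin N)

/-- Real `L²(ℝ^N)` with respect to the Lebesgue measure. -/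
abbrev L2 (N : ℕ) : Type := Lp ℝ 2 (volume : Measure (Rn N))

/-! ### Fractional Sobolev space -/

/-- The integrand `(u(x) - u(y)) (φ(x) - φ(y)) / |x - y|^{N + 2s}` at `p = (x, y)`. -/
def gagliardoDensity {N : ℕ} (s : ℝ) (u φ : Rn N → ℝ) (p : Rn N × Rn N) : ℝ :=
  (u p.1 - u p.2) * (φ p.1 - φ p.2) / ‖p.1 - p.2‖ ^ ((N : ℝ) + 2 * s)

/-- The bilinear form `∬ (u(x) - u(y)) (φ(x) - φ(y)) / |x - y|^{N + 2s} dx dy`; its diagonal is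
`∫ |(-Δ)^{s/2} u|² dx` (in the normalisation in which the dimensional constant is one). -/
def gagliardoForm {N : ℕ} (s : ℝ) (u φ : Rn N → ℝ) : ℝ :=
  ∫ p : Rn N × Rn N, gagliardoDensity s u φ p

theorem measurable_coe {N : ℕ} (u : L2 N) : Measurable (u : Rn N → ℝ) :=
  (Lp.stronglyMeasurable u).measurable

theorem measurable_gagliardoDensity {N : ℕ} (s : ℝ) {u φ : Rn N → ℝ} (hu : Measurable u)
    (hφ : Measurable φ) : Measurable (gagliardoDensity s u φ) := by
  unfold gagliardoDensity
  have h1 : Measurable fun p : Rn N × Rn N => ‖p.1 - p.2‖ :=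
    (measurable_fst.sub measurable_snd).norm
  exact (((hu.comp measurable_fst).sub (hu.comp measurable_snd)).mul
    ((hφ.comp measurable_fst).sub (hφ.comp measurable_snd))).div (h1.pow_const _)

theorem integrable_gagliardoDensity {N : ℕ} (s : ℝ) {u φ : Rn N → ℝ} (hu : Measurable u)
    (hφ : Measurable φ) (hu' : Integrable (gagliardoDensity s u u))
    (hφ' : Integrable (gagliardoDensity s φ φ)) : Integrable (gagliardoDensity s u φ) := by
  refine (hu'.add hφ').mono' (measurable_gagliardoDensity s hu hφ).aestronglyMeasurable
    (Eventually.of_forall fun p => ?_)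
  simp only [gagliardoDensity, Pi.add_apply]
  have hd : 0 ≤ ‖p.1 - p.2‖ ^ ((N : ℝ) + 2 * s) := Real.rpow_nonneg (norm_nonneg _) _
  rw [Real.norm_eq_abs, abs_div, abs_of_nonneg hd, ← add_div]
  refine div_le_div_of_nonneg_right ?_ hd
  rw [abs_le]
  constructor <;>
    nlinarith [sq_nonneg (u p.1 - u p.2 + (φ p.1 - φ p.2)),
      sq_nonneg (u p.1 - u p.2 - (φ p.1 - φ p.2)), sq_nonneg (u p.1 - u p.2),
      sq_nonneg (φ p.1 - φ p.2)]

theorem ae_prod_of_ae {N : ℕ} {P : Rn N → Prop} (h : ∀ᵐ x, P x) :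
    ∀ᵐ p : Rn N × Rn N, P p.1 ∧ P p.2 := by
  have h1 : ∀ᵐ p : Rn N × Rn N, P p.1 := Measure.quasiMeasurePreserving_fst.ae h
  have h2 : ∀ᵐ p : Rn N × Rn N, P p.2 := Measure.quasiMeasurePreserving_snd.ae h
  exact h1.and h2

theorem gagliardoDensity_add_ae {N : ℕ} (s : ℝ) (u v : L2 N) (φ : Rn N → ℝ) :
    gagliardoDensity s (u + v : L2 N) φ =ᵐ[volume]
      fun p => gagliardoDensity s u φ p + gagliardoDensity s v φ p := by
  filter_upwards [ae_prod_of_ae (Lp.coeFn_add u v)] with p hp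
  simp only [gagliardoDensity, hp.1, hp.2, Pi.add_apply]
  ring

theorem gagliardoDensity_smul_ae {N : ℕ} (s c : ℝ) (u : L2 N) (φ : Rn N → ℝ) :
    gagliardoDensity s (c • u : L2 N) φ =ᵐ[volume] fun p => c * gagliardoDensity s u φ p := by
  filter_upwards [ae_prod_of_ae (Lp.coeFn_smul c u)] with p hp
  simp only [gagliardoDensity, hp.1, hp.2, Pi.smul_apply, smul_eq_mul]
  ring

theorem gagliardoDensity_comm {N : ℕ} (s : ℝ) (u φ : Rn N → ℝ) :
    gagliardoDensity s u φ = gagliardoDensity s φ u := by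
  funext p
  simp only [gagliardoDensity]
  ring

/-- The fractional Sobolev space `H^s(ℝ^N)`: the `u ∈ L²` with
`∬ |u(x) - u(y)|² / |x - y|^{N + 2s} dx dy < ∞`. -/
def Hs (N : ℕ) (s : ℝ) : Submodule ℝ (L2 N) where
  carrier := {u | Integrable (gagliardoDensity s (u : Rn N → ℝ) u)}
  zero_mem' := by
    have h := gagliardoDensity_smul_ae s 0 (0 : L2 N) ((0 : L2 N) : Rn N → ℝ)
    simp only [zero_smul, zero_mul] at h
    exact (integrable_congr h).2 (integrable_zero _ _ _)
  add_mem' := by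
    intro u v hu hv
    have huv := integrable_gagliardoDensity s (measurable_coe u) (measurable_coe v) hu hv
    have h1 : Integrable (gagliardoDensity s (u + v : L2 N) u) := by
      refine (integrable_congr (gagliardoDensity_add_ae s u v _)).2 (Integrable.add hu ?_)
      rwa [gagliardoDensity_comm]
    have h2 : Integrable (gagliardoDensity s (u + v : L2 N) v) :=
      (integrable_congr (gagliardoDensity_add_ae s u v _)).2 (huv.add hv)
    refine (integrable_congr (gagliardoDensity_add_ae s u v _)).2 (Integrable.add ?_ ?_)
    · rwa [gagliardoDensity_comm]
    · rwa [gagliardoDensity_comm]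
  smul_mem' := by
    intro c u hu
    refine (integrable_congr (gagliardoDensity_smul_ae s c u _)).2 (Integrable.const_mul ?_ c)
    rw [gagliardoDensity_comm]
    exact (integrable_congr (gagliardoDensity_smul_ae s c u _)).2 (Integrable.const_mul hu c)

/-! ### Potentials and energy spaces -/

/-- A continuous potential with positive infimum (since an infimum that is not finite has the
value `0` here, boundedness from below is part of the condition). -/
structure IsPotential {N : ℕ} (a : Rn N → ℝ) : Prop where
  continuous : Continuous a
  iInf_pos : 0 < ⨅ x, a x

theorem IsPotential.pos {N : ℕ} {a : Rn N → ℝ} (ha : IsPotential a) (x : Rn N) : 0 < a x := by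
  have hb : BddBelow (Set.range a) := by
    by_contra h
    have := ha.iInf_pos
    rw [Real.iInf_of_not_bddBelow h] at this
    exact lt_irrefl _ this
  exact ha.iInf_pos.trans_le (ciInf_le hb x)

theorem IsPotential.rescale {N : ℕ} {a : Rn N → ℝ} (ha : IsPotential a) {ε : ℝ} (hε : 0 < ε) :
    IsPotential fun x => a (ε • x) where
  continuous := ha.continuous.comp (continuous_const_smul ε)
  iInf_pos := by
    have hs : Function.Surjective fun x : Rn N => ε • x := fun y =>
      ⟨ε⁻¹ • y, by simp [smul_smul, hε.ne']⟩
    have := hs.iInf_comp a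
    rw [this]
    exact ha.iInf_pos

theorem IsPotential.const {N : ℕ} {c : ℝ} (hc : 0 < c) : IsPotential fun _ : Rn N => c where
  continuous := continuous_const
  iInf_pos := by rwa [ciInf_const]

/-- The integrand `a u φ + b v ψ`. -/
def potentialDensity {N : ℕ} (a b : Rn N → ℝ) (u v φ ψ : Rn N → ℝ) (x : Rn N) : ℝ :=
  a x * (u x * φ x) + b x * (v x * ψ x)

/-- The bilinear form `∫ (a u φ + b v ψ) dx`. -/
def potentialForm {N : ℕ} (a b : Rn N → ℝ) (u v φ ψ : Rn N → ℝ) : ℝ :=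
  ∫ x, potentialDensity a b u v φ ψ x

section

variable {N : ℕ} {a b : Rn N → ℝ}

theorem integrable_potentialDensity (ha : IsPotential a) (hb : IsPotential b)
    {u v φ ψ : Rn N → ℝ} (hu : Measurable u) (hv : Measurable v) (hφ : Measurable φ)
    (hψ : Measurable ψ) (h1 : Integrable (potentialDensity a b u v u v))
    (h2 : Integrable (potentialDensity a b φ ψ φ ψ)) :
    Integrable (potentialDensity a b u v φ ψ) := by
  have hm : Measurable (potentialDensity a b u v φ ψ) :=
    (ha.continuous.measurable.mul (hu.mul hφ)).add (hb.continuous.measurable.mul (hv.mul hψ))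
  refine (h1.add h2).mono' hm.aestronglyMeasurable (Eventually.of_forall fun x => ?_)
  simp only [potentialDensity, Pi.add_apply]
  have hax := (ha.pos x).le
  have hbx := (hb.pos x).le
  rw [Real.norm_eq_abs, abs_le]
  constructor <;>
    nlinarith [mul_nonneg hax (sq_nonneg (u x + φ x)), mul_nonneg hax (sq_nonneg (u x - φ x)),
      mul_nonneg hbx (sq_nonneg (v x + ψ x)), mul_nonneg hbx (sq_nonneg (v x - ψ x)),
      mul_nonneg hax (sq_nonneg (u x)), mul_nonneg hax (sq_nonneg (φ x)),
      mul_nonneg hbx (sq_nonneg (v x)), mul_nonneg hbx (sq_nonneg (ψ x))]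

theorem potentialDensity_add_ae (a b : Rn N → ℝ) (w z : L2 N × L2 N) (φ ψ : Rn N → ℝ) :
    potentialDensity a b (w + z).1 (w + z).2 φ ψ =ᵐ[volume]
      fun x => potentialDensity a b w.1 w.2 φ ψ x + potentialDensity a b z.1 z.2 φ ψ x := by
  filter_upwards [Lp.coeFn_add w.1 z.1, Lp.coeFn_add w.2 z.2] with x h1 h2
  simp only [potentialDensity, Prod.fst_add, Prod.snd_add, h1, h2, Pi.add_apply]
  ring

theorem potentialDensity_smul_ae (a b : Rn N → ℝ) (c : ℝ) (w : L2 N × L2 N) (φ ψ : Rn N → ℝ) :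
    potentialDensity a b (c • w).1 (c • w).2 φ ψ =ᵐ[volume]
      fun x => c * potentialDensity a b w.1 w.2 φ ψ x := by
  filter_upwards [Lp.coeFn_smul c w.1, Lp.coeFn_smul c w.2] with x h1 h2
  simp only [potentialDensity, Prod.smul_fst, Prod.smul_snd, h1, h2, Pi.smul_apply, smul_eq_mul]
  ring

theorem potentialDensity_comm (a b : Rn N → ℝ) (u v φ ψ : Rn N → ℝ) :
    potentialDensity a b u v φ ψ = potentialDensity a b φ ψ u v := by
  funext x
  simp only [potentialDensity]
  ring

theorem potentialDensity_nonneg (ha : IsPotential a) (hb : IsPotential b) (u v : Rn N → ℝ)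
    (x : Rn N) : 0 ≤ potentialDensity a b u v u v x :=
  add_nonneg (mul_nonneg (ha.pos x).le (mul_self_nonneg _))
    (mul_nonneg (hb.pos x).le (mul_self_nonneg _))

end

/-- The pairs `(u, v) ∈ H^s × H^s` with `∫ (a u² + b v²) dx < ∞`, as a linear subspace. -/
def energySubmodule {N : ℕ} (s : ℝ) {a b : Rn N → ℝ} (ha : IsPotential a) (hb : IsPotential b) :
    Submodule ℝ (L2 N × L2 N) where
  carrier := {w | w.1 ∈ Hs N s ∧ w.2 ∈ Hs N s ∧
    Integrable (potentialDensity a b (w.1 : Rn N → ℝ) w.2 w.1 w.2)}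
  zero_mem' := by
    refine ⟨(Hs N s).zero_mem, (Hs N s).zero_mem, ?_⟩
    have h := potentialDensity_smul_ae a b 0 (0 : L2 N × L2 N)
      ((0 : L2 N × L2 N).1 : Rn N → ℝ) ((0 : L2 N × L2 N).2 : Rn N → ℝ)
    simp only [zero_smul, zero_mul] at h
    exact (integrable_congr h).2 (integrable_zero _ _ _)
  add_mem' := by
    intro w z hw hz
    refine ⟨(Hs N s).add_mem hw.1 hz.1, (Hs N s).add_mem hw.2.1 hz.2.1, ?_⟩
    have hwz := integrable_potentialDensity ha hb (measurable_coe w.1) (measurable_coe w.2)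
      (measurable_coe z.1) (measurable_coe z.2) hw.2.2 hz.2.2
    have h1 : Integrable (potentialDensity a b (w + z).1 (w + z).2 w.1 w.2) := by
      refine (integrable_congr (potentialDensity_add_ae a b w z _ _)).2
        (Integrable.add hw.2.2 ?_)
      rwa [potentialDensity_comm]
    have h2 : Integrable (potentialDensity a b (w + z).1 (w + z).2 z.1 z.2) :=
      (integrable_congr (potentialDensity_add_ae a b w z _ _)).2 (hwz.add hz.2.2)
    refine (integrable_congr (potentialDensity_add_ae a b w z _ _)).2 (Integrable.add ?_ ?_)
    · rwa [potentialDensity_comm]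
    · rwa [potentialDensity_comm]
  smul_mem' := by
    intro c w hw
    refine ⟨(Hs N s).smul_mem c hw.1, (Hs N s).smul_mem c hw.2.1, ?_⟩
    refine (integrable_congr (potentialDensity_smul_ae a b c w _ _)).2
      (Integrable.const_mul ?_ c)
    rw [potentialDensity_comm]
    exact (integrable_congr (potentialDensity_smul_ae a b c w _ _)).2
      (Integrable.const_mul hw.2.2 c)

/-- The energy space of pairs `(u, v) ∈ H^s(ℝ^N) × H^s(ℝ^N)` with `∫ (a u² + b v²) dx < ∞`. Its norm
is the energy norm introduced below, not the one induced from `L² × L²`. -/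
def EnergySpace {N : ℕ} (s : ℝ) {a b : Rn N → ℝ} (ha : IsPotential a) (hb : IsPotential b) :
    Type :=
  energySubmodule s ha hb

namespace EnergySpace

variable {N : ℕ} {s : ℝ} {a b : Rn N → ℝ} {ha : IsPotential a} {hb : IsPotential b}

instance : AddCommGroup (EnergySpace s ha hb) :=
  inferInstanceAs (AddCommGroup (energySubmodule s ha hb))

instance : Module ℝ (EnergySpace s ha hb) :=
  inferInstanceAs (Module ℝ (energySubmodule s ha hb))

/-- The first component `u` of `(u, v)`. -/
def u (w : EnergySpace s ha hb) : L2 N := w.1.1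

/-- The second component `v` of `(u, v)`. -/
def v (w : EnergySpace s ha hb) : L2 N := w.1.2

/-- The scalar product of the energy space: the sum of the two Gagliardo forms and of
`∫ (a u φ + b v ψ) dx`. -/
def innerForm (w z : EnergySpace s ha hb) : ℝ :=
  gagliardoForm s w.u z.u + gagliardoForm s w.v z.v + potentialForm a b w.u w.v z.u z.v

theorem integrable_u (w z : EnergySpace s ha hb) :
    Integrable (gagliardoDensity s (w.u : Rn N → ℝ) z.u) :=
  integrable_gagliardoDensity s (measurable_coe _) (measurable_coe _) w.2.1 z.2.1

theorem integrable_v (w z : EnergySpace s ha hb) :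
    Integrable (gagliardoDensity s (w.v : Rn N → ℝ) z.v) :=
  integrable_gagliardoDensity s (measurable_coe _) (measurable_coe _) w.2.2.1 z.2.2.1

theorem integrable_potential (w z : EnergySpace s ha hb) :
    Integrable (potentialDensity a b (w.u : Rn N → ℝ) w.v z.u z.v) :=
  integrable_potentialDensity ha hb (measurable_coe _) (measurable_coe _) (measurable_coe _)
    (measurable_coe _) w.2.2.2 z.2.2.2

theorem gagliardoForm_self_nonneg (u : Rn N → ℝ) : 0 ≤ gagliardoForm s u u :=
  integral_nonneg fun _ => div_nonneg (mul_self_nonneg _) (Real.rpow_nonneg (norm_nonneg _) _)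

/-- The energy scalar product is a scalar product. -/
@[reducible]
def core : InnerProductSpace.Core ℝ (EnergySpace s ha hb) where
  inner := innerForm
  conj_inner_symm w z := by
    simp only [innerForm, gagliardoForm, potentialForm, conj_trivial]
    rw [gagliardoDensity_comm s z.u, gagliardoDensity_comm s z.v, potentialDensity_comm a b z.u]
  re_inner_nonneg w := by
    simp only [innerForm, RCLike.re_to_real]
    exact add_nonneg (add_nonneg (gagliardoForm_self_nonneg _) (gagliardoForm_self_nonneg _))
      (integral_nonneg fun x => potentialDensity_nonneg ha hb _ _ x)
  add_left w z y := by
    have h1 : gagliardoForm s (w + z).u y.u = gagliardoForm s w.u y.u + gagliardoForm s z.u y.u := by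
      rw [gagliardoForm, gagliardoForm, gagliardoForm,
        ← integral_add (integrable_u w y) (integrable_u z y)]
      exact integral_congr_ae (gagliardoDensity_add_ae s w.u z.u _)
    have h2 : gagliardoForm s (w + z).v y.v = gagliardoForm s w.v y.v + gagliardoForm s z.v y.v := by
      rw [gagliardoForm, gagliardoForm, gagliardoForm,
        ← integral_add (integrable_v w y) (integrable_v z y)]
      exact integral_congr_ae (gagliardoDensity_add_ae s w.v z.v _)
    have h3 : potentialForm a b (w + z).u (w + z).v y.u y.v =
        potentialForm a b w.u w.v y.u y.v + potentialForm a b z.u z.v y.u y.v := by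
      rw [potentialForm, potentialForm, potentialForm,
        ← integral_add (integrable_potential w y) (integrable_potential z y)]
      exact integral_congr_ae (potentialDensity_add_ae a b w.1 z.1 _ _)
    simp only [innerForm, h1, h2, h3]
    ring
  smul_left w y c := by
    have h1 : gagliardoForm s (c • w).u y.u = c * gagliardoForm s w.u y.u := by
      rw [gagliardoForm, gagliardoForm, ← integral_const_mul]
      exact integral_congr_ae (gagliardoDensity_smul_ae s c w.u _)
    have h2 : gagliardoForm s (c • w).v y.v = c * gagliardoForm s w.v y.v := by
      rw [gagliardoForm, gagliardoForm, ← integral_const_mul]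
      exact integral_congr_ae (gagliardoDensity_smul_ae s c w.v _)
    have h3 : potentialForm a b (c • w).u (c • w).v y.u y.v =
        c * potentialForm a b w.u w.v y.u y.v := by
      rw [potentialForm, potentialForm, ← integral_const_mul]
      exact integral_congr_ae (potentialDensity_smul_ae a b c w.1 _ _)
    simp only [innerForm, h1, h2, h3, conj_trivial]
    ring
  definite w hw := by
    have hp : potentialForm a b w.u w.v w.u w.v = 0 := by
      have h1 := gagliardoForm_self_nonneg (s := s) (w.u : Rn N → ℝ)
      have h2 := gagliardoForm_self_nonneg (s := s) (w.v : Rn N → ℝ)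
      have h3 : 0 ≤ potentialForm a b w.u w.v w.u w.v :=
        integral_nonneg fun x => potentialDensity_nonneg ha hb _ _ x
      have h4 : gagliardoForm s w.u w.u + gagliardoForm s w.v w.v +
        potentialForm a b w.u w.v w.u w.v = 0 := hw
      linarith
    have hz := (integral_eq_zero_iff_of_nonneg
      (fun x => potentialDensity_nonneg ha hb (w.u : Rn N → ℝ) w.v x)
      (integrable_potential w w)).1 hp
    have key : ∀ᵐ x, w.u x = 0 ∧ w.v x = 0 := by
      filter_upwards [hz] with x hx
      have hx' : a x * (w.u x * w.u x) + b x * (w.v x * w.v x) = 0 := hx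
      have h1 := mul_nonneg (ha.pos x).le (mul_self_nonneg (w.u x))
      have h2 := mul_nonneg (hb.pos x).le (mul_self_nonneg (w.v x))
      have e1 : a x * (w.u x * w.u x) = 0 := by linarith
      have e2 : b x * (w.v x * w.v x) = 0 := by linarith
      exact ⟨mul_self_eq_zero.1 ((mul_eq_zero.1 e1).resolve_left (ha.pos x).ne'),
        mul_self_eq_zero.1 ((mul_eq_zero.1 e2).resolve_left (hb.pos x).ne')⟩
    have hu : w.u = 0 := by
      refine Lp.ext ?_
      filter_upwards [key, Lp.coeFn_zero ℝ 2 (volume : Measure (Rn N))] with x h1 h2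
      rw [h1.1, h2, Pi.zero_apply]
    have hv : w.v = 0 := by
      refine Lp.ext ?_
      filter_upwards [key, Lp.coeFn_zero ℝ 2 (volume : Measure (Rn N))] with x h1 h2
      rw [h1.2, h2, Pi.zero_apply]
    exact Subtype.ext (Prod.ext hu hv)

instance : NormedAddCommGroup (EnergySpace s ha hb) :=
  InnerProductSpace.Core.toNormedAddCommGroup (cd := core)

instance : InnerProductSpace ℝ (EnergySpace s ha hb) :=
  InnerProductSpace.ofCore core.toCore

/-- The squared norm of the energy space:
`‖(u, v)‖² = ∫ |(-Δ)^{s/2} u|² + |(-Δ)^{s/2} v|² dx + ∫ (a u² + b v²) dx`. -/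
theorem norm_sq_eq (w : EnergySpace s ha hb) :
    ‖w‖ ^ 2 = gagliardoForm s w.u w.u + gagliardoForm s w.v w.v +
      ∫ x, (a x * w.u x ^ 2 + b x * w.v x ^ 2) := by
  rw [← real_inner_self_eq_norm_sq]
  change gagliardoForm s w.u w.u + gagliardoForm s w.v w.v +
    potentialForm a b w.u w.v w.u w.v = _
  simp only [potentialForm, potentialDensity, sq]

end EnergySpace

/-! ### The nonlinearity -/

/-- The closed quadrant `[0, ∞)²`. -/
def quadrant : Set (ℝ × ℝ) := Set.Ici 0 ×ˢ Set.Ici 0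

/-- The open quadrant `(0, ∞)²`. -/
def openQuadrant : Set (ℝ × ℝ) := Set.Ioi 0 ×ˢ Set.Ioi 0

/-- `Q_u` on the closed quadrant (one-sided on its boundary). -/
def partialU (Q : ℝ × ℝ → ℝ) (p : ℝ × ℝ) : ℝ := fderivWithin ℝ Q quadrant p (1, 0)

/-- `Q_v` on the closed quadrant (one-sided on its boundary). -/
def partialV (Q : ℝ × ℝ → ℝ) (p : ℝ × ℝ) : ℝ := fderivWithin ℝ Q quadrant p (0, 1)

/-- The critical Sobolev exponent `2N / (N - 2s)`. -/
def criticalExponent (N : ℕ) (s : ℝ) : ℝ := 2 * (N : ℝ) / ((N : ℝ) - 2 * s)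

/-- The assumptions on `Q : [0, ∞)² → ℝ`; values of `Q` outside the closed quadrant play no role. -/
structure IsNonlinearity (N : ℕ) (s q : ℝ) (Q : ℝ × ℝ → ℝ) : Prop where
  contDiffOn_one : ContDiffOn ℝ 1 Q quadrant
  contDiffOn_two : ContDiffOn ℝ 2 Q openQuadrant
  two_lt : 2 < q
  lt_critical : q < criticalExponent N s
  homogeneous : ∀ t : ℝ, 0 < t → ∀ p ∈ quadrant, Q (t • p) = t ^ q * Q p
  growth : ∃ C : ℝ, 0 < C ∧ ∀ p ∈ quadrant,
    |partialU Q p| + |partialV Q p| ≤ C * (p.1 ^ (q - 1) + p.2 ^ (q - 1))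
  partialU_zero_one : partialU Q (0, 1) = 0
  partialV_one_zero : partialV Q (1, 0) = 0
  partialU_one_zero : partialU Q (1, 0) = 0
  partialV_zero_one : partialV Q (0, 1) = 0
  mixed_pos : ∀ p ∈ openQuadrant, 0 < fderiv ℝ (partialU Q) p (0, 1)

open Classical in
/-- The extension of `Q` by `0` to the points with `u ≤ 0` or `v ≤ 0`. -/
def extend (Q : ℝ × ℝ → ℝ) (p : ℝ × ℝ) : ℝ := if p.1 ≤ 0 ∨ p.2 ≤ 0 then 0 else Q p

/-! ### Nehari manifold and Palais–Smale condition -/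

section Nehari

variable {E : Type*} [NormedAddCommGroup E] [NormedSpace ℝ E]

/-- The function `w ↦ ⟨J'(w), w⟩`, whose nontrivial zeros form the Nehari manifold. -/
def nehariConstraint (J : E → ℝ) (w : E) : ℝ := fderiv ℝ J w w

/-- The Nehari manifold `{w ≠ 0 : ⟨J'(w), w⟩ = 0}`. -/
def nehari (J : E → ℝ) : Set E := {w | w ≠ 0 ∧ nehariConstraint J w = 0}

/-- The tangent space of the Nehari manifold at `w`: the kernel of the derivative of the
constraint. -/
def nehariTangent (J : E → ℝ) (w : E) : Submodule ℝ E :=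
  (fderiv ℝ (nehariConstraint J) w).ker

/-- The derivative at `w` of `J` constrained to the Nehari manifold, a continuous linear form on the
tangent space. -/
def constrainedDeriv (J : E → ℝ) (w : E) : nehariTangent J w →L[ℝ] ℝ :=
  (fderiv ℝ J w).comp (nehariTangent J w).subtypeL

/-- `w` is a Palais–Smale sequence at level `d` for `J` constrained to its Nehari manifold. -/
def IsConstrainedPSSeq (J : E → ℝ) (d : ℝ) (w : ℕ → E) : Prop :=
  (∀ n, w n ∈ nehari J) ∧ Tendsto (fun n => J (w n)) atTop (𝓝 d) ∧
    Tendsto (fun n => ‖constrainedDeriv J (w n)‖) atTop (𝓝 0)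

/-- The Palais–Smale condition at level `d` for `J` constrained to its Nehari manifold. -/
def SatisfiesConstrainedPS (J : E → ℝ) (d : ℝ) : Prop :=
  ∀ w : ℕ → E, IsConstrainedPSSeq J d w →
    ∃ w₀ ∈ nehari J, ∃ k : ℕ → ℕ, StrictMono k ∧ Tendsto (w ∘ k) atTop (𝓝 w₀)

end Nehari

/-! ### The functionals -/

/-- `½ (∫ |(-Δ)^{s/2} u|² + |(-Δ)^{s/2} v|² dx + ∫ (A u² + B v²) dx) - ∫ Q(u, v) dx`, with `Q`
extended by zero. -/
def energy {N : ℕ} (s : ℝ) (A B : Rn N → ℝ) (Q : ℝ × ℝ → ℝ) (u v : Rn N → ℝ) : ℝ :=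
  1 / 2 * (gagliardoForm s u u + gagliardoForm s v v + ∫ x, (A x * u x ^ 2 + B x * v x ^ 2)) -
    ∫ x, extend Q (u x, v x)

/-- The space `X_ε`, with the potentials `V(ε x)` and `W(ε x)`. -/
abbrev Xeps {N : ℕ} (s : ℝ) {V W : Rn N → ℝ} (hV : IsPotential V) (hW : IsPotential W)
    {ε : ℝ} (hε : 0 < ε) : Type :=
  EnergySpace s (hV.rescale hε) (hW.rescale hε)

/-- The functional `J_ε` on `X_ε`. -/
def Jeps {N : ℕ} (s : ℝ) {V W : Rn N → ℝ} (hV : IsPotential V) (hW : IsPotential W)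
    {ε : ℝ} (hε : 0 < ε) (Q : ℝ × ℝ → ℝ) (w : Xeps s hV hW hε) : ℝ :=
  energy s (fun x => V (ε • x)) (fun x => W (ε • x)) Q w.u w.v

/-- `J_ε(w) = ½ ‖w‖_ε² - ∫ Q(w) dx`. -/
theorem Jeps_eq {N : ℕ} (s : ℝ) {V W : Rn N → ℝ} (hV : IsPotential V) (hW : IsPotential W)
    {ε : ℝ} (hε : 0 < ε) (Q : ℝ × ℝ → ℝ) (w : Xeps s hV hW hε) :
    Jeps s hV hW hε Q w = 1 / 2 * ‖w‖ ^ 2 - ∫ x, extend Q (w.u x, w.v x) := by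
  rw [EnergySpace.norm_sq_eq]
  rfl

/-- `liminf_{|x| → ∞} V(x)`, an extended real number. -/
def liminfAtInfinity {N : ℕ} (V : Rn N → ℝ) : EReal :=
  liminf (fun x => (V x : EReal)) (Bornology.cobounded (Rn N))

/-- The space `X_0 = H^s × H^s`, normed with the constant potentials `inf V` and `inf W`. -/
abbrev Xzero {N : ℕ} (s : ℝ) {V W : Rn N → ℝ} (hV : IsPotential V) (hW : IsPotential W) : Type :=
  EnergySpace (N := N) s (IsPotential.const hV.iInf_pos) (IsPotential.const hW.iInf_pos)

/-- The functional `J_∞` on `X_0`, with the constant potentials `V_∞` and `W_∞`; it is only used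
when these are finite. -/
def Jinf {N : ℕ} (s : ℝ) {V W : Rn N → ℝ} (hV : IsPotential V) (hW : IsPotential W)
    (Q : ℝ × ℝ → ℝ) (w : Xzero s hV hW) : ℝ :=
  energy s (fun _ => (liminfAtInfinity V).toReal) (fun _ => (liminfAtInfinity W).toReal) Q w.u w.v

open Classical in
/-- The level `c_∞`: the infimum of `J_∞` on its Nehari manifold if `V_∞` and `W_∞` are finite, and
`∞` otherwise. -/
def cInf {N : ℕ} (s : ℝ) {V W : Rn N → ℝ} (hV : IsPotential V) (hW : IsPotential W)
    (Q : ℝ × ℝ → ℝ) : EReal :=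
  if max (liminfAtInfinity V) (liminfAtInfinity W) = ⊤ then ⊤
  else ⨅ w ∈ nehari (Jinf s hV hW Q), (Jinf s hV hW Q w : EReal)

end FracSystem

end

/-!
# The Palais–Smale condition on the Nehari manifold of a fractional system

Write `J = ½ ‖·‖² - Φ` with `Φ(w) = ∫ Q(w)`. Everything about the constraint follows from the
homogeneity of `Φ`: by Euler's identity the constraint is `G = ‖·‖² - q Φ`, so `C¹` regularity of `J`
and of `G` is that of `Φ`, and `G'(w) w = (2 - q) ‖w‖²` does not vanish on the Nehari manifold. Hence
`J'(w)`, which annihilates `w`, is determined by its restriction to `ker G'(w)`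
(`norm_fderiv_le_constrainedDeriv`): constrained critical points are free, and constrained
Palais–Smale sequences are free Palais–Smale sequences.

`Φ` is of class `C¹` because it is an integral functional on `L^q` (`contDiff_integral_comp`)
composed with the embedding of the energy space into `L^q`. For the integral functional, homogeneity
and compactness of the unit ball replace all growth conditions: a continuous `f`, homogeneous of degree
`r`, satisfies `|f(a + b) - f(a)| ≤ δ |a|^r + C_δ |b|^r` (`PosHomogeneous.exists_increment_le`). The
subcritical embedding is proved by self-improvement of integrability from `L^p` to `L^(2 + 2sp/N)`
(`rpow_abs_le_gagliardoSlice`), an iteration that converges to the critical exponent.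

For the Palais–Smale condition let `w_n ⇀ w₀` be a Palais–Smale sequence and `z_n = w_n - w₀`. Then
`‖z_n‖²` converges to some `L` with `(½ - 1/q) L ≤ d`, and `z_n → 0` in `L²` on balls by Rellich's
theorem (`vanishesLocally_of_weak`). As `w₀` and `z_n` do not interact in the limit
(`EnergySpace.tendsto_fderiv_nonlinearPart_sub`), testing `J'(w_n)` with `z_n` gives `q Φ(z_n) → L`.
Suppose `L > 0`. If one potential is coercive, one component of `z_n` tends to zero in `L^q`, and
`Φ(z_n) → 0` since `Q` vanishes on the axes: a contradiction. If `V_∞` and `W_∞` are finite, the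
quadratic form at infinity is asymptotically at most `‖z_n‖²`, so the multiples `t_n z_n` on the Nehari
manifold at infinity have `limsup t_n ≤ 1`, whence `c_∞ ≤ (½ - 1/q) L ≤ d` (`cInf_le`,
`lt_energy_of_vanishing`): again a contradiction. So `L = 0` and `w_n → w₀`. No translations and no
concentration-compactness lemma are needed.
-/

noncomputable section

namespace FracSystem

/-! ### Positively homogeneous functions -/

/-- `f` is positively homogeneous of degree `r`. -/
def PosHomogeneous {E G : Type*} [AddCommGroup E] [Module ℝ E] [AddCommGroup G] [Module ℝ G]
    (r : ℝ) (f : E → G) : Prop :=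
  ∀ t : ℝ, 0 < t → ∀ x, f (t • x) = t ^ r • f x

section Homogeneous

variable {E G : Type*} [NormedAddCommGroup E] [NormedSpace ℝ E] [NormedAddCommGroup G]
  [NormedSpace ℝ G] {f : E → G} {F : E → ℝ} {r q : ℝ}

theorem PosHomogeneous.apply_zero (hr : 0 < r) (hom : PosHomogeneous r f) : f 0 = 0 := by
  have h := hom 2 two_pos 0
  rw [smul_zero] at h
  have h2 : (1 : ℝ) < 2 ^ r := Real.one_lt_rpow one_lt_two hr
  have h3 : ((2 : ℝ) ^ r - 1) • f 0 = 0 := by rw [sub_smul, ← h, one_smul, sub_self]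
  exact (smul_eq_zero.1 h3).resolve_left (by linarith)

theorem PosHomogeneous.exists_bound (hr : 0 < r) (hom : PosHomogeneous r f)
    (hf : Continuous f) : ∃ M, 0 < M ∧ ∀ x, ‖f x‖ ≤ M * ‖x‖ ^ r := by
  have hf0 : Tendsto (fun x => ‖f x‖) (𝓝 0) (𝓝 0) := by
    have := hf.norm.tendsto 0
    rwa [hom.apply_zero hr, norm_zero] at this
  obtain ⟨η, hη, hb⟩ := Metric.eventually_nhds_iff.1 (hf0.eventually (gt_mem_nhds one_pos))
  refine ⟨(2 / η) ^ r, by positivity, fun x => ?_⟩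
  rcases eq_or_ne x 0 with rfl | hx
  · rw [hom.apply_zero hr, norm_zero, norm_zero, Real.zero_rpow hr.ne', mul_zero]
  · have hx' : 0 < ‖x‖ := norm_pos_iff.2 hx
    have ht : 0 < 2 / η * ‖x‖ := by positivity
    have h1 : f x = (2 / η * ‖x‖) ^ r • f ((2 / η * ‖x‖)⁻¹ • x) := by
      rw [← hom _ ht, smul_smul, mul_inv_cancel₀ ht.ne', one_smul]
    have h2 : ‖f ((2 / η * ‖x‖)⁻¹ • x)‖ < 1 := by
      apply hb
      rw [dist_zero_right, norm_smul, norm_inv, Real.norm_of_nonneg ht.le, mul_inv, mul_assoc,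
        inv_mul_cancel₀ hx'.ne', inv_div, mul_one]
      linarith
    rw [h1, norm_smul, Real.norm_of_nonneg (by positivity), ← Real.mul_rpow (by positivity) hx'.le]
    exact mul_le_of_le_one_right (by positivity) h2.le

/-- A continuous homogeneous function is uniformly continuous on the unit scale; by scaling, an
increment of the argument that is relatively small costs a small multiple of the top power, and one
that is not relatively small controls everything. -/
theorem PosHomogeneous.exists_increment_le [ProperSpace E] (hr : 0 < r)
    (hom : PosHomogeneous r f) (hf : Continuous f) {δ : ℝ} (hδ : 0 < δ) :
    ∃ C, 0 < C ∧ ∀ a b, ‖f (a + b) - f a‖ ≤ δ * ‖a‖ ^ r + C * ‖b‖ ^ r := by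
  obtain ⟨M, hM0, hM⟩ := hom.exists_bound hr hf
  have huc := (isCompact_closedBall (0 : E) 2).uniformContinuousOn_of_continuous hf.continuousOn
  obtain ⟨η₀, hη₀, huc⟩ := Metric.uniformContinuousOn_iff.1 huc δ hδ
  set η := min η₀ 1 with hη
  have hη0 : 0 < η := lt_min hη₀ one_pos
  refine ⟨M * (1 + η⁻¹) ^ r + M * η⁻¹ ^ r, by positivity, fun a b => ?_⟩
  rcases lt_or_ge ‖b‖ (η * ‖a‖) with h | h
  · have ha : 0 < ‖a‖ := by
      by_contra h0
      have h0' : ‖a‖ = 0 := le_antisymm (not_lt.1 h0) (norm_nonneg a)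
      rw [h0', mul_zero] at h
      exact absurd h (not_lt.2 (norm_nonneg b))
    have e1 : f a = ‖a‖ ^ r • f (‖a‖⁻¹ • a) := by
      rw [← hom _ ha, smul_smul, mul_inv_cancel₀ ha.ne', one_smul]
    have e2 : f (a + b) = ‖a‖ ^ r • f (‖a‖⁻¹ • a + ‖a‖⁻¹ • b) := by
      rw [← hom _ ha, ← smul_add, smul_smul, mul_inv_cancel₀ ha.ne', one_smul]
    have n1 : ‖‖a‖⁻¹ • a‖ = 1 := by
      rw [norm_smul, norm_inv, norm_norm, inv_mul_cancel₀ ha.ne']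
    have n2 : ‖‖a‖⁻¹ • b‖ < η := by
      rw [norm_smul, norm_inv, norm_norm, inv_mul_lt_iff₀ ha, mul_comm]
      exact h
    have h3 := huc (‖a‖⁻¹ • a + ‖a‖⁻¹ • b) (by
      rw [mem_closedBall_zero_iff]
      have := norm_add_le (‖a‖⁻¹ • a) (‖a‖⁻¹ • b)
      have := min_le_right η₀ 1
      linarith) (‖a‖⁻¹ • a) (by rw [mem_closedBall_zero_iff, n1]; norm_num) (by
      rw [dist_eq_norm, add_sub_cancel_left]
      exact n2.trans_le (min_le_left _ _))
    rw [dist_eq_norm] at h3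
    rw [e1, e2, ← smul_sub, norm_smul, Real.norm_of_nonneg (by positivity), mul_comm]
    have : 0 ≤ (M * (1 + η⁻¹) ^ r + M * η⁻¹ ^ r) * ‖b‖ ^ r := by positivity
    have := mul_le_mul_of_nonneg_right h3.le (Real.rpow_nonneg ha.le r)
    linarith
  · have h1 : ‖a‖ ≤ η⁻¹ * ‖b‖ := by
      rw [inv_mul_eq_div, le_div_iff₀ hη0, mul_comm]
      exact h
    have h2 : ‖a + b‖ ≤ (1 + η⁻¹) * ‖b‖ := by
      have := norm_add_le a b
      linarith
    have h3 : ‖f a‖ ≤ M * η⁻¹ ^ r * ‖b‖ ^ r := by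
      refine (hM a).trans ?_
      rw [mul_assoc, ← Real.mul_rpow (by positivity) (norm_nonneg b)]
      gcongr
    have h4 : ‖f (a + b)‖ ≤ M * (1 + η⁻¹) ^ r * ‖b‖ ^ r := by
      refine (hM _).trans ?_
      rw [mul_assoc, ← Real.mul_rpow (by positivity) (norm_nonneg b)]
      gcongr
    have h5 := norm_sub_le (f (a + b)) (f a)
    have : 0 ≤ δ * ‖a‖ ^ r := by positivity
    linarith

theorem PosHomogeneous.fderiv (hom : PosHomogeneous q F) (hF : Differentiable ℝ F) :
    PosHomogeneous (q - 1) (fderiv ℝ F) := by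
  intro t ht x
  have h1 : HasFDerivAt (fun y => F (t • y)) (t • _root_.fderiv ℝ F (t • x)) x := by
    have h : HasFDerivAt (fun y => F (t • y))
        ((_root_.fderiv ℝ F (t • x)).comp (t • ContinuousLinearMap.id ℝ E)) x :=
      HasFDerivAt.comp (g := F) x (hF (t • x)).hasFDerivAt
        (t • ContinuousLinearMap.id ℝ E).hasFDerivAt
    refine HasFDerivAt.congr_fderiv h ?_
    ext y
    simp
  have h2 : HasFDerivAt (fun y => F (t • y)) (t ^ q • _root_.fderiv ℝ F x) x := by
    have : (fun y => F (t • y)) = fun y => t ^ q • F y := funext fun y => hom t ht y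
    rw [this]
    exact (hF x).hasFDerivAt.const_smul (t ^ q)
  have h3 := h1.unique h2
  rw [Real.rpow_sub_one ht.ne', div_eq_inv_mul, mul_smul, ← h3, smul_smul,
    inv_mul_cancel₀ ht.ne', one_smul]

/-- Euler's identity. -/
theorem PosHomogeneous.fderiv_apply_self (hom : PosHomogeneous q F) {x : E}
    (hF : DifferentiableAt ℝ F x) : _root_.fderiv ℝ F x x = q * F x := by
  have h1 : HasDerivAt (fun t : ℝ => F (t • x)) (_root_.fderiv ℝ F x x) 1 := by
    have hx : HasFDerivAt F (_root_.fderiv ℝ F x) ((1 : ℝ) • x) := by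
      rw [one_smul]; exact hF.hasFDerivAt
    have h := hx.comp_hasDerivAt (1 : ℝ) ((hasDerivAt_id (1 : ℝ)).smul_const x)
    rwa [one_smul] at h
  have h2 : HasDerivAt (fun t : ℝ => F (t • x)) (q * F x) 1 := by
    have h : HasDerivAt (fun t : ℝ => t ^ q * F x) (q * F x) 1 := by
      have := (Real.hasDerivAt_rpow_const (x := 1) (p := q) (Or.inl one_ne_zero)).mul_const (F x)
      simpa using this
    refine h.congr_of_eventuallyEq ?_
    filter_upwards [lt_mem_nhds (zero_lt_one' ℝ)] with t ht
    rw [hom t ht, smul_eq_mul]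
  exact h1.unique h2

theorem norm_sub_sub_fderiv_le (hF : Differentiable ℝ F) (hq : 1 < q) {δ C : ℝ} (hC : 0 ≤ C)
    (h : ∀ a b, ‖_root_.fderiv ℝ F (a + b) - _root_.fderiv ℝ F a‖
      ≤ δ * ‖a‖ ^ (q - 1) + C * ‖b‖ ^ (q - 1)) (a b : E) :
    ‖F (a + b) - F a - _root_.fderiv ℝ F a b‖
      ≤ (δ * ‖a‖ ^ (q - 1) + C * ‖b‖ ^ (q - 1)) * ‖b‖ := by
  have key := Convex.norm_image_sub_le_of_norm_hasFDerivWithin_le' (𝕜 := ℝ)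
    (f := F) (f' := _root_.fderiv ℝ F) (φ := _root_.fderiv ℝ F a)
    (C := δ * ‖a‖ ^ (q - 1) + C * ‖b‖ ^ (q - 1)) (s := Metric.closedBall a ‖b‖) (x := a)
    (y := a + b) (fun x _ => (hF x).hasFDerivAt.hasFDerivWithinAt) (fun x hx => ?_)
    (convex_closedBall _ _) (Metric.mem_closedBall_self (norm_nonneg _)) (by simp)
  · simpa using key
  · have h1 := h a (x - a)
    rw [add_sub_cancel] at h1
    refine h1.trans ?_
    have : ‖x - a‖ ≤ ‖b‖ := by simpa [dist_eq_norm] using hx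
    gcongr

end Homogeneous

/-! ### Integral functionals on `L^q` -/

section Nemytskii

variable {α : Type*} {mα : MeasurableSpace α} {μ : Measure α} {E : Type*} [NormedAddCommGroup E]
  {q : ℝ}

theorem integrable_norm_rpow_Lp (hq : 0 < q) (w : Lp E (ENNReal.ofReal q) μ) :
    Integrable (fun x => ‖w x‖ ^ q) μ := by
  have h := (Lp.memLp w).integrable_norm_rpow (by simpa using hq) ENNReal.ofReal_ne_top
  rwa [ENNReal.toReal_ofReal hq.le] at h

theorem integral_norm_rpow_Lp (hq : 0 < q) (w : Lp E (ENNReal.ofReal q) μ) :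
    ∫ x, ‖w x‖ ^ q ∂μ = ‖w‖ ^ q := by
  have h := (Lp.memLp w).eLpNorm_eq_integral_rpow_norm (by simpa using hq) ENNReal.ofReal_ne_top
  have h0 : 0 ≤ ∫ x, ‖w x‖ ^ q ∂μ := integral_nonneg fun _ => by positivity
  rw [ENNReal.toReal_ofReal hq.le] at h
  rw [Lp.norm_def, h, ENNReal.toReal_ofReal (by positivity), ← Real.rpow_mul h0,
    inv_mul_cancel₀ hq.ne', Real.rpow_one]

theorem memLp_norm_rpow_sub_one (hq : 1 < q) (a : Lp E (ENNReal.ofReal q) μ) :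
    MemLp (fun x => ‖a x‖ ^ (q - 1)) (ENNReal.ofReal (q / (q - 1))) μ := by
  have h := (Lp.memLp a).norm_rpow_div (ENNReal.ofReal (q - 1))
  rwa [ENNReal.toReal_ofReal (by linarith), ← ENNReal.ofReal_div_of_pos (by linarith)] at h

theorem integrable_rpow_mul_norm_Lp (hq : 1 < q) (a b : Lp E (ENNReal.ofReal q) μ) :
    Integrable (fun x => ‖a x‖ ^ (q - 1) * ‖b x‖) μ := by
  have hc : (q / (q - 1)).HolderConjugate q := (Real.HolderConjugate.conjExponent hq).symm
  have : (ENNReal.ofReal (q / (q - 1))).HolderTriple (ENNReal.ofReal q) 1 :=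
    ENNReal.HolderConjugate.of_toReal (by
      rwa [ENNReal.toReal_ofReal hc.nonneg, ENNReal.toReal_ofReal hc.symm.nonneg])
  exact (memLp_norm_rpow_sub_one hq a).integrable_mul (Lp.memLp b).norm

/-- Hölder's inequality. -/
theorem integral_rpow_mul_norm_Lp_le [Fact (1 ≤ ENNReal.ofReal q)] (hq : 1 < q) (a b : Lp E (ENNReal.ofReal q) μ) :
    ∫ x, ‖a x‖ ^ (q - 1) * ‖b x‖ ∂μ ≤ ‖a‖ ^ (q - 1) * ‖b‖ := by
  have hc : (q / (q - 1)).HolderConjugate q := (Real.HolderConjugate.conjExponent hq).symm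
  have h := integral_mul_le_Lp_mul_Lq_of_nonneg (μ := μ) hc
    (f := fun x => ‖a x‖ ^ (q - 1)) (g := fun x => ‖b x‖)
    (Eventually.of_forall fun x => by positivity) (Eventually.of_forall fun x => by positivity)
    (memLp_norm_rpow_sub_one hq a) (Lp.memLp b).norm
  refine h.trans (le_of_eq ?_)
  have hq1 : q - 1 ≠ 0 := by linarith
  have e1 : ∀ x, (‖a x‖ ^ (q - 1)) ^ (q / (q - 1)) = ‖a x‖ ^ q := fun x => by
    rw [← Real.rpow_mul (norm_nonneg _), mul_div_cancel₀ _ hq1]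
  simp only [e1]
  rw [integral_norm_rpow_Lp (by linarith), integral_norm_rpow_Lp (by linarith),
    ← Real.rpow_mul (norm_nonneg _), ← Real.rpow_mul (norm_nonneg _)]
  congr 1
  · congr 1
    field_simp
  · rw [mul_one_div_cancel (by linarith), Real.rpow_one]

variable [NormedSpace ℝ E] {F : E → ℝ}

theorem integrable_comp_Lp (hq : 1 < q) (hF : Continuous F) (hom : PosHomogeneous q F)
    (w : Lp E (ENNReal.ofReal q) μ) : Integrable (fun x => F (w x)) μ := by
  obtain ⟨M, -, hM⟩ := hom.exists_bound (by linarith) hF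
  exact ((integrable_norm_rpow_Lp (by linarith) w).const_mul M).mono'
    (hF.comp_aestronglyMeasurable (Lp.aestronglyMeasurable w)) (Eventually.of_forall fun x => hM _)

theorem integrable_fderiv_comp_Lp (hq : 1 < q) (hF : ContDiff ℝ 1 F) (hom : PosHomogeneous q F)
    (w φ : Lp E (ENNReal.ofReal q) μ) : Integrable (fun x => fderiv ℝ F (w x) (φ x)) μ := by
  have hF' : Continuous (fderiv ℝ F) := hF.continuous_fderiv one_ne_zero
  obtain ⟨M, -, hM⟩ := (hom.fderiv (hF.differentiable one_ne_zero)).exists_bound (by linarith) hF'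
  refine ((integrable_rpow_mul_norm_Lp hq w φ).const_mul M).mono' ?_
    (Eventually.of_forall fun x => ?_)
  · exact (isBoundedBilinearMap_apply.continuous.comp_aestronglyMeasurable
      ((hF'.comp_aestronglyMeasurable (Lp.aestronglyMeasurable w)).prodMk
        (Lp.aestronglyMeasurable φ)))
  · rw [← mul_assoc]
    exact (ContinuousLinearMap.le_opNorm _ _).trans (by gcongr; exact hM _)

variable [Fact (1 ≤ ENNReal.ofReal q)]

/-- The derivative `φ ↦ ∫ F'(w) φ` of the integral functional `w ↦ ∫ F(w)` on `L^q`. -/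
def integralDeriv (hq : 1 < q) (hF : ContDiff ℝ 1 F) (hom : PosHomogeneous q F)
    (w : Lp E (ENNReal.ofReal q) μ) : Lp E (ENNReal.ofReal q) μ →L[ℝ] ℝ :=
  LinearMap.mkContinuousOfExistsBound
    { toFun := fun φ => ∫ x, fderiv ℝ F (w x) (φ x) ∂μ
      map_add' := fun φ ψ => by
        rw [← integral_add (integrable_fderiv_comp_Lp hq hF hom w φ)
          (integrable_fderiv_comp_Lp hq hF hom w ψ)]
        refine integral_congr_ae ?_
        filter_upwards [Lp.coeFn_add φ ψ] with x hx
        rw [hx, Pi.add_apply, map_add]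
      map_smul' := fun c φ => by
        rw [RingHom.id_apply, smul_eq_mul, ← integral_const_mul]
        refine integral_congr_ae ?_
        filter_upwards [Lp.coeFn_smul c φ] with x hx
        rw [hx, Pi.smul_apply, map_smul, smul_eq_mul] } (by
    obtain ⟨M, hM0, hM⟩ := (hom.fderiv (hF.differentiable one_ne_zero)).exists_bound (by linarith)
      (hF.continuous_fderiv one_ne_zero)
    refine ⟨M * ‖w‖ ^ (q - 1), fun φ => ?_⟩
    refine (norm_integral_le_of_norm_le ((integrable_rpow_mul_norm_Lp hq w φ).const_mul M)
      (Eventually.of_forall fun x => ?_)).trans ?_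
    · rw [← mul_assoc]
      exact (ContinuousLinearMap.le_opNorm _ _).trans (by gcongr; exact hM _)
    · rw [integral_const_mul, mul_assoc]
      gcongr
      exact integral_rpow_mul_norm_Lp_le hq w φ)

theorem integralDeriv_apply (hq : 1 < q) (hF : ContDiff ℝ 1 F) (hom : PosHomogeneous q F)
    (w φ : Lp E (ENNReal.ofReal q) μ) :
    integralDeriv hq hF hom w φ = ∫ x, fderiv ℝ F (w x) (φ x) ∂μ :=
  rfl

theorem norm_integralDeriv_sub_le (hq : 1 < q) (hF : ContDiff ℝ 1 F) (hom : PosHomogeneous q F)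
    {δ C : ℝ} (hδ : 0 ≤ δ) (hC : 0 ≤ C)
    (h : ∀ a b, ‖fderiv ℝ F (a + b) - fderiv ℝ F a‖ ≤ δ * ‖a‖ ^ (q - 1) + C * ‖b‖ ^ (q - 1))
    (w φ : Lp E (ENNReal.ofReal q) μ) :
    ‖integralDeriv hq hF hom (w + φ) - integralDeriv hq hF hom w‖ ≤
      δ * ‖w‖ ^ (q - 1) + C * ‖φ‖ ^ (q - 1) := by
  refine ContinuousLinearMap.opNorm_le_bound _ (by positivity) fun ψ => ?_
  rw [sub_apply, integralDeriv_apply, integralDeriv_apply,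
    ← integral_sub (integrable_fderiv_comp_Lp hq hF hom _ ψ)
      (integrable_fderiv_comp_Lp hq hF hom w ψ)]
  have i1 := (integrable_rpow_mul_norm_Lp hq w ψ).const_mul δ
  have i2 := (integrable_rpow_mul_norm_Lp hq φ ψ).const_mul C
  refine (norm_integral_le_of_norm_le (i1.add i2) ?_).trans ?_
  · filter_upwards [Lp.coeFn_add w φ] with x hx
    rw [hx, Pi.add_apply, ← sub_apply, Pi.add_apply, ← mul_assoc,
      ← mul_assoc, ← add_mul]
    exact (ContinuousLinearMap.le_opNorm _ _).trans (by gcongr; exact h _ _)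
  · simp only [Pi.add_apply]
    rw [integral_add i1 i2, integral_const_mul, integral_const_mul, add_mul, mul_assoc, mul_assoc]
    gcongr
    · exact integral_rpow_mul_norm_Lp_le hq w ψ
    · exact integral_rpow_mul_norm_Lp_le hq φ ψ

theorem norm_integral_sub_sub_integralDeriv_le (hq : 1 < q) (hF : ContDiff ℝ 1 F)
    (hom : PosHomogeneous q F) {δ C : ℝ} (hδ : 0 ≤ δ) (hC : 0 ≤ C)
    (h : ∀ a b, ‖fderiv ℝ F (a + b) - fderiv ℝ F a‖ ≤ δ * ‖a‖ ^ (q - 1) + C * ‖b‖ ^ (q - 1))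
    (w φ : Lp E (ENNReal.ofReal q) μ) :
    ‖∫ x, F ((w + φ : Lp E (ENNReal.ofReal q) μ) x) ∂μ - ∫ x, F (w x) ∂μ
      - integralDeriv hq hF hom w φ‖ ≤ (δ * ‖w‖ ^ (q - 1) + C * ‖φ‖ ^ (q - 1)) * ‖φ‖ := by
  have j1 := integrable_comp_Lp hq hF.continuous hom (w + φ)
  have j2 := integrable_comp_Lp hq hF.continuous hom w
  rw [integralDeriv_apply, ← integral_sub j1 j2,
    ← integral_sub (f := fun x => F ((w + φ : Lp E (ENNReal.ofReal q) μ) x) - F (w x))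
      (j1.sub j2) (integrable_fderiv_comp_Lp hq hF hom w φ)]
  have i1 := (integrable_rpow_mul_norm_Lp hq w φ).const_mul δ
  have i2 := (integrable_rpow_mul_norm_Lp hq φ φ).const_mul C
  refine (norm_integral_le_of_norm_le (i1.add i2) ?_).trans ?_
  · filter_upwards [Lp.coeFn_add w φ] with x hx
    rw [hx, Pi.add_apply, Pi.add_apply, ← mul_assoc, ← mul_assoc, ← add_mul]
    exact norm_sub_sub_fderiv_le (hF.differentiable one_ne_zero) hq hC h _ _
  · simp only [Pi.add_apply]
    rw [integral_add i1 i2, integral_const_mul, integral_const_mul, add_mul, mul_assoc, mul_assoc]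
    gcongr
    · exact integral_rpow_mul_norm_Lp_le hq w φ
    · exact integral_rpow_mul_norm_Lp_le hq φ φ

theorem exists_norm_small {q A C δ : ℝ} (hq : 1 < q) (hA : 0 ≤ A) (hδ : 0 < δ) :
    ∃ η > 0, ∀ t, 0 ≤ t → t < η → δ / (2 * (A + 1)) * A + C * t ^ (q - 1) ≤ δ := by
  have h : Tendsto (fun t : ℝ => C * t ^ (q - 1)) (𝓝 0) (𝓝 0) := by
    have := ((Real.continuous_rpow_const (q := q - 1) (by linarith)).const_mul C).tendsto 0
    rwa [Real.zero_rpow (by linarith), mul_zero] at this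
  obtain ⟨η, hη, h⟩ := Metric.eventually_nhds_iff.1 (h.eventually (gt_mem_nhds (half_pos hδ)))
  refine ⟨η, hη, fun t ht hlt => ?_⟩
  have h1 := h (y := t) (by rwa [Real.dist_eq, sub_zero, abs_of_nonneg ht])
  have h2 : δ / (2 * (A + 1)) * A ≤ δ / 2 := by
    rw [div_mul_eq_mul_div, div_le_div_iff₀ (by positivity) two_pos]
    nlinarith
  linarith

variable [ProperSpace E]

theorem hasFDerivAt_integral_comp (hq : 1 < q) (hF : ContDiff ℝ 1 F) (hom : PosHomogeneous q F)
    (w : Lp E (ENNReal.ofReal q) μ) :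
    HasFDerivAt (fun w : Lp E (ENNReal.ofReal q) μ => ∫ x, F (w x) ∂μ)
      (integralDeriv hq hF hom w) w := by
  rw [hasFDerivAt_iff_isLittleO_nhds_zero, Asymptotics.isLittleO_iff]
  intro c hc
  obtain ⟨C, hC, h⟩ := (hom.fderiv (hF.differentiable one_ne_zero)).exists_increment_le
    (by linarith) (hF.continuous_fderiv one_ne_zero)
    (δ := c / (2 * (‖w‖ ^ (q - 1) + 1))) (by positivity)
  obtain ⟨η, hη, hs⟩ := exists_norm_small hq (A := ‖w‖ ^ (q - 1)) (by positivity) hc (C := C)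
  filter_upwards [Metric.ball_mem_nhds 0 hη] with φ hφ
  refine (norm_integral_sub_sub_integralDeriv_le hq hF hom (by positivity) hC.le h w φ).trans ?_
  gcongr
  exact hs _ (norm_nonneg _) (mem_ball_zero_iff.1 hφ)

theorem continuous_integralDeriv (hq : 1 < q) (hF : ContDiff ℝ 1 F) (hom : PosHomogeneous q F) :
    Continuous (integralDeriv (μ := μ) hq hF hom) := by
  rw [Metric.continuous_iff]
  intro w c hc
  obtain ⟨C, hC, h⟩ := (hom.fderiv (hF.differentiable one_ne_zero)).exists_increment_le
    (by linarith) (hF.continuous_fderiv one_ne_zero)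
    (δ := c / 2 / (2 * (‖w‖ ^ (q - 1) + 1))) (by positivity)
  obtain ⟨η, hη, hs⟩ := exists_norm_small hq (A := ‖w‖ ^ (q - 1)) (by positivity) (half_pos hc) (C := C)
  refine ⟨η, hη, fun z hz => ?_⟩
  have h1 := norm_integralDeriv_sub_le hq hF hom (by positivity) hC.le h w (z - w)
  rw [add_sub_cancel] at h1
  rw [dist_eq_norm] at hz ⊢
  have := hs _ (norm_nonneg _) hz
  linarith

/-- The integral functional of a homogeneous `C¹` integrand of degree `q` is of class `C¹` on
`L^q`. -/
theorem contDiff_integral_comp (hq : 1 < q) (hF : ContDiff ℝ 1 F) (hom : PosHomogeneous q F) :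
    ContDiff ℝ 1 (fun w : Lp E (ENNReal.ofReal q) μ => ∫ x, F (w x) ∂μ) :=
  contDiff_one_iff_hasFDerivAt.2 ⟨integralDeriv hq hF hom, continuous_integralDeriv hq hF hom,
    hasFDerivAt_integral_comp hq hF hom⟩

end Nemytskii

/-! ### The extended nonlinearity -/

section Extension

variable {N : ℕ} {s q : ℝ} {Q : ℝ × ℝ → ℝ}

theorem smul_mem_quadrant {t : ℝ} (ht : 0 < t) {p : ℝ × ℝ} (hp : p ∈ quadrant) :
    t • p ∈ quadrant :=
  ⟨mul_nonneg ht.le hp.1, mul_nonneg ht.le hp.2⟩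

theorem uniqueDiffOn_quadrant : UniqueDiffOn ℝ quadrant :=
  (uniqueDiffOn_Ici 0).prod (uniqueDiffOn_Ici 0)

theorem IsNonlinearity.hasFDerivWithinAt (hQ : IsNonlinearity N s q Q) {p : ℝ × ℝ}
    (hp : p ∈ quadrant) : HasFDerivWithinAt Q (fderivWithin ℝ Q quadrant p) quadrant p :=
  (hQ.contDiffOn_one.differentiableOn one_ne_zero p hp).hasFDerivWithinAt

theorem fderivWithin_eq_zero_of_partial {p : ℝ × ℝ} (h1 : partialU Q p = 0)
    (h2 : partialV Q p = 0) : fderivWithin ℝ Q quadrant p = 0 := by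
  ext
  · simpa [partialU] using h1
  · simpa [partialV] using h2

theorem IsNonlinearity.eq_zero_of_fderivWithin (hQ : IsNonlinearity N s q Q) {p : ℝ × ℝ}
    (hp : p ∈ quadrant) (hD : fderivWithin ℝ Q quadrant p = 0) : Q p = 0 := by
  have h1 : HasDerivWithinAt (fun t : ℝ => Q (t • p)) 0 (Set.Ioi 0) 1 := by
    have h0 := hQ.hasFDerivWithinAt hp
    rw [hD] at h0
    have hp1 : HasFDerivWithinAt Q (0 : ℝ × ℝ →L[ℝ] ℝ) quadrant ((1 : ℝ) • p) := by rwa [one_smul]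
    have h := hp1.comp_hasDerivWithinAt (1 : ℝ)
      (((hasDerivAt_id (1 : ℝ)).smul_const p).hasDerivWithinAt (s := Set.Ioi 0))
      (fun t ht => smul_mem_quadrant ht hp)
    rwa [zero_apply] at h
  have h2 : HasDerivWithinAt (fun t : ℝ => Q (t • p)) (q * Q p) (Set.Ioi 0) 1 := by
    have h : HasDerivAt (fun t : ℝ => t ^ q * Q p) (q * Q p) 1 := by
      have := (Real.hasDerivAt_rpow_const (x := 1) (p := q) (Or.inl one_ne_zero)).mul_const (Q p)
      simpa using this
    exact h.hasDerivWithinAt.congr (fun t ht => hQ.homogeneous t ht p hp)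
      (hQ.homogeneous 1 one_pos p hp)
  have h3 := (uniqueDiffOn_Ioi (0 : ℝ) 1 (Set.mem_Ioi.2 one_pos)).eq_deriv _ h1 h2
  have := hQ.two_lt
  exact (mul_eq_zero.1 h3.symm).resolve_left (by linarith)

theorem IsNonlinearity.fderivWithin_smul (hQ : IsNonlinearity N s q Q) {p : ℝ × ℝ}
    (hp : p ∈ quadrant) (hD : fderivWithin ℝ Q quadrant p = 0) {t : ℝ} (ht : 0 < t) :
    fderivWithin ℝ Q quadrant (t • p) = 0 := by
  have h1 : HasFDerivWithinAt (fun y => Q (t • y))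
      ((fderivWithin ℝ Q quadrant (t • p)).comp (t • ContinuousLinearMap.id ℝ (ℝ × ℝ)))
      quadrant p :=
    HasFDerivWithinAt.comp (g := Q) (t := quadrant) p
      (hQ.hasFDerivWithinAt (smul_mem_quadrant ht hp))
      (t • ContinuousLinearMap.id ℝ (ℝ × ℝ)).hasFDerivAt.hasFDerivWithinAt
      (fun y hy => smul_mem_quadrant ht hy)
  have h2 : HasFDerivWithinAt (fun y => Q (t • y)) (0 : ℝ × ℝ →L[ℝ] ℝ) quadrant p := by
    have h0 := hQ.hasFDerivWithinAt hp
    rw [hD] at h0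
    have h := h0.const_smul (t ^ q)
    rw [smul_zero] at h
    exact h.congr (fun y hy => hQ.homogeneous t ht y hy) (hQ.homogeneous t ht p hp)
  have h3 := (uniqueDiffOn_quadrant p hp).eq h1 h2
  refine ContinuousLinearMap.ext fun y => ?_
  have h4 := congrArg (fun L : ℝ × ℝ →L[ℝ] ℝ => L (t⁻¹ • y)) h3
  simpa [smul_smul, mul_inv_cancel₀ ht.ne', ht.ne'] using h4

/-- The nonlinearity vanishes to first order on the coordinate half-axes: this holds at `(1, 0)` and
`(0, 1)` by assumption, and spreads along the axes by homogeneity. -/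
theorem IsNonlinearity.boundary (hQ : IsNonlinearity N s q Q) {p : ℝ × ℝ} (hp : p ∈ quadrant)
    (h0 : p.1 = 0 ∨ p.2 = 0) : Q p = 0 ∧ fderivWithin ℝ Q quadrant p = 0 := by
  suffices h : fderivWithin ℝ Q quadrant p = 0 from ⟨hQ.eq_zero_of_fderivWithin hp h, h⟩
  have hp1 : 0 ≤ p.1 := hp.1
  have hp2 : 0 ≤ p.2 := hp.2
  rcases hp1.eq_or_lt with h1 | h1
  · rcases hp2.eq_or_lt with h2 | h2
    · obtain ⟨C, -, hC⟩ := hQ.growth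
      have h := hC p hp
      have hq := hQ.two_lt
      rw [← h1, ← h2, Real.zero_rpow (by linarith), add_zero, mul_zero] at h
      have a1 := abs_nonneg (partialU Q p)
      have a2 := abs_nonneg (partialV Q p)
      exact fderivWithin_eq_zero_of_partial (abs_eq_zero.1 (by linarith))
        (abs_eq_zero.1 (by linarith))
    · have e : p = p.2 • ((0 : ℝ), (1 : ℝ)) := Prod.ext (by simp [← h1]) (by simp)
      rw [e]
      exact hQ.fderivWithin_smul (p := (0, 1)) ⟨le_refl (0 : ℝ), zero_le_one' ℝ⟩
        (fderivWithin_eq_zero_of_partial hQ.partialU_zero_one hQ.partialV_zero_one) h2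
  · have h2 : p.2 = 0 := h0.resolve_left h1.ne'
    have e : p = p.1 • ((1 : ℝ), (0 : ℝ)) := Prod.ext (by simp) (by simp [h2])
    rw [e]
    exact hQ.fderivWithin_smul (p := (1, 0)) ⟨zero_le_one' ℝ, le_refl (0 : ℝ)⟩
      (fderivWithin_eq_zero_of_partial hQ.partialU_one_zero hQ.partialV_one_zero) h1

theorem extend_of_le {p : ℝ × ℝ} (h : p.1 ≤ 0 ∨ p.2 ≤ 0) : extend Q p = 0 :=
  if_pos h

theorem IsNonlinearity.extend_of_mem (hQ : IsNonlinearity N s q Q) {p : ℝ × ℝ}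
    (hp : p ∈ quadrant) : extend Q p = Q p := by
  by_cases h : p.1 ≤ 0 ∨ p.2 ≤ 0
  · rw [extend_of_le h, (hQ.boundary hp _).1]
    exact h.imp (fun h => le_antisymm h hp.1) fun h => le_antisymm h hp.2
  · exact if_neg h

theorem IsNonlinearity.posHomogeneous_extend (hQ : IsNonlinearity N s q Q) :
    PosHomogeneous q (extend Q) := by
  intro t ht p
  by_cases h : p.1 ≤ 0 ∨ p.2 ≤ 0
  · rw [extend_of_le h, extend_of_le, smul_zero]
    exact h.imp (fun h => mul_nonpos_of_nonneg_of_nonpos ht.le h)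
      fun h => mul_nonpos_of_nonneg_of_nonpos ht.le h
  · have hp : p ∈ quadrant := by
      rw [not_or, not_le, not_le] at h
      exact ⟨h.1.le, h.2.le⟩
    rw [hQ.extend_of_mem hp, hQ.extend_of_mem (smul_mem_quadrant ht hp),
      hQ.homogeneous t ht p hp, smul_eq_mul]

/-- The nearest point of the closed quadrant. -/
def quadrantProj (p : ℝ × ℝ) : ℝ × ℝ := (max p.1 0, max p.2 0)

theorem quadrantProj_mem (p : ℝ × ℝ) : quadrantProj p ∈ quadrant :=
  ⟨le_max_right p.1 0, le_max_right p.2 0⟩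

theorem IsNonlinearity.hasFDerivAt_extend (hQ : IsNonlinearity N s q Q) (p : ℝ × ℝ) :
    HasFDerivAt (extend Q) (fderivWithin ℝ Q quadrant (quadrantProj p)) p := by
  by_cases h : p.1 ≤ 0 ∨ p.2 ≤ 0
  · have hb : fderivWithin ℝ Q quadrant (quadrantProj p) = 0 :=
      (hQ.boundary (quadrantProj_mem p)
        (h.imp (fun h => max_eq_right h) fun h => max_eq_right h)).2
    rw [hb, ← hasFDerivWithinAt_univ, ← Set.union_compl_self quadrant]
    refine HasFDerivWithinAt.union ?_ ?_
    · by_cases hp : p ∈ quadrant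
      · have e : quadrantProj p = p := Prod.ext (max_eq_left hp.1) (max_eq_left hp.2)
        have h1 := hQ.hasFDerivWithinAt hp
        rw [e] at hb
        rw [hb] at h1
        exact h1.congr (fun y hy => hQ.extend_of_mem hy) (hQ.extend_of_mem hp)
      · refine HasFDerivWithinAt.of_notMem_closure ?_
        have : IsClosed quadrant := isClosed_Ici.prod isClosed_Ici
        rwa [this.closure_eq]
    · refine (hasFDerivWithinAt_const (0 : ℝ) p _).congr (fun y hy => extend_of_le ?_)
        (extend_of_le h)
      by_contra hc
      rw [not_or, not_le, not_le] at hc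
      exact hy ⟨hc.1.le, hc.2.le⟩
  · rw [not_or, not_le, not_le] at h
    have e : quadrantProj p = p := Prod.ext (max_eq_left h.1.le) (max_eq_left h.2.le)
    have hn : quadrant ∈ 𝓝 p := prod_mem_nhds (Ici_mem_nhds h.1) (Ici_mem_nhds h.2)
    rw [e]
    refine ((hQ.hasFDerivWithinAt ⟨h.1.le, h.2.le⟩).hasFDerivAt hn).congr_of_eventuallyEq ?_
    filter_upwards [hn] with y hy using hQ.extend_of_mem hy

theorem IsNonlinearity.contDiff_extend (hQ : IsNonlinearity N s q Q) :
    ContDiff ℝ 1 (extend Q) := by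
  refine contDiff_one_iff_hasFDerivAt.2 ⟨_, ?_, hQ.hasFDerivAt_extend⟩
  refine (hQ.contDiffOn_one.continuousOn_fderivWithin uniqueDiffOn_quadrant le_rfl).comp_continuous
    ?_ quadrantProj_mem
  unfold quadrantProj
  fun_prop

end Extension

/-! ### The fractional Sobolev inequality below the critical exponent -/

section Sobolev

variable {N : ℕ} {s : ℝ} {u : Rn N → ℝ}

theorem gagliardoDensity_self_nonneg (s : ℝ) (u : Rn N → ℝ) (p : Rn N × Rn N) :
    0 ≤ gagliardoDensity s u u p :=
  div_nonneg (mul_self_nonneg _) (Real.rpow_nonneg (norm_nonneg _) _)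

/-- The square of the fractional gradient, `∫ |u(x) - u(y)|² / |x - y|^{N + 2s} dy`. -/
def gagliardoSlice (s : ℝ) (u : Rn N → ℝ) (x : Rn N) : ℝ :=
  ∫ y, gagliardoDensity s u u (x, y)

theorem gagliardoSlice_nonneg (s : ℝ) (u : Rn N → ℝ) (x : Rn N) : 0 ≤ gagliardoSlice s u x :=
  integral_nonneg fun _ => gagliardoDensity_self_nonneg s u _

theorem integrable_gagliardoSlice (h : Integrable (gagliardoDensity s u u)) :
    Integrable (gagliardoSlice s u) := by
  rw [Measure.volume_eq_prod] at h
  exact h.integral_prod_left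

theorem integral_gagliardoSlice (h : Integrable (gagliardoDensity s u u)) :
    ∫ x, gagliardoSlice s u x = gagliardoForm s u u := by
  unfold gagliardoSlice gagliardoForm
  rw [Measure.volume_eq_prod] at h ⊢
  exact (integral_prod _ h).symm

theorem ae_integrable_slice (h : Integrable (gagliardoDensity s u u)) :
    ∀ᵐ x, Integrable fun y => gagliardoDensity s u u (x, y) := by
  rw [Measure.volume_eq_prod] at h
  exact h.prod_right_ae

theorem sq_sub_le_gagliardoDensity (hs : 0 < s) (u : Rn N → ℝ) {h : ℝ} {x y : Rn N}
    (hxy : ‖x - y‖ ≤ h) :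
    (u x - u y) ^ 2 ≤ h ^ ((N : ℝ) + 2 * s) * gagliardoDensity s u u (x, y) := by
  have he : 0 < (N : ℝ) + 2 * s := by positivity
  rcases eq_or_ne x y with rfl | hne
  · simp [gagliardoDensity]
  · have h0 : 0 < ‖x - y‖ := norm_pos_iff.2 (sub_ne_zero.2 hne)
    have h1 : 0 < ‖x - y‖ ^ ((N : ℝ) + 2 * s) := Real.rpow_pos_of_pos h0 _
    have h2 : ‖x - y‖ ^ ((N : ℝ) + 2 * s) ≤ h ^ ((N : ℝ) + 2 * s) := by gcongr
    simp only [gagliardoDensity]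
    rw [mul_div_assoc', le_div_iff₀ h1, sq, mul_comm]
    exact mul_le_mul_of_nonneg_right h2 (mul_self_nonneg _)

theorem integrableOn_sq_sub (hs : 0 < s) (hu : Measurable u) {x : Rn N}
    (hx : Integrable fun y => gagliardoDensity s u u (x, y)) (h : ℝ) :
    IntegrableOn (fun y => (u x - u y) ^ 2) (Metric.ball x h) := by
  refine (hx.integrableOn.const_mul (h ^ ((N : ℝ) + 2 * s))).mono'
    ((measurable_const.sub hu).pow_const 2).aestronglyMeasurable ?_
  filter_upwards [ae_restrict_mem measurableSet_ball] with y hy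
  rw [Real.norm_of_nonneg (sq_nonneg _)]
  exact sq_sub_le_gagliardoDensity hs u (by rw [← dist_eq_norm']; exact (Metric.mem_ball.1 hy).le)

theorem integral_ball_sq_sub_le (hs : 0 < s) (hu : Measurable u) {x : Rn N}
    (hx : Integrable fun y => gagliardoDensity s u u (x, y)) {h : ℝ} (hh : 0 ≤ h) :
    ∫ y in Metric.ball x h, (u x - u y) ^ 2 ≤ h ^ ((N : ℝ) + 2 * s) * gagliardoSlice s u x := by
  calc ∫ y in Metric.ball x h, (u x - u y) ^ 2
      ≤ ∫ y in Metric.ball x h, h ^ ((N : ℝ) + 2 * s) * gagliardoDensity s u u (x, y) := by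
        refine setIntegral_mono_on (integrableOn_sq_sub hs hu hx h)
          (hx.integrableOn.const_mul _) measurableSet_ball fun y hy => ?_
        exact sq_sub_le_gagliardoDensity hs u
          (by rw [← dist_eq_norm']; exact (Metric.mem_ball.1 hy).le)
    _ ≤ ∫ y, h ^ ((N : ℝ) + 2 * s) * gagliardoDensity s u u (x, y) :=
        setIntegral_le_integral (hx.const_mul _) (Eventually.of_forall fun y =>
          mul_nonneg (Real.rpow_nonneg hh _) (gagliardoDensity_self_nonneg s u _))
    _ = _ := integral_const_mul _ _

/-- The volume of the unit ball of `ℝ^N`. -/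
def unitBallVolume (N : ℕ) : ℝ := volume.real (Metric.ball (0 : Rn N) 1)

theorem unitBallVolume_pos (N : ℕ) : 0 < unitBallVolume N :=
  ENNReal.toReal_pos (Metric.measure_ball_pos volume _ one_pos).ne' measure_ball_lt_top.ne

theorem volume_real_ball (x : Rn N) {h : ℝ} (hh : 0 < h) :
    volume.real (Metric.ball x h) = h ^ (N : ℝ) * unitBallVolume N := by
  rw [unitBallVolume, measureReal_def, measureReal_def, Measure.addHaar_ball_of_pos volume x hh,
    ENNReal.toReal_mul, ENNReal.toReal_ofReal (by positivity), finrank_euclideanSpace_fin,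
    Real.rpow_natCast]

/-- Self-improvement of integrability, pointwise. On a ball around `x` whose volume is twice the
Chebyshev bound for `{|u| ≥ |u(x)| / 2}`, the function `u` differs from `u(x)` by at least
`|u(x)| / 2` on half of the volume; this forces the fractional gradient at `x` to be large. -/
theorem rpow_abs_le_gagliardoSlice (hN : 0 < N) (hs : 0 < s) (hu : Measurable u) {p K : ℝ}
    (hp : 0 < p) (hK : 0 < K) (hi : Integrable fun y => |u y| ^ p) (hb : ∫ y, |u y| ^ p ≤ K)
    {x : Rn N} (hx : Integrable fun y => gagliardoDensity s u u (x, y)) :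
    |u x| ^ (2 + 2 * s * p / N) ≤
      8 / unitBallVolume N * (2 ^ (p + 1) * K / unitBallVolume N) ^ (2 * s / N) *
        gagliardoSlice s u x := by
  have hN' : (0 : ℝ) < N := Nat.cast_pos.2 hN
  have hω := unitBallVolume_pos N
  set ω := unitBallVolume N
  set A : ℝ := 2 ^ (p + 1) * K / ω with hA
  have hA0 : 0 < A := by positivity
  have hG := gagliardoSlice_nonneg s u x
  rcases (abs_nonneg (u x)).eq_or_lt with h0 | hU
  · rw [← h0, Real.zero_rpow (by positivity)]
    positivity
  set U := |u x| with hUdef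
  set h : ℝ := (A * U ^ (-p)) ^ (1 / (N : ℝ)) with hh
  have hb0 : 0 < A * U ^ (-p) := by positivity
  have hh0 : 0 < h := by positivity
  have hhN : h ^ (N : ℝ) = A * U ^ (-p) := by
    rw [hh, ← Real.rpow_mul hb0.le, one_div_mul_cancel hN'.ne', Real.rpow_one]
  have hhs : h ^ (2 * s) = A ^ (2 * s / N) * U ^ (-(2 * s * p / N)) := by
    rw [hh, ← Real.rpow_mul hb0.le, Real.mul_rpow hA0.le (by positivity), ← Real.rpow_mul hU.le]
    congr 2
    · ring
    · ring
  have hpt : ∀ y, U ^ 2 ≤ 4 * (u x - u y) ^ 2 + 2 ^ p * U ^ (2 - p) * |u y| ^ p := by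
    intro y
    rcases le_or_gt (U / 2) |u y| with h1 | h1
    · have h2 : (U / 2) ^ p ≤ |u y| ^ p := by gcongr
      have h3 : 2 ^ p * U ^ (2 - p) * (U / 2) ^ p = U ^ 2 := by
        rw [Real.div_rpow hU.le two_pos.le, mul_assoc, mul_div_assoc', ← Real.rpow_add hU,
          sub_add_cancel, Real.rpow_two]
        field_simp
      have h4 := mul_le_mul_of_nonneg_left h2 (by positivity : 0 ≤ 2 ^ p * U ^ (2 - p))
      nlinarith [sq_nonneg (u x - u y)]
    · have h2 : U / 2 ≤ |u x - u y| := by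
        have := abs_sub_abs_le_abs_sub (u x) (u y)
        linarith
      have h3 : (U / 2) ^ 2 ≤ (u x - u y) ^ 2 := by
        rw [← sq_abs (u x - u y)]
        gcongr
      have : 0 ≤ 2 ^ p * U ^ (2 - p) * |u y| ^ p := by positivity
      nlinarith
  have i1 := (integrableOn_sq_sub hs hu hx h).const_mul 4
  have i2 := (hi.const_mul (2 ^ p * U ^ (2 - p))).integrableOn (s := Metric.ball x h)
  have hint : h ^ (N : ℝ) * ω * U ^ 2 ≤
      4 * (h ^ ((N : ℝ) + 2 * s) * gagliardoSlice s u x) + 2 ^ p * U ^ (2 - p) * K := by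
    calc h ^ (N : ℝ) * ω * U ^ 2 = ∫ y in Metric.ball x h, U ^ 2 := by
          rw [setIntegral_const, volume_real_ball x hh0, smul_eq_mul]
      _ ≤ ∫ y in Metric.ball x h, (4 * (u x - u y) ^ 2 + 2 ^ p * U ^ (2 - p) * |u y| ^ p) :=
          integral_mono (integrableOn_const measure_ball_lt_top.ne) (i1.add i2) hpt
      _ = 4 * (∫ y in Metric.ball x h, (u x - u y) ^ 2)
            + 2 ^ p * U ^ (2 - p) * ∫ y in Metric.ball x h, |u y| ^ p := by
          rw [integral_add i1 i2, integral_const_mul, integral_const_mul]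
      _ ≤ _ := by
          gcongr
          · exact integral_ball_sq_sub_le hs hu hx hh0.le
          · exact (setIntegral_le_integral hi (Eventually.of_forall fun y => by positivity)).trans
              hb
  have e1 : U ^ (-p) * U ^ 2 = U ^ (2 - p) := by
    rw [← Real.rpow_two, ← Real.rpow_add hU]
    congr 1
    ring
  have e2 : A * ω = 2 * (2 ^ p * K) := by
    rw [hA, div_mul_cancel₀ _ hω.ne', Real.rpow_add two_pos, Real.rpow_one]
    ring
  have e3 : A * U ^ (-p) * ω * U ^ 2 = 2 * (2 ^ p * K) * U ^ (2 - p) := by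
    rw [← e1, ← e2]; ring
  have key : U ^ 2 ≤ 8 / ω * (h ^ (2 * s) * gagliardoSlice s u x) := by
    rw [Real.rpow_add hh0, hhN, e3] at hint
    have h5 : 2 ^ p * K * U ^ (2 - p) ≤
        4 * (A * U ^ (-p) * h ^ (2 * s) * gagliardoSlice s u x) := by linarith
    have h6 : A * U ^ (-p) * (ω * U ^ 2) ≤
        A * U ^ (-p) * (8 * (h ^ (2 * s) * gagliardoSlice s u x)) := by
      nlinarith
    have h7 := le_of_mul_le_mul_left h6 hb0
    rw [div_mul_eq_mul_div, le_div_iff₀ hω, mul_comm]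
    exact h7
  rw [hhs] at key
  have e4 : U ^ (2 + 2 * s * p / N) = U ^ 2 * U ^ (2 * s * p / N) := by
    rw [Real.rpow_add hU, Real.rpow_two]
  rw [e4]
  refine (mul_le_mul_of_nonneg_right key (by positivity)).trans (le_of_eq ?_)
  rw [Real.rpow_neg hU.le]
  field_simp

/-- Functions bounded in `H^s` are bounded in `L^p`. -/
def SobolevBound (N : ℕ) (s p : ℝ) : Prop :=
  ∀ K : ℝ, 0 < K → ∃ C : ℝ, 0 < C ∧ ∀ u : Rn N → ℝ, Measurable u →
    Integrable (gagliardoDensity s u u) → Integrable (fun x => u x ^ 2) →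
    gagliardoForm s u u ≤ K → ∫ x, u x ^ 2 ≤ K →
    Integrable (fun x => |u x| ^ p) ∧ ∫ x, |u x| ^ p ≤ C

theorem sobolevBound_two : SobolevBound N s 2 := by
  intro K hK
  refine ⟨K, hK, fun u _ _ h2 _ h2K => ?_⟩
  simp only [Real.rpow_two, sq_abs]
  exact ⟨h2, h2K⟩

theorem SobolevBound.improve (hN : 0 < N) (hs : 0 < s) {p : ℝ} (hp : 0 < p)
    (h : SobolevBound N s p) : SobolevBound N s (2 + 2 * s * p / N) := by
  intro K hK
  obtain ⟨C, hC, hb⟩ := h K hK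
  have hω := unitBallVolume_pos N
  set D := 8 / unitBallVolume N * (2 ^ (p + 1) * C / unitBallVolume N) ^ (2 * s / N)
  have hD : 0 < D := by positivity
  refine ⟨D * K, by positivity, fun u hu hd h2 hdK h2K => ?_⟩
  obtain ⟨hi, hC'⟩ := hb u hu hd h2 hdK h2K
  have hpt : ∀ᵐ x, |u x| ^ (2 + 2 * s * p / N) ≤ D * gagliardoSlice s u x := by
    filter_upwards [ae_integrable_slice hd] with x hx
    exact rpow_abs_le_gagliardoSlice hN hs hu hp hC hi hC' hx
  have hg := (integrable_gagliardoSlice hd).const_mul D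
  have hint : Integrable fun x => |u x| ^ (2 + 2 * s * p / N) := by
    refine hg.mono' (hu.abs.pow_const _).aestronglyMeasurable ?_
    filter_upwards [hpt] with x hx
    rwa [Real.norm_of_nonneg (by positivity)]
  refine ⟨hint, (integral_mono_ae hint hg hpt).trans ?_⟩
  rw [integral_const_mul, integral_gagliardoSlice hd]
  gcongr

theorem SobolevBound.interpolate {p q : ℝ} (hq : 2 ≤ q) (hqp : q ≤ p) (h : SobolevBound N s p) :
    SobolevBound N s q := by
  intro K hK
  obtain ⟨C, hC, hb⟩ := h K hK
  refine ⟨K + C, by positivity, fun u hu hd h2 hdK h2K => ?_⟩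
  obtain ⟨hi, hC'⟩ := hb u hu hd h2 hdK h2K
  have hpt : ∀ x, |u x| ^ q ≤ u x ^ 2 + |u x| ^ p := by
    intro x
    rcases le_total |u x| 1 with h1 | h1
    · rcases (abs_nonneg (u x)).eq_or_lt with h0 | h0
      · rw [← h0, Real.zero_rpow (by linarith)]
        positivity
      · have := Real.rpow_le_rpow_of_exponent_ge h0 h1 hq
        rw [Real.rpow_two, sq_abs] at this
        have : 0 ≤ |u x| ^ p := by positivity
        linarith
    · have := Real.rpow_le_rpow_of_exponent_le h1 hqp
      nlinarith [sq_nonneg (u x)]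
  have hint : Integrable fun x => |u x| ^ q := by
    refine (h2.add hi).mono' (hu.abs.pow_const _).aestronglyMeasurable
      (Eventually.of_forall fun x => ?_)
    rw [Real.norm_of_nonneg (by positivity)]
    exact hpt x
  refine ⟨hint, (integral_mono hint (h2.add hi) hpt).trans ?_⟩
  simp only [Pi.add_apply]
  rw [integral_add h2 hi]
  exact add_le_add h2K hC'

/-- The map `p ↦ 2 + 2sp/N` contracts towards the critical exponent, so iterated self-improvement
starting from `p = 2` passes every subcritical exponent. -/
theorem exists_sobolevBound (hN : 2 * s < N) (hs : 0 < s) {q : ℝ} (hq : q < criticalExponent N s) :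
    ∃ p, q < p ∧ SobolevBound N s p := by
  have hN' : (0 : ℝ) < N := by linarith
  have hN0 : 0 < N := Nat.cast_pos.1 hN'
  have hd : 0 < (N : ℝ) - 2 * s := by linarith
  set P := criticalExponent N s with hP
  have hfix : P = 2 + 2 * s * P / N := by
    rw [hP, criticalExponent]
    field_simp
    ring
  have hP2 : 2 < P := by
    have : 0 < P := by rw [hP, criticalExponent]; positivity
    have : 0 < 2 * s * P / N := by positivity
    linarith
  set θ : ℝ := 2 * s / N with hθ
  have hθ0 : 0 < θ := by positivity
  have hθ1 : θ < 1 := by rw [hθ, div_lt_one hN']; exact hN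
  have hk : ∀ k : ℕ, SobolevBound N s (P - (P - 2) * θ ^ k) := by
    intro k
    induction k with
    | zero => simpa using sobolevBound_two
    | succ k ih =>
      have hpos : 0 < P - (P - 2) * θ ^ k := by
        have : θ ^ k ≤ 1 := pow_le_one₀ hθ0.le hθ1.le
        nlinarith
      have h := ih.improve hN0 hs hpos
      have e : 2 + 2 * s * (P - (P - 2) * θ ^ k) / N = P - (P - 2) * θ ^ (k + 1) := by
        have e1 : 2 * s * (P - (P - 2) * θ ^ k) / N = 2 * s * P / N - (P - 2) * θ ^ (k + 1) := by
          rw [pow_succ, hθ]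
          ring
        rw [e1]
        linarith
      rwa [e] at h
  have ht : Tendsto (fun k : ℕ => P - (P - 2) * θ ^ k) atTop (𝓝 P) := by
    have := (tendsto_pow_atTop_nhds_zero_of_lt_one hθ0.le hθ1).const_mul (P - 2)
    simpa using this.const_sub P
  obtain ⟨k, hk'⟩ := (ht.eventually (lt_mem_nhds hq)).exists
  exact ⟨_, hk', hk k⟩

end Sobolev

/-! ### Local compactness -/

section Rellich

variable {N : ℕ} {s : ℝ} {u : Rn N → ℝ}

/-- The value of `u` at `x` is controlled by the fractional gradient at `x` and by the mean of `u`
over a ball around `x`. -/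
theorem sq_mul_volume_ball_le (hs : 0 < s) (hu : Measurable u) {h : ℝ} (hh : 0 < h) {x : Rn N}
    (hx : Integrable fun y => gagliardoDensity s u u (x, y))
    (hi : IntegrableOn u (Metric.ball x h)) :
    u x ^ 2 * (h ^ (N : ℝ) * unitBallVolume N) / 4 ≤
      h ^ ((N : ℝ) + 2 * s) * gagliardoSlice s u x / 2 +
        (∫ y in Metric.ball x h, u y) ^ 2 / (h ^ (N : ℝ) * unitBallVolume N) := by
  have hv := volume_real_ball x hh
  have hω := unitBallVolume_pos N
  set b := h ^ (N : ℝ) * unitBallVolume N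
  have hb : 0 < b := by positivity
  set I := ∫ y in Metric.ball x h, u y
  have i0 : IntegrableOn (fun _ : Rn N => u x ^ 2 / 2) (Metric.ball x h) :=
    integrableOn_const measure_ball_lt_top.ne
  have i1 := (integrableOn_sq_sub hs hu hx h).div_const 2
  have i2 := hi.const_mul (u x)
  -- `u(x)² = u(x) (u(x) - u(y)) + u(x) u(y)`, integrated in `y`
  have h1 : b * u x ^ 2 ≤
      b * (u x ^ 2 / 2) + (∫ y in Metric.ball x h, (u x - u y) ^ 2) / 2 + u x * I := by
    calc b * u x ^ 2 = ∫ y in Metric.ball x h, u x ^ 2 := by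
          rw [setIntegral_const, hv, smul_eq_mul]
      _ ≤ ∫ y in Metric.ball x h, (u x ^ 2 / 2 + (u x - u y) ^ 2 / 2 + u x * u y) := by
          refine integral_mono (integrableOn_const measure_ball_lt_top.ne) ((Integrable.add i0 i1).add i2)
            fun y => ?_
          simp only []
          nlinarith [sq_nonneg (u y)]
      _ = _ := by
          rw [integral_add (f := fun y => u x ^ 2 / 2 + (u x - u y) ^ 2 / 2) (Integrable.add i0 i1) i2,
            integral_add i0 i1, integral_const_mul, setIntegral_const, hv, smul_eq_mul,
            integral_div]
  have h2 := integral_ball_sq_sub_le hs hu hx hh.le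
  have h3 : u x * I ≤ u x ^ 2 * b / 4 + I ^ 2 / b := by
    have e : u x ^ 2 * b / 4 + I ^ 2 / b - u x * I = (u x * b / 2 - I) ^ 2 / b := by
      field_simp
      ring
    have : 0 ≤ (u x * b / 2 - I) ^ 2 / b := by positivity
    linarith
  linarith

end Rellich

/-! ### The Nehari manifold of a homogeneous perturbation of the squared norm -/

section AbstractNehari

variable {E : Type*} [NormedAddCommGroup E] [InnerProductSpace ℝ E] {J Φ : E → ℝ} {q d : ℝ}

theorem hasFDerivAt_half_norm_sq (w : E) :
    HasFDerivAt (fun w : E => 1 / 2 * ‖w‖ ^ 2) (innerSL ℝ w) w := by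
  have h := ((hasStrictFDerivAt_norm_sq w).hasFDerivAt).const_mul (1 / 2)
  refine h.congr_fderiv ?_
  ext y
  simp

theorem contDiff_energy (hJ : ∀ w, J w = 1 / 2 * ‖w‖ ^ 2 - Φ w) (hΦ : ContDiff ℝ 1 Φ) :
    ContDiff ℝ 1 J := by
  rw [funext hJ]
  exact (contDiff_const.mul (contDiff_norm_sq ℝ)).sub hΦ

theorem fderiv_energy (hJ : ∀ w, J w = 1 / 2 * ‖w‖ ^ 2 - Φ w) (hΦ : ContDiff ℝ 1 Φ) (w φ : E) :
    fderiv ℝ J w φ = inner ℝ w φ - fderiv ℝ Φ w φ := by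
  have h : HasFDerivAt J (innerSL ℝ w - fderiv ℝ Φ w) w := by
    rw [funext hJ]
    exact (hasFDerivAt_half_norm_sq w).sub (hΦ.differentiable one_ne_zero w).hasFDerivAt
  rw [h.fderiv]
  simp

theorem nehariConstraint_eq (hJ : ∀ w, J w = 1 / 2 * ‖w‖ ^ 2 - Φ w) (hΦ : ContDiff ℝ 1 Φ)
    (hom : PosHomogeneous q Φ) (w : E) : nehariConstraint J w = ‖w‖ ^ 2 - q * Φ w := by
  rw [nehariConstraint, fderiv_energy hJ hΦ, real_inner_self_eq_norm_sq,
    hom.fderiv_apply_self (hΦ.differentiable one_ne_zero w)]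

theorem contDiff_nehariConstraint (hJ : ∀ w, J w = 1 / 2 * ‖w‖ ^ 2 - Φ w) (hΦ : ContDiff ℝ 1 Φ)
    (hom : PosHomogeneous q Φ) : ContDiff ℝ 1 (nehariConstraint J) := by
  rw [funext (nehariConstraint_eq hJ hΦ hom)]
  exact (contDiff_norm_sq ℝ).sub (contDiff_const.mul hΦ)

theorem fderiv_nehariConstraint (hJ : ∀ w, J w = 1 / 2 * ‖w‖ ^ 2 - Φ w) (hΦ : ContDiff ℝ 1 Φ)
    (hom : PosHomogeneous q Φ) (w : E) :
    fderiv ℝ (nehariConstraint J) w = (2 : ℝ) • innerSL ℝ w - q • fderiv ℝ Φ w := by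
  rw [funext (nehariConstraint_eq hJ hΦ hom)]
  refine HasFDerivAt.fderiv ?_
  refine HasFDerivAt.sub ?_ ((hΦ.differentiable one_ne_zero w).hasFDerivAt.const_mul q)
  refine (hasStrictFDerivAt_norm_sq w).hasFDerivAt.congr_fderiv ?_
  ext y
  simp

/-- The constraint is nondegenerate in the radial direction. -/
theorem fderiv_nehariConstraint_self (hJ : ∀ w, J w = 1 / 2 * ‖w‖ ^ 2 - Φ w)
    (hΦ : ContDiff ℝ 1 Φ) (hom : PosHomogeneous q Φ) {w : E} (hw : w ∈ nehari J) :
    fderiv ℝ (nehariConstraint J) w w = (2 - q) * ‖w‖ ^ 2 := by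
  have h := hw.2
  rw [nehariConstraint_eq hJ hΦ hom] at h
  rw [fderiv_nehariConstraint hJ hΦ hom]
  simp only [sub_apply, smul_apply, innerSL_apply_apply,
    real_inner_self_eq_norm_sq, smul_eq_mul,
    hom.fderiv_apply_self (hΦ.differentiable one_ne_zero w)]
  linear_combination q * h

/-- `J'(w)` annihilates the radial direction, which is transversal to the tangent space; it is
therefore determined by its restriction to the tangent space, with a quantitative bound. -/
theorem norm_fderiv_le_constrainedDeriv (hq : 2 < q) (hJ : ∀ w, J w = 1 / 2 * ‖w‖ ^ 2 - Φ w)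
    (hΦ : ContDiff ℝ 1 Φ) (hom : PosHomogeneous q Φ) {w : E} (hw : w ∈ nehari J) :
    ‖fderiv ℝ J w‖ ≤ ‖constrainedDeriv J w‖ *
      (1 + ‖fderiv ℝ (nehariConstraint J) w‖ / ((q - 2) * ‖w‖)) := by
  have hn : 0 < ‖w‖ := norm_pos_iff.2 hw.1
  have hq2 : 0 < q - 2 := by linarith
  have hs := fderiv_nehariConstraint_self hJ hΦ hom hw
  refine ContinuousLinearMap.opNorm_le_bound _ (by positivity) fun φ => ?_
  set G := fderiv ℝ (nehariConstraint J) w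
  set α := G φ / ((2 - q) * ‖w‖ ^ 2) with hα
  have hne : (2 - q) * ‖w‖ ^ 2 ≠ 0 := mul_ne_zero (by linarith) (by positivity)
  have hmem : φ - α • w ∈ nehariTangent J w := by
    rw [nehariTangent, LinearMap.mem_ker]
    change G (φ - α • w) = 0
    rw [map_sub, map_smul, hs, smul_eq_mul, hα, div_mul_cancel₀ _ hne, sub_self]
  have hJ0 : fderiv ℝ J w w = 0 := hw.2
  have e : fderiv ℝ J w φ = constrainedDeriv J w ⟨φ - α • w, hmem⟩ := by
    change _ = fderiv ℝ J w (φ - α • w)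
    rw [map_sub, map_smul, hJ0, smul_zero, sub_zero]
  have hαn : ‖α‖ = ‖G φ‖ / ((q - 2) * ‖w‖ ^ 2) := by
    rw [hα, norm_div, norm_mul, norm_pow, norm_norm, Real.norm_eq_abs (2 - q),
      abs_of_neg (by linarith), neg_sub]
  have hb : ‖φ - α • w‖ ≤ (1 + ‖G‖ / ((q - 2) * ‖w‖)) * ‖φ‖ := by
    calc ‖φ - α • w‖ ≤ ‖φ‖ + ‖α‖ * ‖w‖ := by rw [← norm_smul]; exact norm_sub_le _ _
      _ ≤ ‖φ‖ + ‖G‖ * ‖φ‖ / ((q - 2) * ‖w‖ ^ 2) * ‖w‖ := by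
          rw [hαn]
          gcongr
          exact G.le_opNorm φ
      _ = _ := by field_simp
  rw [e, mul_assoc]
  refine (ContinuousLinearMap.le_opNorm _ _).trans ?_
  gcongr
  exact hb

theorem fderiv_eq_zero_of_constrainedDeriv (hq : 2 < q)
    (hJ : ∀ w, J w = 1 / 2 * ‖w‖ ^ 2 - Φ w) (hΦ : ContDiff ℝ 1 Φ) (hom : PosHomogeneous q Φ)
    {w : E} (hw : w ∈ nehari J) (h0 : constrainedDeriv J w = 0) : fderiv ℝ J w = 0 := by
  have h := norm_fderiv_le_constrainedDeriv hq hJ hΦ hom hw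
  have hz : ‖constrainedDeriv J w‖ = 0 := by
    rw [h0]
    exact ContinuousLinearMap.opNorm_zero
  rw [hz, zero_mul] at h
  exact norm_le_zero_iff.1 h

/-- The Nehari manifold stays away from the origin. -/
theorem exists_le_norm_of_mem_nehari (hq : 2 < q) (hJ : ∀ w, J w = 1 / 2 * ‖w‖ ^ 2 - Φ w)
    (hΦ : ContDiff ℝ 1 Φ) (hom : PosHomogeneous q Φ) :
    ∃ c, 0 < c ∧ ∀ w ∈ nehari J, c ≤ ‖w‖ := by
  obtain ⟨M, hM, hb⟩ := hom.exists_bound (by linarith) hΦ.continuous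
  have hq0 : 0 < q := by linarith
  refine ⟨(1 / (q * M)) ^ (1 / (q - 2)), by positivity, fun w hw => ?_⟩
  have hn : 0 < ‖w‖ := norm_pos_iff.2 hw.1
  have h := hw.2
  rw [nehariConstraint_eq hJ hΦ hom] at h
  have h1 := (le_abs_self _).trans (hb w)
  have h2 : ‖w‖ ^ 2 * 1 ≤ ‖w‖ ^ 2 * (q * M * ‖w‖ ^ (q - 2)) := by
    have e : ‖w‖ ^ 2 * ‖w‖ ^ (q - 2) = ‖w‖ ^ q := by
      rw [← Real.rpow_two, ← Real.rpow_add hn]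
      congr 1
      ring
    have h5 := mul_le_mul_of_nonneg_left h1 hq0.le
    linear_combination h5 + h - q * M * e
  have h3 := le_of_mul_le_mul_left h2 (by positivity)
  have h4 : 1 / (q * M) ≤ ‖w‖ ^ (q - 2) := by
    rw [div_le_iff₀ (by positivity)]
    linarith
  calc (1 / (q * M)) ^ (1 / (q - 2)) ≤ (‖w‖ ^ (q - 2)) ^ (1 / (q - 2)) := by
        have : 0 ≤ 1 / (q - 2) := one_div_nonneg.2 (by linarith)
        gcongr
    _ = ‖w‖ := by
        rw [← Real.rpow_mul hn.le, mul_one_div_cancel (by linarith), Real.rpow_one]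

theorem half_sub_one_div_pos (hq : 2 < q) : 0 < 1 / 2 - 1 / q :=
  sub_pos.2 (one_div_lt_one_div_of_lt two_pos hq)

theorem energy_eq_of_mem_nehari (hq : 2 < q) (hJ : ∀ w, J w = 1 / 2 * ‖w‖ ^ 2 - Φ w)
    (hΦ : ContDiff ℝ 1 Φ) (hom : PosHomogeneous q Φ) {w : E} (hw : w ∈ nehari J) :
    J w = (1 / 2 - 1 / q) * ‖w‖ ^ 2 := by
  have h := hw.2
  rw [nehariConstraint_eq hJ hΦ hom] at h
  have hq0 : q ≠ 0 := by linarith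
  have : Φ w = ‖w‖ ^ 2 / q := by
    rw [eq_div_iff hq0]
    linarith
  rw [hJ, this]
  ring

theorem IsConstrainedPSSeq.tendsto_norm_sq (hq : 2 < q)
    (hJ : ∀ w, J w = 1 / 2 * ‖w‖ ^ 2 - Φ w) (hΦ : ContDiff ℝ 1 Φ) (hom : PosHomogeneous q Φ)
    {w : ℕ → E} (hw : IsConstrainedPSSeq J d w) :
    Tendsto (fun n => ‖w n‖ ^ 2) atTop (𝓝 (d / (1 / 2 - 1 / q))) := by
  have hκ := half_sub_one_div_pos hq
  refine (hw.2.1.div_const (1 / 2 - 1 / q)).congr fun n => ?_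
  rw [energy_eq_of_mem_nehari hq hJ hΦ hom (hw.1 n), mul_div_cancel_left₀ _ hκ.ne']

/-- A constrained Palais–Smale sequence is a Palais–Smale sequence of the free functional. -/
theorem IsConstrainedPSSeq.tendsto_fderiv (hq : 2 < q)
    (hJ : ∀ w, J w = 1 / 2 * ‖w‖ ^ 2 - Φ w) (hΦ : ContDiff ℝ 1 Φ) (hom : PosHomogeneous q Φ)
    {w : ℕ → E} (hw : IsConstrainedPSSeq J d w) {R : ℝ} (hR : ∀ n, ‖w n‖ ≤ R) :
    Tendsto (fun n => ‖fderiv ℝ J (w n)‖) atTop (𝓝 0) := by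
  obtain ⟨c, hc, hcw⟩ := exists_le_norm_of_mem_nehari hq hJ hΦ hom
  obtain ⟨M, hM, hb⟩ := (hom.fderiv (hΦ.differentiable one_ne_zero)).exists_bound (by linarith)
    (hΦ.continuous_fderiv one_ne_zero)
  have hR0 : 0 ≤ R := (norm_nonneg _).trans (hR 0)
  have hq2 : 0 < q - 2 := by linarith
  have hq0 : 0 < q := by linarith
  set B := 2 * R + q * (M * R ^ (q - 1))
  have hG : ∀ n, ‖fderiv ℝ (nehariConstraint J) (w n)‖ ≤ B := fun n => by
    rw [fderiv_nehariConstraint hJ hΦ hom]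
    refine (norm_sub_le _ _).trans ?_
    rw [norm_smul, norm_smul, innerSL_apply_norm, Real.norm_of_nonneg two_pos.le,
      Real.norm_of_nonneg hq0.le]
    refine add_le_add (by gcongr; exact hR n) ?_
    gcongr
    refine (hb _).trans ?_
    have : 0 ≤ q - 1 := by linarith
    gcongr
    exact hR n
  have h0 := hw.2.2.mul_const (1 + B / ((q - 2) * c))
  rw [zero_mul] at h0
  refine squeeze_zero (fun n => norm_nonneg _) (fun n => ?_) h0
  refine (norm_fderiv_le_constrainedDeriv hq hJ hΦ hom (hw.1 n)).trans ?_
  have hB : 0 ≤ B := (norm_nonneg _).trans (hG 0)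
  gcongr
  · exact hG n
  · exact hcw _ (hw.1 n)

end AbstractNehari

/-! ### Weak compactness -/

/-- Bounded sequences in a Hilbert space have weakly convergent subsequences. The closed span of the
sequence is separable, and the sequential Banach–Alaoglu theorem applies to it. -/
theorem exists_weak_subseq {E : Type*} [NormedAddCommGroup E] [InnerProductSpace ℝ E]
    [CompleteSpace E] {w : ℕ → E} {R : ℝ} (hR : ∀ n, ‖w n‖ ≤ R) :
    ∃ (k : ℕ → ℕ) (w₀ : E), StrictMono k ∧
      ∀ y, Tendsto (fun n => inner ℝ (w (k n)) y) atTop (𝓝 (inner ℝ w₀ y)) := by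
  set K : Submodule ℝ E := (Submodule.span ℝ (Set.range w)).topologicalClosure with hK
  have : CompleteSpace K := (Submodule.isClosed_topologicalClosure _).completeSpace_coe
  have hsep : TopologicalSpace.IsSeparable (K : Set E) := by
    rw [hK, Submodule.topologicalClosure_coe]
    exact ((Set.countable_range w).isSeparable.span (R := ℝ)).closure
  have : TopologicalSpace.SeparableSpace K := hsep.separableSpace
  have hw : ∀ n, w n ∈ K := fun n =>
    Submodule.le_topologicalClosure _ (Submodule.subset_span (Set.mem_range_self n))
  set ℓ : ℕ → WeakDual ℝ K := fun n =>
    StrongDual.toWeakDual (InnerProductSpace.toDual ℝ K ⟨w n, hw n⟩)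
  have hℓ : ∀ n, ℓ n ∈ WeakDual.toStrongDual ⁻¹' Metric.closedBall (0 : StrongDual ℝ K) R := by
    intro n
    refine (mem_closedBall_zero_iff (E := StrongDual ℝ K)).2 ?_
    change ‖InnerProductSpace.toDual ℝ K ⟨w n, hw n⟩‖ ≤ R
    rw [LinearIsometryEquiv.norm_map]
    exact hR n
  obtain ⟨ℓ₀, -, k, hk, hlim⟩ := WeakDual.isSeqCompact_closedBall ℝ K 0 R hℓ
  set w₀ := (InnerProductSpace.toDual ℝ K).symm (WeakDual.toStrongDual ℓ₀)
  refine ⟨k, w₀, hk, fun y => ?_⟩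
  have hy := ((WeakBilin.eval_continuous (topDualPairing ℝ K)
    (K.orthogonalProjectionOnto y)).tendsto ℓ₀).comp hlim
  have e : ∀ z : K, inner ℝ (z : E) y = inner ℝ z (K.orthogonalProjectionOnto y) := fun z => by
    rw [← Submodule.inner_orthogonalProjectionOnto_eq_of_mem_left, real_inner_comm,
      real_inner_comm]
  have h1 : inner ℝ (w₀ : E) y = ℓ₀ (K.orthogonalProjectionOnto y) := by
    rw [e, InnerProductSpace.toDual_symm_apply]
    rfl
  rw [h1]
  refine hy.congr fun n => ?_
  rw [e ⟨w (k n), hw _⟩]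
  rfl

/-! ### Completeness of the energy space -/

/-- Fatou's lemma for a bounded sequence of nonnegative integrable functions. -/
theorem integrable_of_ae_tendsto {α : Type*} {mα : MeasurableSpace α} {μ : Measure α}
    {f : ℕ → α → ℝ} {g : α → ℝ} {R : ℝ} (hf : ∀ n, Integrable (f n) μ) (h0 : ∀ n x, 0 ≤ f n x)
    (hlim : ∀ᵐ x ∂μ, Tendsto (fun n => f n x) atTop (𝓝 (g x))) (hb : ∀ n, ∫ x, f n x ∂μ ≤ R) :
    Integrable g μ ∧ ∫ x, g x ∂μ ≤ R := by
  have hg0 : 0 ≤ᵐ[μ] g := by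
    filter_upwards [hlim] with x hx
    exact ge_of_tendsto' hx fun n => h0 n x
  have hgm : AEStronglyMeasurable g μ :=
    aestronglyMeasurable_of_tendsto_ae atTop (fun n => (hf n).aestronglyMeasurable) hlim
  have hR : 0 ≤ R := (integral_nonneg (h0 0)).trans (hb 0)
  have key : ∫⁻ x, ENNReal.ofReal (g x) ∂μ ≤ ENNReal.ofReal R := by
    calc ∫⁻ x, ENNReal.ofReal (g x) ∂μ
        = ∫⁻ x, liminf (fun n => ENNReal.ofReal (f n x)) atTop ∂μ := by
          refine lintegral_congr_ae ?_
          filter_upwards [hlim] with x hx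
          exact (ENNReal.tendsto_ofReal hx).liminf_eq.symm
      _ ≤ liminf (fun n => ∫⁻ x, ENNReal.ofReal (f n x) ∂μ) atTop :=
          lintegral_liminf_le' fun n => (hf n).aestronglyMeasurable.aemeasurable.ennreal_ofReal
      _ ≤ ENNReal.ofReal R := by
          refine liminf_le_of_le (by isBoundedDefault) fun b hb' => ?_
          obtain ⟨n, hn⟩ := hb'.exists
          refine hn.trans ?_
          rw [← ofReal_integral_eq_lintegral_ofReal (hf n) (Eventually.of_forall (h0 n))]
          exact ENNReal.ofReal_le_ofReal (hb n)
  have hgi : Integrable g μ := by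
    refine ⟨hgm, ?_⟩
    rw [hasFiniteIntegral_iff_ofReal hg0]
    exact key.trans_lt ENNReal.ofReal_lt_top
  refine ⟨hgi, ?_⟩
  rw [← ofReal_integral_eq_lintegral_ofReal hgi hg0] at key
  exact (ENNReal.ofReal_le_ofReal_iff hR).1 key

theorem integrable_sq_L2 {N : ℕ} (u : L2 N) : Integrable fun x => u x ^ 2 :=
  (Lp.memLp u).integrable_sq

theorem integral_sq_L2 {N : ℕ} (u : L2 N) : ∫ x, u x ^ 2 = ‖u‖ ^ 2 := by
  rw [← real_inner_self_eq_norm_sq, L2.inner_def]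
  refine integral_congr_ae (Eventually.of_forall fun x => ?_)
  simp

theorem IsPotential.iInf_le {N : ℕ} {a : Rn N → ℝ} (ha : IsPotential a) (x : Rn N) :
    ⨅ x, a x ≤ a x := by
  have hb : BddBelow (Set.range a) := by
    by_contra h
    have := ha.iInf_pos
    rw [Real.iInf_of_not_bddBelow h] at this
    exact lt_irrefl _ this
  exact ciInf_le hb x

namespace EnergySpace

variable {N : ℕ} {s : ℝ} {a b : Rn N → ℝ} {ha : IsPotential a} {hb : IsPotential b}

theorem integrable_mul_sq_u (w : EnergySpace s ha hb) : Integrable fun x => a x * w.u x ^ 2 := by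
  refine (integrable_potential w w).mono'
    (ha.continuous.measurable.mul ((measurable_coe w.u).pow_const 2)).aestronglyMeasurable
    (Eventually.of_forall fun x => ?_)
  rw [Real.norm_of_nonneg (mul_nonneg (ha.pos x).le (sq_nonneg _)), sq]
  exact le_add_of_nonneg_right (mul_nonneg (hb.pos x).le (mul_self_nonneg _))

theorem integrable_mul_sq_v (w : EnergySpace s ha hb) : Integrable fun x => b x * w.v x ^ 2 := by
  refine (integrable_potential w w).mono'
    (hb.continuous.measurable.mul ((measurable_coe w.v).pow_const 2)).aestronglyMeasurable
    (Eventually.of_forall fun x => ?_)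
  rw [Real.norm_of_nonneg (mul_nonneg (hb.pos x).le (sq_nonneg _)), sq]
  exact le_add_of_nonneg_left (mul_nonneg (ha.pos x).le (mul_self_nonneg _))

theorem norm_sq_eq_add (w : EnergySpace s ha hb) :
    ‖w‖ ^ 2 = gagliardoForm s w.u w.u + gagliardoForm s w.v w.v +
      (∫ x, a x * w.u x ^ 2) + ∫ x, b x * w.v x ^ 2 := by
  rw [norm_sq_eq, integral_add (integrable_mul_sq_u w) (integrable_mul_sq_v w), add_assoc, add_assoc,
    add_assoc]

theorem integral_mul_sq_u_nonneg (w : EnergySpace s ha hb) : 0 ≤ ∫ x, a x * w.u x ^ 2 :=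
  integral_nonneg fun x => mul_nonneg (ha.pos x).le (sq_nonneg _)

theorem integral_mul_sq_v_nonneg (w : EnergySpace s ha hb) : 0 ≤ ∫ x, b x * w.v x ^ 2 :=
  integral_nonneg fun x => mul_nonneg (hb.pos x).le (sq_nonneg _)

theorem gagliardoForm_u_le (w : EnergySpace s ha hb) : gagliardoForm s w.u w.u ≤ ‖w‖ ^ 2 := by
  have := norm_sq_eq_add w
  have := integral_mul_sq_u_nonneg w
  have := integral_mul_sq_v_nonneg w
  have := gagliardoForm_self_nonneg (s := s) (w.v : Rn N → ℝ)
  linarith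

theorem gagliardoForm_v_le (w : EnergySpace s ha hb) : gagliardoForm s w.v w.v ≤ ‖w‖ ^ 2 := by
  have := norm_sq_eq_add w
  have := integral_mul_sq_u_nonneg w
  have := integral_mul_sq_v_nonneg w
  have := gagliardoForm_self_nonneg (s := s) (w.u : Rn N → ℝ)
  linarith

theorem integral_mul_sq_u_le (w : EnergySpace s ha hb) : ∫ x, a x * w.u x ^ 2 ≤ ‖w‖ ^ 2 := by
  have := norm_sq_eq_add w
  have := integral_mul_sq_v_nonneg w
  have := gagliardoForm_self_nonneg (s := s) (w.u : Rn N → ℝ)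
  have := gagliardoForm_self_nonneg (s := s) (w.v : Rn N → ℝ)
  linarith

theorem integral_mul_sq_v_le (w : EnergySpace s ha hb) : ∫ x, b x * w.v x ^ 2 ≤ ‖w‖ ^ 2 := by
  have := norm_sq_eq_add w
  have := integral_mul_sq_u_nonneg w
  have := gagliardoForm_self_nonneg (s := s) (w.u : Rn N → ℝ)
  have := gagliardoForm_self_nonneg (s := s) (w.v : Rn N → ℝ)
  linarith

theorem integral_sq_u_le (w : EnergySpace s ha hb) :
    ∫ x, w.u x ^ 2 ≤ ‖w‖ ^ 2 / ⨅ x, a x := by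
  rw [le_div_iff₀ ha.iInf_pos, mul_comm, ← integral_const_mul]
  refine le_trans ?_ (integral_mul_sq_u_le w)
  exact integral_mono ((integrable_sq_L2 _).const_mul _) (integrable_mul_sq_u w) fun x =>
    mul_le_mul_of_nonneg_right (ha.iInf_le x) (sq_nonneg _)

theorem integral_sq_v_le (w : EnergySpace s ha hb) :
    ∫ x, w.v x ^ 2 ≤ ‖w‖ ^ 2 / ⨅ x, b x := by
  rw [le_div_iff₀ hb.iInf_pos, mul_comm, ← integral_const_mul]
  refine le_trans ?_ (integral_mul_sq_v_le w)
  exact integral_mono ((integrable_sq_L2 _).const_mul _) (integrable_mul_sq_v w) fun x =>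
    mul_le_mul_of_nonneg_right (hb.iInf_le x) (sq_nonneg _)

variable (s ha hb) in
/-- The first component as a continuous linear map into `L²`. -/
def uL : EnergySpace s ha hb →L[ℝ] L2 N :=
  LinearMap.mkContinuous { toFun := u, map_add' := fun _ _ => rfl, map_smul' := fun _ _ => rfl }
    (√(⨅ x, a x))⁻¹ fun w => by
      have h := integral_sq_u_le w
      rw [integral_sq_L2] at h
      refine abs_le_of_sq_le_sq' ?_ (by positivity) |>.2
      rw [mul_pow, inv_pow, Real.sq_sqrt ha.iInf_pos.le, inv_mul_eq_div]
      exact h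

variable (s ha hb) in
/-- The second component as a continuous linear map into `L²`. -/
def vL : EnergySpace s ha hb →L[ℝ] L2 N :=
  LinearMap.mkContinuous { toFun := v, map_add' := fun _ _ => rfl, map_smul' := fun _ _ => rfl }
    (√(⨅ x, b x))⁻¹ fun w => by
      have h := integral_sq_v_le w
      rw [integral_sq_L2] at h
      refine abs_le_of_sq_le_sq' ?_ (by positivity) |>.2
      rw [mul_pow, inv_pow, Real.sq_sqrt hb.iInf_pos.le, inv_mul_eq_div]
      exact h

@[simp] theorem uL_apply (w : EnergySpace s ha hb) : uL s ha hb w = w.u := rfl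

@[simp] theorem vL_apply (w : EnergySpace s ha hb) : vL s ha hb w = w.v := rfl

theorem tendsto_gagliardoDensity {u : ℕ → L2 N} {u₀ : L2 N}
    (h : ∀ᵐ x, Tendsto (fun n => u n x) atTop (𝓝 (u₀ x))) :
    ∀ᵐ p : Rn N × Rn N, Tendsto (fun n => gagliardoDensity s (u n) (u n) p) atTop
      (𝓝 (gagliardoDensity s u₀ u₀ p)) := by
  filter_upwards [ae_prod_of_ae h] with p hp
  exact (((hp.1.sub hp.2).mul (hp.1.sub hp.2)).div_const _)

/-- Pointwise limits of bounded sequences stay in the energy space. -/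
theorem exists_of_ae_tendsto {z : ℕ → EnergySpace s ha hb} {R : ℝ} (hR : ∀ n, ‖z n‖ ^ 2 ≤ R)
    {u₀ v₀ : L2 N} (hu : ∀ᵐ x, Tendsto (fun n => (z n).u x) atTop (𝓝 (u₀ x)))
    (hv : ∀ᵐ x, Tendsto (fun n => (z n).v x) atTop (𝓝 (v₀ x))) :
    ∃ w : EnergySpace s ha hb, w.u = u₀ ∧ w.v = v₀ ∧ ‖w‖ ^ 2 ≤ 3 * R := by
  obtain ⟨i1, b1⟩ := integrable_of_ae_tendsto (fun n => integrable_u (z n) (z n))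
    (fun n x => gagliardoDensity_self_nonneg _ _ _) (tendsto_gagliardoDensity hu)
    (fun n => (gagliardoForm_u_le (z n)).trans (hR n))
  obtain ⟨i2, b2⟩ := integrable_of_ae_tendsto (fun n => integrable_v (z n) (z n))
    (fun n x => gagliardoDensity_self_nonneg _ _ _) (tendsto_gagliardoDensity hv)
    (fun n => (gagliardoForm_v_le (z n)).trans (hR n))
  obtain ⟨i3, b3⟩ := integrable_of_ae_tendsto
    (g := potentialDensity a b (u₀ : Rn N → ℝ) v₀ u₀ v₀)
    (fun n => integrable_potential (z n) (z n))
    (fun n x => potentialDensity_nonneg ha hb _ _ _) (by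
      filter_upwards [hu, hv] with x h1 h2
      exact ((h1.mul h1).const_mul _).add ((h2.mul h2).const_mul _))
    (R := R) (fun n => by
      refine le_trans ?_ (hR n)
      have h1 := gagliardoForm_self_nonneg (s := s) ((z n).u : Rn N → ℝ)
      have h2 := gagliardoForm_self_nonneg (s := s) ((z n).v : Rn N → ℝ)
      have h3 : ‖z n‖ ^ 2 = gagliardoForm s (z n).u (z n).u + gagliardoForm s (z n).v (z n).v +
        potentialForm a b (z n).u (z n).v (z n).u (z n).v := by
        rw [← real_inner_self_eq_norm_sq]; rfl
      have h4 : ∫ x, potentialDensity a b ((z n).u : Rn N → ℝ) (z n).v (z n).u (z n).v x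
        = potentialForm a b (z n).u (z n).v (z n).u (z n).v := rfl
      linarith)
  obtain ⟨w, hwu, hwv⟩ : ∃ w : EnergySpace s ha hb, w.u = u₀ ∧ w.v = v₀ :=
    ⟨⟨(u₀, v₀), i1, i2, i3⟩, rfl, rfl⟩
  refine ⟨w, hwu, hwv, ?_⟩
  rw [← real_inner_self_eq_norm_sq]
  change gagliardoForm s w.u w.u + gagliardoForm s w.v w.v + potentialForm a b w.u w.v w.u w.v ≤ _
  rw [hwu, hwv]
  have b1' : gagliardoForm s u₀ u₀ ≤ R := b1
  have b2' : gagliardoForm s v₀ v₀ ≤ R := b2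
  have b3' : potentialForm a b u₀ v₀ u₀ v₀ ≤ R := b3
  linarith

theorem ext_uv {w z : EnergySpace s ha hb} (h1 : w.u = z.u) (h2 : w.v = z.v) : w = z :=
  Subtype.ext (Prod.ext h1 h2)

theorem exists_ae_subseq {u : ℕ → L2 N} {u₀ : L2 N} (h : Tendsto u atTop (𝓝 u₀)) :
    ∃ k : ℕ → ℕ, StrictMono k ∧ ∀ᵐ x, Tendsto (fun n => u (k n) x) atTop (𝓝 (u₀ x)) :=
  (tendstoInMeasure_of_tendsto_Lp h).exists_seq_tendsto_ae

instance : CompleteSpace (EnergySpace s ha hb) := by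
  refine Metric.complete_of_cauchySeq_tendsto fun w hw => ?_
  obtain ⟨u₀, hu₀⟩ := cauchySeq_tendsto_of_complete ((uL s ha hb).uniformContinuous.comp_cauchySeq hw)
  obtain ⟨v₀, hv₀⟩ := cauchySeq_tendsto_of_complete ((vL s ha hb).uniformContinuous.comp_cauchySeq hw)
  obtain ⟨k₁, hk₁, hu⟩ := exists_ae_subseq hu₀
  obtain ⟨k₂, hk₂, hv⟩ := exists_ae_subseq (hv₀.comp hk₁.tendsto_atTop)
  set k := k₁ ∘ k₂
  have hk : StrictMono k := hk₁.comp hk₂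
  have hu' : ∀ᵐ x, Tendsto (fun n => (w (k n)).u x) atTop (𝓝 (u₀ x)) := by
    filter_upwards [hu] with x hx using hx.comp hk₂.tendsto_atTop
  have hv' : ∀ᵐ x, Tendsto (fun n => (w (k n)).v x) atTop (𝓝 (v₀ x)) := hv
  -- the tails `w (k n) - w m` converge a.e. to the difference of the limit and `w m`
  have key : ∀ ε > 0, ∃ M, ∀ m ≥ M, ∃ z : EnergySpace s ha hb,
      z.u = u₀ - (w m).u ∧ z.v = v₀ - (w m).v ∧ ‖z‖ ^ 2 ≤ 3 * ε ^ 2 := by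
    intro ε hε
    obtain ⟨M, hM⟩ := Metric.cauchySeq_iff.1 hw ε hε
    refine ⟨M, fun m hm => ?_⟩
    refine exists_of_ae_tendsto (z := fun n => w (k (n + M)) - w m) (fun n => ?_) ?_ ?_
    · have h1 : M ≤ k (n + M) := (Nat.le_add_left M n).trans (hk.id_le _)
      have h2 := hM _ h1 _ hm
      rw [dist_eq_norm] at h2
      gcongr
    · filter_upwards [hu', Lp.coeFn_sub u₀ (w m).u,
        ae_all_iff.2 fun n => Lp.coeFn_sub (w (k (n + M))).u (w m).u] with x h1 h2 h3
      rw [h2]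
      refine Tendsto.congr (fun n => (h3 n).symm) ?_
      exact ((tendsto_add_atTop_iff_nat M).2 h1).sub_const _
    · filter_upwards [hv', Lp.coeFn_sub v₀ (w m).v,
        ae_all_iff.2 fun n => Lp.coeFn_sub (w (k (n + M))).v (w m).v] with x h1 h2 h3
      rw [h2]
      refine Tendsto.congr (fun n => (h3 n).symm) ?_
      exact ((tendsto_add_atTop_iff_nat M).2 h1).sub_const _
  obtain ⟨M₁, hM₁⟩ := key 1 one_pos
  obtain ⟨z₁, hz₁u, hz₁v, -⟩ := hM₁ M₁ le_rfl
  refine ⟨z₁ + w M₁, Metric.tendsto_atTop.2 fun ε hε => ?_⟩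
  obtain ⟨M, hM⟩ := key (ε / 2) (half_pos hε)
  refine ⟨M, fun m hm => ?_⟩
  obtain ⟨z, hzu, hzv, hz⟩ := hM m hm
  have e : z₁ + w M₁ - w m = z := by
    refine ext_uv ?_ ?_
    · change z₁.u + (w M₁).u - (w m).u = z.u
      rw [hz₁u, hzu, sub_add_cancel]
    · change z₁.v + (w M₁).v - (w m).v = z.v
      rw [hz₁v, hzv, sub_add_cancel]
  rw [dist_comm, dist_eq_norm, e]
  nlinarith [norm_nonneg z]

end EnergySpace

/-! ### The embedding into `L^q` and the functionals -/

theorem posHomogeneous_integral_comp {α : Type*} {mα : MeasurableSpace α} {μ : Measure α}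
    {E : Type*} [NormedAddCommGroup E] [NormedSpace ℝ E] {q : ℝ} {F : E → ℝ}
    [Fact (1 ≤ ENNReal.ofReal q)] (hom : PosHomogeneous q F) :
    PosHomogeneous q (fun f : Lp E (ENNReal.ofReal q) μ => ∫ x, F (f x) ∂μ) := by
  intro t ht f
  simp only [smul_eq_mul]
  rw [← integral_const_mul]
  refine integral_congr_ae ?_
  filter_upwards [Lp.coeFn_smul t f] with x hx
  rw [hx, Pi.smul_apply, hom t ht, smul_eq_mul]

theorem norm_prod_rpow_le (q : ℝ) (p : ℝ × ℝ) :
    ‖p‖ ^ q ≤ |p.1| ^ q + |p.2| ^ q := by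
  have h1 : 0 ≤ |p.1| ^ q := by positivity
  have h2 : 0 ≤ |p.2| ^ q := by positivity
  rw [Prod.norm_def, Real.norm_eq_abs, Real.norm_eq_abs]
  rcases max_cases |p.1| |p.2| with h | h <;> rw [h.1] <;> linarith

namespace EnergySpace

variable {N : ℕ} {s p q : ℝ} {a b : Rn N → ℝ} {ha : IsPotential a} {hb : IsPotential b}

variable (ha hb) in
theorem exists_integral_rpow_le (hS : SobolevBound N s p) (R : ℝ) :
    ∃ C, 0 < C ∧ ∀ w : EnergySpace s ha hb, ‖w‖ ^ 2 ≤ R →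
      (Integrable (fun x => |w.u x| ^ p) ∧ ∫ x, |w.u x| ^ p ≤ C) ∧
      (Integrable (fun x => |w.v x| ^ p) ∧ ∫ x, |w.v x| ^ p ≤ C) := by
  have hia := ha.iInf_pos
  have hib := hb.iInf_pos
  have e1 : 0 ≤ |R| / ⨅ x, a x := by positivity
  have e2 : 0 ≤ |R| / ⨅ x, b x := by positivity
  have e3 := abs_nonneg R
  obtain ⟨C, hC, h⟩ := hS (|R| + 1 + |R| / (⨅ x, a x) + |R| / ⨅ x, b x) (by positivity)
  refine ⟨C, hC, fun w hw => ⟨?_, ?_⟩⟩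
  · have hw' : ‖w‖ ^ 2 ≤ |R| := hw.trans (le_abs_self R)
    refine h _ (measurable_coe _) (integrable_u w w) (integrable_sq_L2 _) ?_ ?_
    · have := gagliardoForm_u_le w
      linarith
    · have h1 := integral_sq_u_le w
      have : ‖w‖ ^ 2 / (⨅ x, a x) ≤ |R| / ⨅ x, a x := by gcongr
      linarith
  · have hw' : ‖w‖ ^ 2 ≤ |R| := hw.trans (le_abs_self R)
    refine h _ (measurable_coe _) (integrable_v w w) (integrable_sq_L2 _) ?_ ?_
    · have := gagliardoForm_v_le w
      linarith
    · have h1 := integral_sq_v_le w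
      have : ‖w‖ ^ 2 / (⨅ x, b x) ≤ |R| / ⨅ x, b x := by gcongr
      linarith

theorem integrable_rpow_u (hS : SobolevBound N s p) (w : EnergySpace s ha hb) :
    Integrable fun x => |w.u x| ^ p := by
  obtain ⟨C, -, h⟩ := exists_integral_rpow_le ha hb hS (‖w‖ ^ 2)
  exact (h w le_rfl).1.1

theorem integrable_rpow_v (hS : SobolevBound N s p) (w : EnergySpace s ha hb) :
    Integrable fun x => |w.v x| ^ p := by
  obtain ⟨C, -, h⟩ := exists_integral_rpow_le ha hb hS (‖w‖ ^ 2)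
  exact (h w le_rfl).2.1

theorem memLp_pair (hq : 0 < q) (hS : SobolevBound N s q) (w : EnergySpace s ha hb) :
    MemLp (fun x => (w.u x, w.v x)) (ENNReal.ofReal q) := by
  have hq' : ENNReal.ofReal q ≠ 0 := by simpa using hq
  refine memLp_prod_iff.2 ⟨?_, ?_⟩
  · rw [← integrable_norm_rpow_iff (measurable_coe w.u).aestronglyMeasurable hq'
      ENNReal.ofReal_ne_top, ENNReal.toReal_ofReal hq.le]
    exact integrable_rpow_u hS w
  · rw [← integrable_norm_rpow_iff (measurable_coe w.v).aestronglyMeasurable hq'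
      ENNReal.ofReal_ne_top, ENNReal.toReal_ofReal hq.le]
    exact integrable_rpow_v hS w

section Embedding

variable [Fact (1 ≤ ENNReal.ofReal q)]

variable (ha hb) in
/-- The continuous embedding `(u, v) ↦ (u, v)` of the energy space into `L^q(ℝ^N; ℝ²)`, for an
exponent for which the Sobolev bound holds. -/
def toLq (hq : 0 < q) (hS : SobolevBound N s q) :
    EnergySpace s ha hb →L[ℝ] Lp (ℝ × ℝ) (ENNReal.ofReal q) (volume : Measure (Rn N)) :=
  LinearMap.mkContinuousOfExistsBound
    { toFun := fun w => (memLp_pair hq hS w).toLp _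
      map_add' := fun w z => by
        rw [← MemLp.toLp_add]
        refine MemLp.toLp_congr _ _ ?_
        filter_upwards [Lp.coeFn_add w.u z.u, Lp.coeFn_add w.v z.v] with x h1 h2
        exact Prod.ext h1 h2
      map_smul' := fun c w => by
        rw [RingHom.id_apply, ← MemLp.toLp_const_smul]
        refine MemLp.toLp_congr _ _ ?_
        filter_upwards [Lp.coeFn_smul c w.u, Lp.coeFn_smul c w.v] with x h1 h2
        exact Prod.ext h1 h2 } (by
    obtain ⟨C, hC, h⟩ := exists_integral_rpow_le ha hb hS 1
    refine LinearMap.bound_of_ball_bound one_pos ((2 * C) ^ q⁻¹) _ fun w hw => ?_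
    rw [mem_ball_zero_iff] at hw
    have hw2 : ‖w‖ ^ 2 ≤ 1 := pow_le_one₀ (norm_nonneg w) hw.le
    obtain ⟨⟨i1, h1⟩, i2, h2⟩ := h w hw2
    set f : Lp (ℝ × ℝ) (ENNReal.ofReal q) (volume : Measure (Rn N)) := (memLp_pair hq hS w).toLp _
    change ‖f‖ ≤ _
    have hf : ‖f‖ ^ q ≤ 2 * C := by
      rw [← integral_norm_rpow_Lp hq f]
      calc ∫ x, ‖f x‖ ^ q ≤ ∫ x, (|w.u x| ^ q + |w.v x| ^ q) := by
            refine integral_mono_ae (integrable_norm_rpow_Lp hq f) (i1.add i2) ?_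
            filter_upwards [(memLp_pair hq hS w).coeFn_toLp] with x hx
            rw [hx]
            exact norm_prod_rpow_le q _
        _ = (∫ x, |w.u x| ^ q) + ∫ x, |w.v x| ^ q := integral_add i1 i2
        _ ≤ 2 * C := by linarith
    exact (Real.le_rpow_inv_iff_of_pos (norm_nonneg f) (by positivity) hq).2 hf)

theorem coeFn_toLq (hq : 0 < q) (hS : SobolevBound N s q) (w : EnergySpace s ha hb) :
    toLq ha hb hq hS w =ᵐ[volume] fun x => (w.u x, w.v x) :=
  (memLp_pair hq hS w).coeFn_toLp

end Embedding

/-- The nonlinear part `∫ F(u, v)` of the functionals. -/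
def nonlinearPart (F : ℝ × ℝ → ℝ) (w : EnergySpace s ha hb) : ℝ := ∫ x, F (w.u x, w.v x)

variable {F : ℝ × ℝ → ℝ}

theorem nonlinearPart_eq [Fact (1 ≤ ENNReal.ofReal q)] (F : ℝ × ℝ → ℝ) (hq : 0 < q)
    (hS : SobolevBound N s q) (w : EnergySpace s ha hb) :
    nonlinearPart F w = ∫ x, F (toLq ha hb hq hS w x) := by
  refine integral_congr_ae ?_
  filter_upwards [coeFn_toLq hq hS w] with x hx
  rw [hx]

theorem fact_one_le_ofReal (hq : 1 < q) : Fact (1 ≤ ENNReal.ofReal q) :=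
  ⟨by simpa using ENNReal.ofReal_le_ofReal hq.le⟩

theorem contDiff_nonlinearPart (hq : 1 < q) (hS : SobolevBound N s q) (hF : ContDiff ℝ 1 F)
    (hom : PosHomogeneous q F) :
    ContDiff ℝ 1 (nonlinearPart F : EnergySpace s ha hb → ℝ) := by
  have := fact_one_le_ofReal hq
  have hq0 : 0 < q := by linarith
  rw [funext (nonlinearPart_eq F hq0 hS)]
  exact (contDiff_integral_comp hq hF hom).comp (toLq ha hb hq0 hS).contDiff

theorem posHomogeneous_nonlinearPart (hq : 1 < q) (hS : SobolevBound N s q)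
    (hom : PosHomogeneous q F) :
    PosHomogeneous q (nonlinearPart F : EnergySpace s ha hb → ℝ) := by
  have := fact_one_le_ofReal hq
  have hq0 : 0 < q := by linarith
  intro t ht w
  rw [nonlinearPart_eq F hq0 hS, nonlinearPart_eq F hq0 hS, map_smul]
  exact posHomogeneous_integral_comp hom t ht _

theorem fderiv_nonlinearPart (hq : 1 < q) (hS : SobolevBound N s q) (hF : ContDiff ℝ 1 F)
    (hom : PosHomogeneous q F) (w φ : EnergySpace s ha hb) :
    Integrable (fun x => fderiv ℝ F (w.u x, w.v x) (φ.u x, φ.v x)) ∧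
    fderiv ℝ (nonlinearPart F) w φ = ∫ x, fderiv ℝ F (w.u x, w.v x) (φ.u x, φ.v x) := by
  have := fact_one_le_ofReal hq
  have hq0 : 0 < q := by linarith
  have e : (fun x => fderiv ℝ F (toLq ha hb hq0 hS w x) (toLq ha hb hq0 hS φ x)) =ᵐ[volume]
      fun x => fderiv ℝ F (w.u x, w.v x) (φ.u x, φ.v x) := by
    filter_upwards [coeFn_toLq hq0 hS w, coeFn_toLq hq0 hS φ] with x h1 h2
    rw [h1, h2]
  refine ⟨(integrable_congr e).1 (integrable_fderiv_comp_Lp hq hF hom _ _), ?_⟩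
  have h : HasFDerivAt (nonlinearPart F : EnergySpace s ha hb → ℝ)
      ((integralDeriv hq hF hom (toLq ha hb hq0 hS w)).comp (toLq ha hb hq0 hS)) w := by
    rw [funext (nonlinearPart_eq F hq0 hS)]
    exact (hasFDerivAt_integral_comp hq hF hom _).comp w (toLq ha hb hq0 hS).hasFDerivAt
  rw [h.fderiv, ContinuousLinearMap.comp_apply, integralDeriv_apply]
  exact integral_congr_ae e

end EnergySpace

/-! ### Vanishing sequences -/

section Vanishing

theorem tendsto_zero_of_forall_eventually_le {X : ℕ → ℝ}
    (h : ∀ δ > 0, ∀ᶠ n in atTop, |X n| ≤ δ) : Tendsto X atTop (𝓝 0) := by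
  rw [Metric.tendsto_nhds]
  intro ε hε
  filter_upwards [h (ε / 2) (half_pos hε)] with n hn
  rw [Real.dist_eq, sub_zero]
  linarith

theorem eventually_le_of_tendsto_zero {X : ℕ → ℝ} (h : Tendsto X atTop (𝓝 0)) {δ : ℝ}
    (hδ : 0 < δ) : ∀ᶠ n in atTop, X n ≤ δ :=
  (h.eventually (gt_mem_nhds hδ)).mono fun _ h => h.le

/-- A quantity that is, for every `δ`, at most `δ` plus a constant multiple of a fixed null
sequence is a null sequence. -/
theorem tendsto_zero_of_le_add {X Y : ℕ → ℝ} {A : ℝ} (hA : 0 ≤ A) (hY : Tendsto Y atTop (𝓝 0))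
    (h : ∀ δ > 0, ∃ C, ∀ n, |X n| ≤ δ * A + C * Y n) : Tendsto X atTop (𝓝 0) := by
  refine tendsto_zero_of_forall_eventually_le fun δ hδ => ?_
  obtain ⟨C, hC⟩ := h (δ / (2 * (A + 1))) (by positivity)
  have h1 : δ / (2 * (A + 1)) * A ≤ δ / 2 := by
    rw [div_mul_eq_mul_div, div_le_div_iff₀ (by positivity) two_pos]
    nlinarith
  have h2 := hY.const_mul C
  rw [mul_zero] at h2
  filter_upwards [eventually_le_of_tendsto_zero h2 (half_pos hδ)] with n hn
  linarith [hC n]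

/-- Interpolation: `L²` convergence to zero together with an `L^p` bound gives `L^q` convergence to
zero for `2 ≤ q < p`. -/
theorem tendsto_integral_rpow_of_sq {α : Type*} {mα : MeasurableSpace α} {μ : Measure α}
    {f : ℕ → α → ℝ} {p q C : ℝ} (hq : 2 < q) (hqp : q < p)
    (h2 : ∀ n, Integrable (fun x => f n x ^ 2) μ) (hp : ∀ n, Integrable (fun x => |f n x| ^ p) μ)
    (hqi : ∀ n, Integrable (fun x => |f n x| ^ q) μ) (hC : ∀ n, ∫ x, |f n x| ^ p ∂μ ≤ C)
    (h0 : Tendsto (fun n => ∫ x, f n x ^ 2 ∂μ) atTop (𝓝 0)) :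
    Tendsto (fun n => ∫ x, |f n x| ^ q ∂μ) atTop (𝓝 0) := by
  have hC0 : 0 ≤ C := (integral_nonneg fun x => by positivity).trans (hC 0)
  refine tendsto_zero_of_le_add hC0 h0 fun δ hδ => ?_
  set T : ℝ := δ⁻¹ ^ (1 / (p - q)) with hT
  have hpq : 0 < p - q := by linarith
  have hT0 : 0 < T := by positivity
  have hTp : δ * T ^ (p - q) = 1 := by
    rw [hT, ← Real.rpow_mul (by positivity), one_div_mul_cancel hpq.ne', Real.rpow_one,
      mul_inv_cancel₀ hδ.ne']
  have hpt : ∀ t : ℝ, |t| ^ q ≤ δ * |t| ^ p + T ^ (q - 2) * t ^ 2 := by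
    intro t
    rcases (abs_nonneg t).eq_or_lt with h | h
    · rw [← h, Real.zero_rpow (by linarith)]
      positivity
    · rcases le_total |t| T with h1 | h1
      · have e : |t| ^ q = |t| ^ (q - 2) * t ^ 2 := by
          rw [← sq_abs t, ← Real.rpow_two |t|, ← Real.rpow_add h, sub_add_cancel]
        have h2 : |t| ^ (q - 2) ≤ T ^ (q - 2) := Real.rpow_le_rpow h.le h1 (by linarith)
        have h3 := mul_le_mul_of_nonneg_right h2 (sq_nonneg t)
        have : 0 ≤ δ * |t| ^ p := by positivity
        linarith
      · have e : |t| ^ p = |t| ^ (p - q) * |t| ^ q := by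
          rw [← Real.rpow_add h, sub_add_cancel]
        have h2 : T ^ (p - q) ≤ |t| ^ (p - q) := Real.rpow_le_rpow hT0.le h1 hpq.le
        have h3 : 1 ≤ δ * |t| ^ (p - q) := by
          rw [← hTp]
          gcongr
        have h4 : 0 ≤ |t| ^ q := by positivity
        have : 0 ≤ T ^ (q - 2) * t ^ 2 := by positivity
        rw [e]
        nlinarith
  refine ⟨T ^ (q - 2), fun n => ?_⟩
  rw [abs_of_nonneg (integral_nonneg fun x => by positivity)]
  calc ∫ x, |f n x| ^ q ∂μ ≤ ∫ x, (δ * |f n x| ^ p + T ^ (q - 2) * f n x ^ 2) ∂μ :=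
        integral_mono (hqi n) (((hp n).const_mul _).add ((h2 n).const_mul _)) fun x => hpt _
    _ = δ * (∫ x, |f n x| ^ p ∂μ) + T ^ (q - 2) * ∫ x, f n x ^ 2 ∂μ := by
        rw [integral_add ((hp n).const_mul _) ((h2 n).const_mul _), integral_const_mul,
          integral_const_mul]
    _ ≤ _ := by
        gcongr
        exact hC n

variable {N : ℕ}

/-- Local convergence to zero with uniformly small tails is global convergence to zero. -/
theorem tendsto_integral_of_ball_of_tail {f : ℕ → Rn N → ℝ} (hf : ∀ n, Integrable (f n))
    (h0 : ∀ n x, 0 ≤ f n x)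
    (hloc : ∀ r, Tendsto (fun n => ∫ x in Metric.ball 0 r, f n x) atTop (𝓝 0))
    (htail : ∀ δ > 0, ∃ r, ∀ n, ∫ x in (Metric.ball 0 r)ᶜ, f n x ≤ δ) :
    Tendsto (fun n => ∫ x, f n x) atTop (𝓝 0) := by
  refine tendsto_zero_of_forall_eventually_le fun δ hδ => ?_
  obtain ⟨r, hr⟩ := htail (δ / 2) (half_pos hδ)
  filter_upwards [eventually_le_of_tendsto_zero (hloc r) (half_pos hδ)] with n hn
  rw [abs_of_nonneg (integral_nonneg (h0 n)),
    ← integral_add_compl (measurableSet_ball (x := (0 : Rn N)) (ε := r)) (hf n)]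
  linarith [hr n]

theorem exists_integral_compl_ball_le {f : Rn N → ℝ} (hf : Integrable f) {δ : ℝ} (hδ : 0 < δ) :
    ∃ r, ∫ x in (Metric.ball 0 r)ᶜ, f x ≤ δ := by
  have h := (aecover_ball (μ := (volume : Measure (Rn N))) (x := (0 : Rn N))
    (tendsto_id (α := ℝ) (x := atTop))).integral_tendsto_of_countably_generated hf
  obtain ⟨r, hr⟩ := (h.eventually (lt_mem_nhds (sub_lt_self _ hδ))).exists
  refine ⟨r, ?_⟩
  have := integral_add_compl (measurableSet_ball (x := (0 : Rn N)) (ε := r)) hf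
  simp only [id] at hr
  linarith

/-- A sequence in `L²` that converges to zero in `L²` on every ball. -/
def VanishesLocally (u : ℕ → L2 N) : Prop :=
  ∀ r : ℝ, Tendsto (fun n => ∫ x in Metric.ball 0 r, u n x ^ 2) atTop (𝓝 0)

theorem VanishesLocally.tendsto_integral_mul_sq {u : ℕ → L2 N} (hu : VanishesLocally u) {K M : ℝ}
    (hK : ∀ n, ∫ x, u n x ^ 2 ≤ K) {m : Rn N → ℝ} (hm : Measurable m) (hm0 : ∀ x, 0 ≤ m x)
    (hmM : ∀ x, m x ≤ M) (htail : ∀ δ > 0, ∃ r, ∀ x, r ≤ ‖x‖ → m x ≤ δ) :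
    Tendsto (fun n => ∫ x, m x * u n x ^ 2) atTop (𝓝 0) := by
  have hK0 : 0 ≤ K := (integral_nonneg fun x => sq_nonneg _).trans (hK 0)
  have hi : ∀ n, Integrable fun x => m x * u n x ^ 2 := fun n =>
    (integrable_sq_L2 (u n)).bdd_mul (c := M) hm.aestronglyMeasurable
      (Eventually.of_forall fun x => by rw [Real.norm_of_nonneg (hm0 x)]; exact hmM x)
  refine tendsto_integral_of_ball_of_tail hi (fun n x => mul_nonneg (hm0 x) (sq_nonneg _))
    (fun r => ?_) fun δ hδ => ?_
  · have h := (hu r).const_mul M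
    rw [mul_zero] at h
    refine squeeze_zero (fun n => integral_nonneg fun x => mul_nonneg (hm0 x) (sq_nonneg _))
      (fun n => ?_) h
    rw [← integral_const_mul]
    exact integral_mono (hi n).integrableOn ((integrable_sq_L2 (u n)).integrableOn.const_mul M)
      fun x => mul_le_mul_of_nonneg_right (hmM x) (sq_nonneg _)
  · obtain ⟨r, hr⟩ := htail (δ / (K + 1)) (by positivity)
    refine ⟨r, fun n => ?_⟩
    calc ∫ x in (Metric.ball 0 r)ᶜ, m x * u n x ^ 2
        ≤ ∫ x in (Metric.ball 0 r)ᶜ, δ / (K + 1) * u n x ^ 2 := by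
          refine setIntegral_mono_on (hi n).integrableOn
            ((integrable_sq_L2 (u n)).integrableOn.const_mul _) measurableSet_ball.compl
            fun x hx => mul_le_mul_of_nonneg_right (hr x ?_) (sq_nonneg _)
          simpa using hx
      _ ≤ ∫ x, δ / (K + 1) * u n x ^ 2 :=
          setIntegral_le_integral ((integrable_sq_L2 (u n)).const_mul _)
            (Eventually.of_forall fun x => by positivity)
      _ ≤ δ / (K + 1) * (K + 1) := by
          rw [integral_const_mul]
          gcongr
          linarith [hK n]
      _ = δ := by field_simp

/-- Rellich's theorem: a weak null sequence in `L²` with bounded Gagliardo seminorms converges to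
zero in `L²` on balls. The functions are close in `L²` to their means over small balls, and these
means tend to zero by dominated convergence. -/
theorem vanishesLocally_of_weak {s : ℝ} (hs : 0 < s) {u : ℕ → L2 N} {K : ℝ}
    (hd : ∀ n, Integrable (gagliardoDensity s (u n : Rn N → ℝ) (u n)))
    (hG : ∀ n, gagliardoForm s (u n) (u n) ≤ K) (h2 : ∀ n, ∫ x, u n x ^ 2 ≤ K)
    (hw : ∀ f : L2 N, Tendsto (fun n => inner ℝ f (u n)) atTop (𝓝 0)) : VanishesLocally u := by
  intro r
  have hK0 : 0 ≤ K := (integral_nonneg fun x => sq_nonneg _).trans (h2 0)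
  have hω := unitBallVolume_pos N
  have hI : ∀ n (x : Rn N) (h : ℝ), ∫ y in Metric.ball x h, u n y =
      inner ℝ (indicatorConstLp 2 measurableSet_ball
        (measure_ball_lt_top (μ := volume) (x := x) (r := h)).ne (1 : ℝ)) (u n) :=
    fun n x h => (L2.inner_indicatorConstLp_one _ _ _).symm
  have hmeas : ∀ n (h : ℝ), StronglyMeasurable fun x : Rn N => ∫ y in Metric.ball x h, u n y := by
    intro n h
    have e : (fun x : Rn N => ∫ y in Metric.ball x h, u n y) =
        fun x => ∫ y, Set.indicator {p : Rn N × Rn N | dist p.2 p.1 < h}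
          (fun p => u n p.2) (x, y) := by
      funext x
      rw [← integral_indicator measurableSet_ball]
      rfl
    rw [e]
    refine StronglyMeasurable.integral_prod_right (f := fun x y =>
      Set.indicator {p : Rn N × Rn N | dist p.2 p.1 < h} (fun p => u n p.2) (x, y)) ?_
    refine StronglyMeasurable.indicator
      ((Lp.stronglyMeasurable (u n)).comp_measurable measurable_snd) ?_
    exact measurableSet_lt (measurable_snd.dist measurable_fst) measurable_const
  have hbd : ∀ h : ℝ, 0 < h → ∀ n (x : Rn N), ‖(∫ y in Metric.ball x h, u n y) ^ 2‖ ≤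
      ((h ^ (N : ℝ) * unitBallVolume N) ^ (1 / (2 : ℝ)) * √K) ^ 2 := by
    intro h hh n x
    rw [norm_pow, hI]
    refine pow_le_pow_left₀ (norm_nonneg _) ?_ 2
    refine (norm_inner_le_norm _ _).trans ?_
    rw [norm_indicatorConstLp two_ne_zero ENNReal.ofNat_ne_top, norm_one, one_mul,
      volume_real_ball x hh, ENNReal.toReal_ofNat]
    refine mul_le_mul_of_nonneg_left ?_ (by positivity)
    rw [Real.le_sqrt (norm_nonneg _) hK0, ← integral_sq_L2]
    exact h2 n
  have hloc : ∀ h : ℝ, 0 < h → Tendsto (fun n => ∫ x in Metric.ball (0 : Rn N) r,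
      (∫ y in Metric.ball x h, u n y) ^ 2) atTop (𝓝 0) := by
    intro h hh
    have key := tendsto_integral_of_dominated_convergence
      (μ := volume.restrict (Metric.ball (0 : Rn N) r))
      (F := fun n x => (∫ y in Metric.ball x h, u n y) ^ 2) (f := fun _ => 0)
      (fun _ => ((h ^ (N : ℝ) * unitBallVolume N) ^ (1 / (2 : ℝ)) * √K) ^ 2)
      (fun n => ((hmeas n h).pow 2).aestronglyMeasurable)
      (integrableOn_const measure_ball_lt_top.ne) (fun n => Eventually.of_forall fun x => ?_)
      (Eventually.of_forall fun x => ?_)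
    · simpa using key
    · exact hbd h hh n x
    · have h1 : Tendsto (fun n => ∫ y in Metric.ball x h, u n y) atTop (𝓝 0) :=
        (hw _).congr fun n => (hI n x h).symm
      simpa using h1.pow 2
  refine tendsto_zero_of_forall_eventually_le fun δ hδ => ?_
  obtain ⟨h, hh, hhδ⟩ : ∃ h : ℝ, 0 < h ∧ 2 * h ^ (2 * s) / unitBallVolume N * K ≤ δ / 2 := by
    have ht : Tendsto (fun h : ℝ => 2 * h ^ (2 * s) / unitBallVolume N * K) (𝓝[>] 0) (𝓝 0) := by
      have hc : Continuous fun h : ℝ => 2 * h ^ (2 * s) / unitBallVolume N * K :=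
        (((Real.continuous_rpow_const (by positivity)).const_mul 2).div_const _).mul_const K
      have := (hc.tendsto 0).mono_left (nhdsWithin_le_nhds (s := Set.Ioi 0))
      rwa [Real.zero_rpow (by positivity), mul_zero, zero_div, zero_mul] at this
    obtain ⟨h, h1, h2⟩ := ((ht.eventually (gt_mem_nhds (half_pos hδ))).and
      self_mem_nhdsWithin).exists
    exact ⟨h, h2, h1.le⟩
  set b := h ^ (N : ℝ) * unitBallVolume N with hbdef
  have hb : 0 < b := by positivity
  have hsmall := (hloc h hh).const_mul (4 / b ^ 2)
  rw [mul_zero] at hsmall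
  filter_upwards [eventually_le_of_tendsto_zero hsmall (half_pos hδ)] with n hn
  rw [abs_of_nonneg (integral_nonneg fun x => sq_nonneg _)]
  have hIi : IntegrableOn (fun x => (∫ y in Metric.ball x h, u n y) ^ 2)
      (Metric.ball (0 : Rn N) r) := by
    exact Integrable.mono' (g := fun _ => (b ^ (1 / (2 : ℝ)) * √K) ^ 2)
      (integrableOn_const measure_ball_lt_top.ne) ((hmeas n h).pow 2).aestronglyMeasurable
      (Eventually.of_forall fun x => hbd h hh n x)
  have hGi := (integrable_gagliardoSlice (hd n)).const_mul (2 * h ^ (2 * s) / unitBallVolume N)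
  have hpt : ∀ᵐ x, u n x ^ 2 ≤
      2 * h ^ (2 * s) / unitBallVolume N * gagliardoSlice s (u n) x +
        4 / b ^ 2 * (∫ y in Metric.ball x h, u n y) ^ 2 := by
    filter_upwards [ae_integrable_slice (hd n)] with x hx
    have hi : IntegrableOn (u n) (Metric.ball x h) :=
      ((Lp.memLp (u n)).locallyIntegrable one_le_two).integrableOn_isCompact
        (isCompact_closedBall x h) |>.mono_set Metric.ball_subset_closedBall
    have h1 := sq_mul_volume_ball_le hs (measurable_coe (u n)) hh hx hi
    rw [← hbdef, Real.rpow_add hh] at h1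
    have h3 : u n x ^ 2 ≤ (4 / b) * (h ^ (N : ℝ) * h ^ (2 * s) * gagliardoSlice s (u n) x / 2 +
        (∫ y in Metric.ball x h, u n y) ^ 2 / b) := by
      rw [div_mul_eq_mul_div, le_div_iff₀ hb]
      linarith
    refine h3.trans (le_of_eq ?_)
    rw [hbdef]
    have : 0 < h ^ (N : ℝ) := by positivity
    field_simp
    ring
  calc ∫ x in Metric.ball 0 r, u n x ^ 2
      ≤ ∫ x in Metric.ball 0 r, (2 * h ^ (2 * s) / unitBallVolume N * gagliardoSlice s (u n) x +
        4 / b ^ 2 * (∫ y in Metric.ball x h, u n y) ^ 2) :=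
        integral_mono_ae (integrable_sq_L2 (u n)).integrableOn
          (Integrable.add hGi.integrableOn (hIi.const_mul _)) (ae_restrict_of_ae hpt)
    _ = (∫ x in Metric.ball 0 r, 2 * h ^ (2 * s) / unitBallVolume N * gagliardoSlice s (u n) x) +
        4 / b ^ 2 * ∫ x in Metric.ball 0 r, (∫ y in Metric.ball x h, u n y) ^ 2 := by
        rw [integral_add hGi.integrableOn (hIi.const_mul _), integral_const_mul (4 / b ^ 2)]
    _ ≤ 2 * h ^ (2 * s) / unitBallVolume N * K + δ / 2 := by
        refine add_le_add ?_ hn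
        refine (setIntegral_le_integral hGi (Eventually.of_forall fun x =>
          mul_nonneg (by positivity) (gagliardoSlice_nonneg _ _ _))).trans ?_
        rw [integral_const_mul, integral_gagliardoSlice (hd n)]
        gcongr
        exact hG n
    _ ≤ δ := by linarith

end Vanishing

/-! ### Splitting of the nonlinear part along vanishing sequences -/

/-- A continuous homogeneous function of two variables that vanishes on both axes is small, relative
to the larger variable, unless both variables are comparable. -/
theorem PosHomogeneous.exists_le_min {E E' : Type*} [NormedAddCommGroup E] [NormedSpace ℝ E]
    [ProperSpace E] [NormedAddCommGroup E'] [NormedSpace ℝ E'] [ProperSpace E'] {g : E × E' → ℝ}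
    {q : ℝ} (hq : 0 < q) (hom : PosHomogeneous q g) (hg : Continuous g) (h1 : ∀ a, g (a, 0) = 0)
    (h2 : ∀ b, g (0, b) = 0) {δ : ℝ} (hδ : 0 < δ) :
    ∃ C, 0 < C ∧ ∀ a b,
      |g (a, b)| ≤ δ * (‖a‖ ^ q + ‖b‖ ^ q) + C * min (‖a‖ ^ q) (‖b‖ ^ q) := by
  obtain ⟨C, hC, h⟩ := hom.exists_increment_le hq hg hδ
  refine ⟨C, hC, fun a b => ?_⟩
  have e1 := h (a, 0) (0, b)
  have e2 := h (0, b) (a, 0)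
  rw [h1, Prod.mk_add_mk, add_zero, zero_add, sub_zero] at e1
  rw [h2, Prod.mk_add_mk, add_zero, zero_add, sub_zero] at e2
  simp only [Prod.norm_def, norm_zero, norm_nonneg, max_eq_left, max_eq_right,
    Real.norm_eq_abs] at e1 e2
  have ha : 0 ≤ δ * ‖a‖ ^ q := by positivity
  have hb : 0 ≤ δ * ‖b‖ ^ q := by positivity
  rcases min_cases (‖a‖ ^ q) (‖b‖ ^ q) with h | h <;> rw [h.1] <;> linarith

theorem tendsto_integral_ball_rpow {N : ℕ} {u : ℕ → L2 N} (hu : VanishesLocally u) {p q C : ℝ}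
    (hq : 2 < q) (hqp : q < p) (hp : ∀ n, Integrable fun x => |u n x| ^ p)
    (hqi : ∀ n, Integrable fun x => |u n x| ^ q) (hC : ∀ n, ∫ x, |u n x| ^ p ≤ C) (r : ℝ) :
    Tendsto (fun n => ∫ x in Metric.ball 0 r, |u n x| ^ q) atTop (𝓝 0) :=
  tendsto_integral_rpow_of_sq hq hqp (fun n => (integrable_sq_L2 (u n)).integrableOn)
    (fun n => (hp n).integrableOn) (fun n => (hqi n).integrableOn)
    (fun n => (setIntegral_le_integral (hp n) (Eventually.of_forall fun x => by positivity)).trans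
      (hC n)) (hu r)

namespace EnergySpace

variable {N : ℕ} {s p q R : ℝ} {a b : Rn N → ℝ} {ha : IsPotential a} {hb : IsPotential b}
  {F : ℝ × ℝ → ℝ}

/-- The Brezis–Lieb type splitting: a fixed `w` and a locally vanishing sequence do not interact in
the limit. -/
theorem tendsto_fderiv_nonlinearPart_sub (hq : 2 < q) (hqp : q < p) (hSq : SobolevBound N s q)
    (hSp : SobolevBound N s p) (hF : ContDiff ℝ 1 F) (hom : PosHomogeneous q F)
    {z : ℕ → EnergySpace s ha hb} (hR : ∀ n, ‖z n‖ ^ 2 ≤ R)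
    (hu : VanishesLocally fun n => (z n).u) (hv : VanishesLocally fun n => (z n).v)
    (w : EnergySpace s ha hb) :
    Tendsto (fun n => fderiv ℝ (nonlinearPart F) (w + z n) (z n) -
      fderiv ℝ (nonlinearPart F) (z n) (z n)) atTop (𝓝 0) := by
  have hq0 : 0 < q := by linarith
  have hq1 : 1 < q := by linarith
  obtain ⟨Cp, -, hCp⟩ := exists_integral_rpow_le ha hb hSp R
  obtain ⟨Cq, hCq0, hCq⟩ := exists_integral_rpow_le ha hb hSq R
  set f : Rn N → ℝ := fun x => |w.u x| ^ q + |w.v x| ^ q with hf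
  set g : ℕ → Rn N → ℝ := fun n x => |(z n).u x| ^ q + |(z n).v x| ^ q with hg
  have hf0 : ∀ x, 0 ≤ f x := fun x => by positivity
  have hg0 : ∀ n x, 0 ≤ g n x := fun n x => by positivity
  have hfi : Integrable f := (integrable_rpow_u hSq w).add (integrable_rpow_v hSq w)
  have hgi : ∀ n, Integrable (g n) := fun n =>
    (integrable_rpow_u hSq (z n)).add (integrable_rpow_v hSq (z n))
  have hgC : ∀ n, ∫ x, g n x ≤ 2 * Cq := fun n => by
    rw [hg, integral_add (integrable_rpow_u hSq (z n)) (integrable_rpow_v hSq (z n))]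
    linarith [(hCq _ (hR n)).1.2, (hCq _ (hR n)).2.2]
  have hmi : ∀ n, Integrable fun x => min (f x) (g n x) := fun n => hfi.inf (hgi n)
  have hmin : Tendsto (fun n => ∫ x, min (f x) (g n x)) atTop (𝓝 0) := by
    refine tendsto_integral_of_ball_of_tail hmi (fun n x => le_min (hf0 x) (hg0 n x))
      (fun r => ?_) fun δ hδ => ?_
    · have l1 := tendsto_integral_ball_rpow hu hq hqp (fun n => (hCp _ (hR n)).1.1)
        (fun n => (hCq _ (hR n)).1.1) (fun n => (hCp _ (hR n)).1.2) r
      have l2 := tendsto_integral_ball_rpow hv hq hqp (fun n => (hCp _ (hR n)).2.1)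
        (fun n => (hCq _ (hR n)).2.1) (fun n => (hCp _ (hR n)).2.2) r
      have l := l1.add l2
      rw [add_zero] at l
      refine squeeze_zero (fun n => integral_nonneg fun x => le_min (hf0 x) (hg0 n x))
        (fun n => ?_) l
      rw [← integral_add (integrable_rpow_u hSq (z n)).integrableOn
        (integrable_rpow_v hSq (z n)).integrableOn]
      exact integral_mono (hmi n).integrableOn (hgi n).integrableOn fun x => min_le_right _ _
    · obtain ⟨r, hr⟩ := exists_integral_compl_ball_le hfi hδ
      exact ⟨r, fun n => (integral_mono (hmi n).integrableOn hfi.integrableOn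
        fun x => min_le_left _ _).trans hr⟩
  have hF' : Continuous (fderiv ℝ F) := hF.continuous_fderiv one_ne_zero
  set G : (ℝ × ℝ) × (ℝ × ℝ) → ℝ := fun y => fderiv ℝ F (y.1 + y.2) y.2 - fderiv ℝ F y.2 y.2
    with hG
  have hGc : Continuous G := by
    refine Continuous.sub ?_ ?_
    · exact (hF'.comp (continuous_fst.add continuous_snd)).clm_apply continuous_snd
    · exact (hF'.comp continuous_snd).clm_apply continuous_snd
  have hGh : PosHomogeneous q G := by
    intro t ht y
    have h : ∀ x, fderiv ℝ F (t • x) = t ^ (q - 1) • fderiv ℝ F x :=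
      hom.fderiv (hF.differentiable one_ne_zero) t ht
    have e : t ^ (q - 1) * t = t ^ q := by
      rw [Real.rpow_sub_one ht.ne', div_mul_cancel₀ _ ht.ne']
    simp only [hG, Prod.smul_fst, Prod.smul_snd, ← smul_add, h, smul_apply, map_smul,
      smul_eq_mul]
    rw [← e]
    ring
  refine tendsto_zero_of_le_add (A := (∫ x, f x) + 2 * Cq)
    (add_nonneg (integral_nonneg hf0) (by positivity)) hmin fun δ hδ => ?_
  obtain ⟨C, hC, hGb⟩ := hGh.exists_le_min hq0 hGc (by simp [hG]) (by simp [hG]) hδ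
  refine ⟨C, fun n => ?_⟩
  obtain ⟨i1, d1⟩ := fderiv_nonlinearPart hq1 hSq hF hom (w + z n) (z n)
  obtain ⟨i2, d2⟩ := fderiv_nonlinearPart hq1 hSq hF hom (z n) (z n)
  rw [d1, d2, ← integral_sub i1 i2, ← Real.norm_eq_abs]
  have i3 : Integrable fun x => δ * (f x + g n x) := (hfi.add (hgi n)).const_mul δ
  have hbi := i3.add ((hmi n).const_mul C)
  refine (norm_integral_le_of_norm_le hbi ?_).trans ?_
  · filter_upwards [Lp.coeFn_add w.u (z n).u, Lp.coeFn_add w.v (z n).v] with x h1 h2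
    have h1' : (w + z n).u x = w.u x + (z n).u x := h1
    have h2' : (w + z n).v x = w.v x + (z n).v x := h2
    rw [h1', h2']
    have h3 := hGb (w.u x, w.v x) ((z n).u x, (z n).v x)
    have h4 := norm_prod_rpow_le q (w.u x, w.v x)
    have h5 := norm_prod_rpow_le q ((z n).u x, (z n).v x)
    refine h3.trans ?_
    simp only [Pi.add_apply]
    gcongr
  · simp only [Pi.add_apply]
    rw [integral_add i3 ((hmi n).const_mul C), integral_const_mul, integral_const_mul,
      integral_add hfi (hgi n)]
    gcongr
    exact hgC n

/-- If the integrand vanishes on the coordinate axes, the nonlinear part tends to zero as soon as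
one of the two components does so in `L^q`. -/
theorem tendsto_nonlinearPart_of_min (hq : 1 < q) (hSq : SobolevBound N s q) (hF : Continuous F)
    (hom : PosHomogeneous q F) (h1 : ∀ x, F (x, 0) = 0) (h2 : ∀ y, F (0, y) = 0)
    {z : ℕ → EnergySpace s ha hb} (hR : ∀ n, ‖z n‖ ^ 2 ≤ R)
    (h : Tendsto (fun n => ∫ x, |(z n).u x| ^ q) atTop (𝓝 0) ∨
      Tendsto (fun n => ∫ x, |(z n).v x| ^ q) atTop (𝓝 0)) :
    Tendsto (fun n => nonlinearPart F (z n)) atTop (𝓝 0) := by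
  obtain ⟨C, hC0, hC⟩ := exists_integral_rpow_le ha hb hSq R
  have iu := fun n => integrable_rpow_u hSq (z n)
  have iv := fun n => integrable_rpow_v hSq (z n)
  have im : ∀ n, Integrable fun x => min (|(z n).u x| ^ q) (|(z n).v x| ^ q) :=
    fun n => (iu n).inf (iv n)
  have hmin : Tendsto (fun n => ∫ x, min (|(z n).u x| ^ q) (|(z n).v x| ^ q)) atTop (𝓝 0) := by
    have h0 : ∀ n, 0 ≤ ∫ x, min (|(z n).u x| ^ q) (|(z n).v x| ^ q) := fun n =>
      integral_nonneg fun x => by positivity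
    rcases h with h | h
    · exact squeeze_zero h0 (fun n => integral_mono (im n) (iu n) fun x => min_le_left _ _) h
    · exact squeeze_zero h0 (fun n => integral_mono (im n) (iv n) fun x => min_le_right _ _) h
  refine tendsto_zero_of_le_add (A := 2 * C) (by positivity) hmin fun δ hδ => ?_
  obtain ⟨D, hD, hb⟩ := hom.exists_le_min (by linarith) hF h1 h2 hδ
  refine ⟨D, fun n => ?_⟩
  have i3 : Integrable fun x => δ * (|(z n).u x| ^ q + |(z n).v x| ^ q) :=
    ((iu n).add (iv n)).const_mul δ
  have hbi := i3.add ((im n).const_mul D)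
  rw [← Real.norm_eq_abs, nonlinearPart]
  refine (norm_integral_le_of_norm_le hbi (Eventually.of_forall fun x =>
    hb ((z n).u x) ((z n).v x))).trans ?_
  simp only [Pi.add_apply]
  rw [integral_add i3 ((im n).const_mul D), integral_const_mul, integral_const_mul,
    integral_add (iu n) (iv n)]
  gcongr
  linarith [(hC _ (hR n)).1.2, (hC _ (hR n)).2.2]

theorem tendsto_integral_sq_of_coercive {u : ℕ → L2 N} (hu : VanishesLocally u)
    (ha : IsPotential a) (hi : ∀ n, Integrable fun x => a x * u n x ^ 2)
    (hR : ∀ n, ∫ x, a x * u n x ^ 2 ≤ R) (htail : ∀ K : ℝ, ∃ r, ∀ x, r ≤ ‖x‖ → K ≤ a x) :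
    Tendsto (fun n => ∫ x, u n x ^ 2) atTop (𝓝 0) := by
  have hnn : ∀ n x, 0 ≤ a x * u n x ^ 2 := fun n x => mul_nonneg (ha.pos x).le (sq_nonneg _)
  have hR0 : 0 ≤ R := (integral_nonneg (hnn 0)).trans (hR 0)
  refine tendsto_integral_of_ball_of_tail (fun n => integrable_sq_L2 (u n))
    (fun n x => sq_nonneg _) hu fun δ hδ => ?_
  obtain ⟨r, hr⟩ := htail ((R + 1) / δ)
  refine ⟨r, fun n => ?_⟩
  have hK : 0 < (R + 1) / δ := by positivity
  have key : (R + 1) / δ * ∫ x in (Metric.ball 0 r)ᶜ, u n x ^ 2 ≤ R := by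
    rw [← integral_const_mul]
    calc ∫ x in (Metric.ball 0 r)ᶜ, (R + 1) / δ * u n x ^ 2
        ≤ ∫ x in (Metric.ball 0 r)ᶜ, a x * u n x ^ 2 :=
          setIntegral_mono_on ((integrable_sq_L2 (u n)).integrableOn.const_mul _)
            (hi n).integrableOn measurableSet_ball.compl fun x hx =>
              mul_le_mul_of_nonneg_right (hr x (by simpa using hx)) (sq_nonneg _)
      _ ≤ ∫ x, a x * u n x ^ 2 := setIntegral_le_integral (hi n) (Eventually.of_forall (hnn n))
      _ ≤ R := hR n
  rw [div_mul_eq_mul_div, div_le_iff₀ hδ] at key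
  have h0 : 0 ≤ ∫ x in (Metric.ball 0 r)ᶜ, u n x ^ 2 := integral_nonneg fun x => sq_nonneg _
  nlinarith

/-- If one of the potentials tends to infinity, the nonlinear part is weakly continuous at zero. -/
theorem tendsto_nonlinearPart_of_coercive (hq : 2 < q) (hqp : q < p) (hSq : SobolevBound N s q)
    (hSp : SobolevBound N s p) (hF : Continuous F) (hom : PosHomogeneous q F)
    (h1 : ∀ x, F (x, 0) = 0) (h2 : ∀ y, F (0, y) = 0) {z : ℕ → EnergySpace s ha hb}
    (hR : ∀ n, ‖z n‖ ^ 2 ≤ R) (hu : VanishesLocally fun n => (z n).u)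
    (hv : VanishesLocally fun n => (z n).v)
    (h : (∀ K : ℝ, ∃ r, ∀ x, r ≤ ‖x‖ → K ≤ a x) ∨ ∀ K : ℝ, ∃ r, ∀ x, r ≤ ‖x‖ → K ≤ b x) :
    Tendsto (fun n => nonlinearPart F (z n)) atTop (𝓝 0) := by
  obtain ⟨C, -, hC⟩ := exists_integral_rpow_le ha hb hSp R
  refine tendsto_nonlinearPart_of_min (by linarith) hSq hF hom h1 h2 hR (h.imp ?_ ?_)
  · intro h
    exact tendsto_integral_rpow_of_sq hq hqp (fun n => integrable_sq_L2 _)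
      (fun n => integrable_rpow_u hSp _) (fun n => integrable_rpow_u hSq _)
      (fun n => (hC _ (hR n)).1.2) (tendsto_integral_sq_of_coercive hu ha
        (fun n => integrable_mul_sq_u (z n)) (fun n => (integral_mul_sq_u_le _).trans (hR n)) h)
  · intro h
    exact tendsto_integral_rpow_of_sq hq hqp (fun n => integrable_sq_L2 _)
      (fun n => integrable_rpow_v hSp _) (fun n => integrable_rpow_v hSq _)
      (fun n => (hC _ (hR n)).2.2) (tendsto_integral_sq_of_coercive hv hb
        (fun n => integrable_mul_sq_v (z n)) (fun n => (integral_mul_sq_v_le _).trans (hR n)) h)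

/-- Weak null sequences in the energy space vanish locally. -/
theorem vanishesLocally_of_tendsto_inner (hs : 0 < s) {z : ℕ → EnergySpace s ha hb}
    (hR : ∀ n, ‖z n‖ ^ 2 ≤ R) (hw : ∀ y, Tendsto (fun n => inner ℝ (z n) y) atTop (𝓝 0)) :
    VanishesLocally (fun n => (z n).u) ∧ VanishesLocally fun n => (z n).v := by
  have hw' : ∀ ℓ : EnergySpace s ha hb →L[ℝ] ℝ, Tendsto (fun n => ℓ (z n)) atTop (𝓝 0) := by
    intro ℓ
    refine (hw ((InnerProductSpace.toDual ℝ _).symm ℓ)).congr fun n => ?_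
    rw [real_inner_comm, InnerProductSpace.toDual_symm_apply]
  have hia := ha.iInf_pos
  have hib := hb.iInf_pos
  have hR0 : 0 ≤ R := (sq_nonneg _).trans (hR 0)
  constructor
  · refine vanishesLocally_of_weak hs (K := R + R / ⨅ x, a x) (fun n => integrable_u (z n) (z n))
      (fun n => ?_) (fun n => ?_) fun f => hw' ((innerSL ℝ f).comp (uL s ha hb))
    · have : 0 ≤ R / ⨅ x, a x := by positivity
      linarith [gagliardoForm_u_le (z n), hR n]
    · have : ‖z n‖ ^ 2 / (⨅ x, a x) ≤ R / ⨅ x, a x := by gcongr; exact hR n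
      linarith [integral_sq_u_le (z n)]
  · refine vanishesLocally_of_weak hs (K := R + R / ⨅ x, b x) (fun n => integrable_v (z n) (z n))
      (fun n => ?_) (fun n => ?_) fun f => hw' ((innerSL ℝ f).comp (vL s ha hb))
    · have : 0 ≤ R / ⨅ x, b x := by positivity
      linarith [gagliardoForm_v_le (z n), hR n]
    · have : ‖z n‖ ^ 2 / (⨅ x, b x) ≤ R / ⨅ x, b x := by gcongr; exact hR n
      linarith [integral_sq_v_le (z n)]

end EnergySpace

/-! ### Potentials at infinity -/

section Liminf

variable {N : ℕ} {V : Rn N → ℝ}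

theorem exists_le_of_lt_liminfAtInfinity {c : ℝ} (hc : (c : EReal) < liminfAtInfinity V) {ε : ℝ}
    (hε : 0 < ε) : ∃ r, ∀ x : Rn N, r ≤ ‖x‖ → c ≤ V (ε • x) := by
  have h : ∀ᶠ x in Bornology.cobounded (Rn N), (c : EReal) < V x :=
    eventually_lt_of_lt_liminf hc
  obtain ⟨r, -, hr⟩ := (Metric.hasBasis_cobounded_compl_ball (0 : Rn N)).eventually_iff.1 h
  refine ⟨r / ε, fun x hx => ?_⟩
  have h1 := @hr (ε • x) (by
    rw [Set.mem_compl_iff, mem_ball_zero_iff, not_lt, norm_smul, Real.norm_of_nonneg hε.le]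
    rwa [div_le_iff₀' hε] at hx)
  exact (EReal.coe_lt_coe_iff.1 h1).le

theorem IsPotential.iInf_le_liminfAtInfinity (hV : IsPotential V) :
    ((⨅ x, V x : ℝ) : EReal) ≤ liminfAtInfinity V :=
  le_liminf_of_le (by isBoundedDefault)
    (Eventually.of_forall fun x => EReal.coe_le_coe_iff.2 (hV.iInf_le x))

theorem IsPotential.coe_toReal_liminfAtInfinity (hV : IsPotential V)
    (h : liminfAtInfinity V ≠ ⊤) : ((liminfAtInfinity V).toReal : EReal) = liminfAtInfinity V := by
  refine EReal.coe_toReal h fun hb => ?_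
  have := hV.iInf_le_liminfAtInfinity
  rw [hb] at this
  exact EReal.coe_ne_bot _ (le_bot_iff.1 this)

theorem IsPotential.iInf_le_toReal (hV : IsPotential V) (h : liminfAtInfinity V ≠ ⊤) :
    ⨅ x, V x ≤ (liminfAtInfinity V).toReal := by
  have := hV.iInf_le_liminfAtInfinity
  rw [← hV.coe_toReal_liminfAtInfinity h] at this
  exact EReal.coe_le_coe_iff.1 this

/-- Replacing the potential by its lower limit at infinity costs nothing in the limit along a
locally vanishing sequence. -/
theorem IsPotential.tendsto_integral_defect (hV : IsPotential V) (h : liminfAtInfinity V ≠ ⊤)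
    {ε : ℝ} (hε : 0 < ε) {u : ℕ → L2 N} (hu : VanishesLocally u) {K : ℝ}
    (hK : ∀ n, ∫ x, u n x ^ 2 ≤ K) :
    Tendsto (fun n => ∫ x, max ((liminfAtInfinity V).toReal - V (ε • x)) 0 * u n x ^ 2) atTop
      (𝓝 0) := by
  have hm : Measurable fun x : Rn N => max ((liminfAtInfinity V).toReal - V (ε • x)) 0 :=
    ((measurable_const.sub (hV.rescale hε).continuous.measurable).max measurable_const)
  have h0 : 0 ≤ (liminfAtInfinity V).toReal := hV.iInf_pos.le.trans (hV.iInf_le_toReal h)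
  refine hu.tendsto_integral_mul_sq hK hm (fun x => le_max_right _ _)
    (M := (liminfAtInfinity V).toReal) (fun x => max_le ?_ h0) fun δ hδ => ?_
  · linarith [hV.pos (ε • x)]
  · obtain ⟨r, hr⟩ := exists_le_of_lt_liminfAtInfinity (V := V)
      (c := (liminfAtInfinity V).toReal - δ) ((EReal.coe_lt_coe_iff.2 (sub_lt_self _ hδ)).trans_eq
        (hV.coe_toReal_liminfAtInfinity h)) hε
    exact ⟨r, fun x hx => max_le (by linarith [hr x hx]) hδ.le⟩

theorem IsPotential.mul_integral_sq_le (hV : IsPotential V) (h : liminfAtInfinity V ≠ ⊤) {ε : ℝ}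
    (hε : 0 < ε) (u : L2 N) (hi : Integrable fun x => V (ε • x) * u x ^ 2) :
    (liminfAtInfinity V).toReal * ∫ x, u x ^ 2 ≤ (∫ x, V (ε • x) * u x ^ 2) +
      ∫ x, max ((liminfAtInfinity V).toReal - V (ε • x)) 0 * u x ^ 2 := by
  have hm : Measurable fun x : Rn N => max ((liminfAtInfinity V).toReal - V (ε • x)) 0 :=
    ((measurable_const.sub (hV.rescale hε).continuous.measurable).max measurable_const)
  have h0 : 0 ≤ (liminfAtInfinity V).toReal := hV.iInf_pos.le.trans (hV.iInf_le_toReal h)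
  have hi2 : Integrable fun x => max ((liminfAtInfinity V).toReal - V (ε • x)) 0 * u x ^ 2 :=
    (integrable_sq_L2 u).bdd_mul (c := (liminfAtInfinity V).toReal) hm.aestronglyMeasurable
      (Eventually.of_forall fun x => by
        rw [Real.norm_of_nonneg (le_max_right _ _)]
        exact max_le (by linarith [hV.pos (ε • x)]) h0)
  rw [← integral_const_mul, ← integral_add hi hi2]
  refine integral_mono ((integrable_sq_L2 u).const_mul _) (hi.add hi2) fun x => ?_
  have := le_max_left ((liminfAtInfinity V).toReal - V (ε • x)) 0
  simp only
  rw [← add_mul]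
  exact mul_le_mul_of_nonneg_right (by linarith) (sq_nonneg _)

end Liminf

/-! ### The level at infinity -/

section LevelAtInfinity

variable {N : ℕ} {s q : ℝ} {V W : Rn N → ℝ} {hV : IsPotential V} {hW : IsPotential W}
  {Q : ℝ × ℝ → ℝ}

open EnergySpace

/-- The quadratic part of the functional at infinity. -/
def quadInf (hV : IsPotential V) (hW : IsPotential W) (y : Xzero s hV hW) : ℝ :=
  gagliardoForm s y.u y.u + gagliardoForm s y.v y.v +
    (liminfAtInfinity V).toReal * (∫ x, y.u x ^ 2) +
    (liminfAtInfinity W).toReal * ∫ x, y.v x ^ 2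

theorem Jinf_eq (y : Xzero s hV hW) :
    Jinf s hV hW Q y = 1 / 2 * quadInf hV hW y - nonlinearPart (extend Q) y := by
  rw [Jinf, energy, quadInf, integral_add ((integrable_sq_L2 _).const_mul _)
    ((integrable_sq_L2 _).const_mul _), integral_const_mul, integral_const_mul, ← add_assoc]
  rfl

theorem quadInf_eq (y : Xzero s hV hW) :
    quadInf hV hW y = ‖y‖ ^ 2 + ((liminfAtInfinity V).toReal - ⨅ x, V x) * ‖uL s _ _ y‖ ^ 2 +
      ((liminfAtInfinity W).toReal - ⨅ x, W x) * ‖vL s _ _ y‖ ^ 2 := by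
  rw [norm_sq_eq_add, uL_apply, vL_apply, ← integral_sq_L2, ← integral_sq_L2, integral_const_mul,
    integral_const_mul, quadInf]
  ring

theorem contDiff_quadInf : ContDiff ℝ 1 (quadInf hV hW : Xzero s hV hW → ℝ) := by
  rw [funext quadInf_eq]
  exact ((contDiff_norm_sq ℝ).add (contDiff_const.mul
    ((contDiff_norm_sq ℝ).comp (uL s _ _).contDiff))).add (contDiff_const.mul
    ((contDiff_norm_sq ℝ).comp (vL s _ _).contDiff))

theorem posHomogeneous_quadInf : PosHomogeneous 2 (quadInf hV hW : Xzero s hV hW → ℝ) := by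
  intro t _ y
  rw [quadInf_eq, quadInf_eq, map_smul, map_smul, norm_smul, norm_smul, norm_smul, mul_pow, mul_pow,
    mul_pow, Real.norm_eq_abs, sq_abs, Real.rpow_two, smul_eq_mul]
  ring

theorem nehariConstraint_Jinf (hq : 1 < q) (hS : SobolevBound N s q)
    (hF : ContDiff ℝ 1 (extend Q)) (hom : PosHomogeneous q (extend Q)) (y : Xzero s hV hW) :
    nehariConstraint (Jinf s hV hW Q) y = quadInf hV hW y - q * nonlinearPart (extend Q) y := by
  have h1 := (contDiff_quadInf (hV := hV) (hW := hW) (s := s)).differentiable one_ne_zero y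
  have h2 := (contDiff_nonlinearPart (ha := IsPotential.const hV.iInf_pos)
    (hb := IsPotential.const hW.iInf_pos) hq hS hF hom).differentiable one_ne_zero y
  have h3 : HasFDerivAt (Jinf s hV hW Q) ((1 / 2 : ℝ) • fderiv ℝ (quadInf hV hW) y -
      fderiv ℝ (nonlinearPart (extend Q)) y) y := by
    rw [funext Jinf_eq]
    exact (h1.hasFDerivAt.const_mul _).sub h2.hasFDerivAt
  rw [nehariConstraint, h3.fderiv, sub_apply, smul_apply, posHomogeneous_quadInf.fderiv_apply_self h1,
    (posHomogeneous_nonlinearPart hq hS hom).fderiv_apply_self h2, smul_eq_mul]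
  ring

/-- A bound for the level at infinity: every pair on which the nonlinear part is positive can be
scaled onto the Nehari manifold at infinity. -/
theorem cInf_le (hq : 2 < q) (hS : SobolevBound N s q) (hF : ContDiff ℝ 1 (extend Q))
    (hom : PosHomogeneous q (extend Q))
    (hfin : max (liminfAtInfinity V) (liminfAtInfinity W) ≠ ⊤) (y : Xzero s hV hW)
    (hpos : 0 < nonlinearPart (extend Q) y) :
    cInf s hV hW Q ≤ (((1 / 2 - 1 / q) *
      ((quadInf hV hW y / (q * nonlinearPart (extend Q) y)) ^ (2 / (q - 2)) * quadInf hV hW y) :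
        ℝ) : EReal) := by
  have hVfin : liminfAtInfinity V ≠ ⊤ := fun h => hfin (by rw [h]; exact max_eq_left le_top)
  have hWfin : liminfAtInfinity W ≠ ⊤ := fun h => hfin (by rw [h]; exact max_eq_right le_top)
  have hq0 : 0 < q := by linarith
  have homΦ := posHomogeneous_nonlinearPart (ha := IsPotential.const hV.iInf_pos)
    (hb := IsPotential.const hW.iInf_pos) (by linarith) hS hom
  have hy : y ≠ 0 := by
    rintro rfl
    rw [homΦ.apply_zero hq0] at hpos
    exact lt_irrefl _ hpos
  have hB : 0 < quadInf hV hW y := by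
    rw [quadInf_eq]
    have h1 := hV.iInf_le_toReal hVfin
    have h2 := hW.iInf_le_toReal hWfin
    have h3 : 0 < ‖y‖ ^ 2 := pow_pos (norm_pos_iff.2 hy) 2
    have h4 := mul_nonneg (sub_nonneg.2 h1) (sq_nonneg ‖uL s _ _ y‖)
    have h5 := mul_nonneg (sub_nonneg.2 h2) (sq_nonneg ‖vL s _ _ y‖)
    linarith
  set B := quadInf hV hW y
  set P := nonlinearPart (extend Q) y
  set t : ℝ := (B / (q * P)) ^ (1 / (q - 2)) with ht
  have hb0 : 0 < B / (q * P) := by positivity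
  have ht0 : 0 < t := by positivity
  have hq2 : q - 2 ≠ 0 := by linarith
  have htq : t ^ q * (q * P) = t ^ 2 * B := by
    have e1 : t ^ (q - 2) = B / (q * P) := by
      rw [ht, ← Real.rpow_mul hb0.le, one_div_mul_cancel hq2, Real.rpow_one]
    have e2 : t ^ q = t ^ (q - 2) * t ^ 2 := by
      rw [← Real.rpow_two, ← Real.rpow_add ht0, sub_add_cancel]
    rw [e2, e1]
    field_simp
  have ht2 : t ^ 2 = (B / (q * P)) ^ (2 / (q - 2)) := by
    rw [ht, ← Real.rpow_two, ← Real.rpow_mul hb0.le, one_div_mul_eq_div]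
  have hBt : quadInf hV hW (t • y) = t ^ 2 * B := by
    rw [posHomogeneous_quadInf t ht0, Real.rpow_two, smul_eq_mul]
  have hPt : nonlinearPart (extend Q) (t • y) = t ^ q * P := by
    rw [homΦ t ht0, smul_eq_mul]
  have hmem : t • y ∈ nehari (Jinf s hV hW Q) := by
    refine ⟨smul_ne_zero ht0.ne' hy, ?_⟩
    rw [nehariConstraint_Jinf (by linarith) hS hF hom, hBt, hPt]
    linarith
  have hval : Jinf s hV hW Q (t • y) =
      (1 / 2 - 1 / q) * ((B / (q * P)) ^ (2 / (q - 2)) * B) := by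
    rw [Jinf_eq, hBt, hPt, ← ht2]
    have : t ^ q * P = t ^ 2 * B / q := by
      rw [eq_div_iff hq0.ne', ← htq]
      ring
    rw [this]
    ring
  rw [cInf, if_neg hfin, ← hval]
  exact iInf₂_le (t • y) hmem

end LevelAtInfinity

/-! ### The Palais–Smale condition -/

section PalaisSmale

variable {N : ℕ} {s p q ε d : ℝ} {V W : Rn N → ℝ} {hV : IsPotential V} {hW : IsPotential W}
  {Q : ℝ × ℝ → ℝ} {hε : 0 < ε}

open EnergySpace

/-- Below the level at infinity no mass can be lost: a locally vanishing sequence that is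
asymptotically on the Nehari manifold and does not tend to zero has a limit energy above every
`d < c_∞`. -/
theorem lt_energy_of_vanishing (hq : 2 < q) (hqp : q < p) (hSq : SobolevBound N s q)
    (hSp : SobolevBound N s p) (hF : ContDiff ℝ 1 (extend Q))
    (hom : PosHomogeneous q (extend Q)) {z : ℕ → Xeps s hV hW hε} {R L : ℝ}
    (hR : ∀ n, ‖z n‖ ^ 2 ≤ R) (hu : VanishesLocally fun n => (z n).u)
    (hv : VanishesLocally fun n => (z n).v) (hL : 0 < L)
    (hz : Tendsto (fun n => ‖z n‖ ^ 2) atTop (𝓝 L))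
    (hP : Tendsto (fun n => q * nonlinearPart (extend Q) (z n)) atTop (𝓝 L))
    (hd : (d : EReal) < cInf s hV hW Q) : d < (1 / 2 - 1 / q) * L := by
  have hq0 : 0 < q := by linarith
  by_cases hfin : max (liminfAtInfinity V) (liminfAtInfinity W) = ⊤
  · exfalso
    have htail : ∀ {U : Rn N → ℝ}, liminfAtInfinity U = ⊤ →
        ∀ K : ℝ, ∃ r, ∀ x : Rn N, r ≤ ‖x‖ → K ≤ U (ε • x) := fun hU K =>
      exists_le_of_lt_liminfAtInfinity (by rw [hU]; exact EReal.coe_lt_top K) hε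
    have h0 := tendsto_nonlinearPart_of_coercive hq hqp hSq hSp hF.continuous hom
      (fun x => extend_of_le (Or.inr le_rfl)) (fun y => extend_of_le (Or.inl le_rfl)) hR hu hv
      ((max_eq_top.1 hfin).imp htail htail)
    have h1 := h0.const_mul q
    rw [mul_zero] at h1
    exact hL.ne' (tendsto_nhds_unique hP h1)
  · have hVfin : liminfAtInfinity V ≠ ⊤ := fun h => hfin (by rw [h]; exact max_eq_left le_top)
    have hWfin : liminfAtInfinity W ≠ ⊤ := fun h => hfin (by rw [h]; exact max_eq_right le_top)
    have hκ := half_sub_one_div_pos hq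
    have hR0 : 0 ≤ R := (sq_nonneg _).trans (hR 0)
    have hu2 : ∀ n, ∫ x, (z n).u x ^ 2 ≤ R / ⨅ x, V (ε • x) := fun n =>
      (integral_sq_u_le (z n)).trans
        (div_le_div_of_nonneg_right (hR n) (hV.rescale hε).iInf_pos.le)
    have hv2 : ∀ n, ∫ x, (z n).v x ^ 2 ≤ R / ⨅ x, W (ε • x) := fun n =>
      (integral_sq_v_le (z n)).trans
        (div_le_div_of_nonneg_right (hR n) (hW.rescale hε).iInf_pos.le)
    have hβ := (hz.add (hV.tendsto_integral_defect hVfin hε hu hu2)).add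
      (hW.tendsto_integral_defect hWfin hε hv hv2)
    rw [add_zero, add_zero] at hβ
    set β : ℕ → ℝ := fun n => ‖z n‖ ^ 2 +
      (∫ x, max ((liminfAtInfinity V).toReal - V (ε • x)) 0 * (z n).u x ^ 2) +
      ∫ x, max ((liminfAtInfinity W).toReal - W (ε • x)) 0 * (z n).v x ^ 2
    have hy : ∀ n, ∃ y : Xzero s hV hW, y.u = (z n).u ∧ y.v = (z n).v := fun n =>
      ⟨⟨((z n).u, (z n).v), (z n).2.1, (z n).2.2.1, by
        refine (((integrable_sq_L2 (z n).u).const_mul (⨅ x, V x)).add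
          ((integrable_sq_L2 (z n).v).const_mul (⨅ x, W x))).congr
          (Eventually.of_forall fun x => ?_)
        simp only [potentialDensity, Pi.add_apply, sq]⟩, rfl, rfl⟩
    choose y hyu hyv using hy
    have hquad : ∀ n, quadInf hV hW (y n) ≤ β n := fun n => by
      rw [quadInf, hyu, hyv]
      have h1 := hV.mul_integral_sq_le hVfin hε (z n).u (integrable_mul_sq_u (z n))
      have h2 := hW.mul_integral_sq_le hWfin hε (z n).v (integrable_mul_sq_v (z n))
      have h3 := norm_sq_eq_add (z n)
      simp only [β]
      linarith
    have hnl : ∀ n, nonlinearPart (extend Q) (y n) = nonlinearPart (extend Q) (z n) := fun n => by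
      rw [nonlinearPart, nonlinearPart, hyu, hyv]
    obtain ⟨c, hdc, hc⟩ := EReal.lt_iff_exists_real_btwn.1 hd
    refine (EReal.coe_lt_coe_iff.1 hdc).trans_le ?_
    have hexp : 0 < 2 / (q - 2) := div_pos two_pos (by linarith)
    have hlim : Tendsto (fun n => (1 / 2 - 1 / q) *
        ((β n / (q * nonlinearPart (extend Q) (z n))) ^ (2 / (q - 2)) * β n)) atTop
        (𝓝 ((1 / 2 - 1 / q) * ((L / L) ^ (2 / (q - 2)) * L))) :=
      (((hβ.div hP hL.ne').rpow_const (Or.inr hexp.le)).mul hβ).const_mul _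
    rw [div_self hL.ne', Real.one_rpow, one_mul] at hlim
    refine ge_of_tendsto hlim ?_
    filter_upwards [hP.eventually (lt_mem_nhds hL)] with n hn
    have hn' : 0 < nonlinearPart (extend Q) (z n) := (mul_pos_iff_of_pos_left hq0).1 hn
    have h1 := hc.le.trans (cInf_le hq hSq hF hom hfin (y n) (by rwa [hnl]))
    rw [EReal.coe_le_coe_iff, hnl] at h1
    refine h1.trans ?_
    have hB0 : 0 ≤ quadInf hV hW (y n) := by
      rw [quadInf]
      have := gagliardoForm_self_nonneg (s := s) ((y n).u : Rn N → ℝ)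
      have := gagliardoForm_self_nonneg (s := s) ((y n).v : Rn N → ℝ)
      have := mul_nonneg (hV.iInf_pos.le.trans (hV.iInf_le_toReal hVfin))
        (integral_nonneg fun x => sq_nonneg ((y n).u x) : 0 ≤ ∫ x, (y n).u x ^ 2)
      have := mul_nonneg (hW.iInf_pos.le.trans (hW.iInf_le_toReal hWfin))
        (integral_nonneg fun x => sq_nonneg ((y n).v x) : 0 ≤ ∫ x, (y n).v x ^ 2)
      linarith
    have hβn := hquad n
    have hβ0 := hB0.trans hβn
    gcongr

theorem satisfiesConstrainedPS (hs : 0 < s) (hq : 2 < q) (hqp : q < p)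
    (hSq : SobolevBound N s q) (hSp : SobolevBound N s p) (hF : ContDiff ℝ 1 (extend Q))
    (hom : PosHomogeneous q (extend Q)) (hd : (d : EReal) < cInf s hV hW Q) :
    SatisfiesConstrainedPS (Jeps s hV hW hε Q) d := by
  intro w hw
  have hq1 : 1 < q := by linarith
  have hJ : ∀ w : Xeps s hV hW hε,
      Jeps s hV hW hε Q w = 1 / 2 * ‖w‖ ^ 2 - nonlinearPart (extend Q) w := Jeps_eq s hV hW hε Q
  have hΦ : ContDiff ℝ 1 (nonlinearPart (extend Q) : Xeps s hV hW hε → ℝ) :=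
    contDiff_nonlinearPart hq1 hSq hF hom
  have homΦ : PosHomogeneous q (nonlinearPart (extend Q) : Xeps s hV hW hε → ℝ) :=
    posHomogeneous_nonlinearPart hq1 hSq hom
  have hκ := half_sub_one_div_pos hq
  have hn := hw.tendsto_norm_sq hq hJ hΦ homΦ
  obtain ⟨R₀, hR₀⟩ := hn.bddAbove_range
  have hwR : ∀ n, ‖w n‖ ≤ √R₀ := fun n => Real.le_sqrt_of_sq_le (hR₀ ⟨n, rfl⟩)
  have hd0 := hw.tendsto_fderiv hq hJ hΦ homΦ hwR
  obtain ⟨k, w₀, hk, hweak⟩ := exists_weak_subseq hwR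
  set z : ℕ → Xeps s hV hW hε := fun n => w (k n) - w₀ with hzdef
  have hzR : ∀ n, ‖z n‖ ≤ √R₀ + ‖w₀‖ := fun n =>
    (norm_sub_le _ _).trans (by gcongr; exact hwR _)
  have hzR2 : ∀ n, ‖z n‖ ^ 2 ≤ (√R₀ + ‖w₀‖) ^ 2 := fun n =>
    pow_le_pow_left₀ (norm_nonneg _) (hzR n) 2
  have hzweak : ∀ y, Tendsto (fun n => inner ℝ (z n) y) atTop (𝓝 0) := fun y => by
    have h := (hweak y).sub_const (inner ℝ w₀ y)
    rw [sub_self] at h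
    exact h.congr fun n => (inner_sub_left _ _ _).symm
  obtain ⟨hu, hv⟩ := vanishesLocally_of_tendsto_inner hs hzR2 hzweak
  set D := d / (1 / 2 - 1 / q) with hD
  have hz2 : Tendsto (fun n => ‖z n‖ ^ 2) atTop (𝓝 (D - ‖w₀‖ ^ 2)) := by
    have h := ((hn.comp hk.tendsto_atTop).sub ((hweak w₀).const_mul 2)).add_const (‖w₀‖ ^ 2)
    rw [real_inner_self_eq_norm_sq] at h
    have e : D - 2 * ‖w₀‖ ^ 2 + ‖w₀‖ ^ 2 = D - ‖w₀‖ ^ 2 := by ring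
    rw [e] at h
    exact h.congr fun n => (norm_sub_sq_real _ _).symm
  set L := D - ‖w₀‖ ^ 2
  -- `⟨J'(w_n), z_n⟩ → 0`, and `w₀` contributes nothing to this pairing in the limit
  have hP : Tendsto (fun n => q * nonlinearPart (extend Q) (z n)) atTop (𝓝 L) := by
    have h1 : Tendsto (fun n => fderiv ℝ (Jeps s hV hW hε Q) (w (k n)) (z n)) atTop (𝓝 0) := by
      have hsq := (hd0.comp hk.tendsto_atTop).mul_const (√R₀ + ‖w₀‖)
      rw [zero_mul] at hsq
      refine squeeze_zero_norm (fun n => ?_) hsq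
      exact (ContinuousLinearMap.le_opNorm _ _).trans
        (mul_le_mul_of_nonneg_left (hzR n) (norm_nonneg _))
    have h2 := tendsto_fderiv_nonlinearPart_sub hq hqp hSq hSp hF hom hzR2 hu hv w₀
    have h3 := ((hz2.add (hzweak w₀)).sub h1).sub h2
    rw [add_zero, sub_zero, sub_zero] at h3
    refine h3.congr fun n => ?_
    have e1 : w₀ + z n = w (k n) := by simp [hzdef]
    have e2 : inner ℝ (w (k n)) (z n) = ‖z n‖ ^ 2 + inner ℝ (z n) w₀ := by
      rw [← e1, inner_add_left, real_inner_self_eq_norm_sq, real_inner_comm]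
      ring
    rw [e1, fderiv_energy hJ hΦ, e2,
      homΦ.fderiv_apply_self (hΦ.differentiable one_ne_zero (z n))]
    ring
  have hL0 : 0 ≤ L := ge_of_tendsto' hz2 fun n => sq_nonneg _
  have hL : L = 0 := by
    by_contra hne
    have h := lt_energy_of_vanishing hq hqp hSq hSp hF hom hzR2 hu hv (lt_of_le_of_ne hL0 (Ne.symm hne))
      hz2 hP hd
    have h1 : (1 / 2 - 1 / q) * L ≤ (1 / 2 - 1 / q) * D := by
      gcongr
      exact sub_le_self _ (sq_nonneg _)
    rw [hD, mul_div_cancel₀ _ hκ.ne'] at h1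
    linarith
  rw [hL] at hz2
  have hz0 : Tendsto z atTop (𝓝 0) := by
    rw [tendsto_zero_iff_norm_tendsto_zero]
    have h := hz2.sqrt
    rw [Real.sqrt_zero] at h
    exact h.congr fun n => Real.sqrt_sq (norm_nonneg _)
  have hlim : Tendsto (w ∘ k) atTop (𝓝 w₀) := by
    have h := hz0.add_const w₀
    rw [zero_add] at h
    exact h.congr fun n => sub_add_cancel _ _
  refine ⟨w₀, ⟨?_, ?_⟩, k, hk, hlim⟩
  · obtain ⟨c, hc, hcw⟩ := exists_le_norm_of_mem_nehari hq hJ hΦ homΦ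
    have h : c ≤ ‖w₀‖ := ge_of_tendsto' hlim.norm fun n => hcw _ (hw.1 (k n))
    exact norm_pos_iff.1 (hc.trans_le h)
  · have h := ((contDiff_nehariConstraint hJ hΦ homΦ).continuous.tendsto w₀).comp hlim
    refine tendsto_nhds_unique h ?_
    exact tendsto_const_nhds.congr fun n => (hw.1 (k n)).2.symm

end PalaisSmale

end FracSystem

end

theorem theorem4p3
    (N : ℕ) (s : ℝ) (hs0 : 0 < s) (hs1 : s < 1) (hN : 2 * s < (N : ℝ))
    (V W : FracSystem.Rn N → ℝ)
    (hV : FracSystem.IsPotential V) (hW : FracSystem.IsPotential W)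
    (hH1 : (⨅ x, V x) = ⨅ x, W x)
    (hM : ∃ x, V x = (⨅ y, V y) ∧ W x = ⨅ y, V y)
    (hH2 : ((⨅ x, V x : ℝ) : EReal) <
      max (FracSystem.liminfAtInfinity V) (FracSystem.liminfAtInfinity W))
    (q : ℝ) (Q : ℝ × ℝ → ℝ) (hQ : FracSystem.IsNonlinearity N s q Q)
    (ε : ℝ) (hε : 0 < ε) :
    ContDiff ℝ 1 (FracSystem.Jeps s hV hW hε Q) ∧
    ContDiff ℝ 1 (FracSystem.nehariConstraint (FracSystem.Jeps s hV hW hε Q)) ∧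
    (∀ d : ℝ, (d : EReal) < FracSystem.cInf s hV hW Q →
      FracSystem.SatisfiesConstrainedPS (FracSystem.Jeps s hV hW hε Q) d) ∧
    (∀ w ∈ FracSystem.nehari (FracSystem.Jeps s hV hW hε Q),
      FracSystem.constrainedDeriv (FracSystem.Jeps s hV hW hε Q) w = 0 →
        fderiv ℝ (FracSystem.Jeps s hV hW hε Q) w = 0) := by
  obtain ⟨p, hqp, hSp⟩ := FracSystem.exists_sobolevBound hN hs0 hQ.lt_critical
  have hq := hQ.two_lt
  have hSq := hSp.interpolate hq.le hqp.le
  have hF := hQ.contDiff_extend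
  have hom := hQ.posHomogeneous_extend
  have hJ := FracSystem.Jeps_eq s hV hW hε Q
  have hΦ := FracSystem.EnergySpace.contDiff_nonlinearPart (ha := hV.rescale hε)
    (hb := hW.rescale hε) (by linarith) hSq hF hom
  have homΦ := FracSystem.EnergySpace.posHomogeneous_nonlinearPart (ha := hV.rescale hε)
    (hb := hW.rescale hε) (by linarith) hSq hom
  exact ⟨FracSystem.contDiff_energy hJ hΦ, FracSystem.contDiff_nehariConstraint hJ hΦ homΦ,
    fun d hd => FracSystem.satisfiesConstrainedPS hs0 hq hqp hSq hSp hF hom hd,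
    fun w hw h0 => FracSystem.fderiv_eq_zero_of_constrainedDeriv hq hJ hΦ homΦ hw h0⟩
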